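/- For $\tau$ in the upper half-plane $\mathbb H$ write $y=\operatorname{Im}\tau$, $q^r=e^{2\pi i r\tau}$, $\zeta_n=e^{2\pi i/n}$, $(a;q)_\infty=\prod_{n\ge0}(1-aq^n)$, $(a)_\infty=(a;q)_\infty$, and let $\eta$ be the Dedekind eta function. Define the fifth-order mock theta functions ($|q|<1$) by $$1+2\psi_0(q)=\tfrac{(-q)_\infty}{(q)_\infty}\Bigl(1+2\sum_{n\ge1}(-1)^nq^{n^2+n}-2\sum_{n\ge1,\,|j|<n}(-1)^jq^{\frac52n^2-\frac12n-\frac32j^2-\frac12j}(1-q^n)\Bigr),$$ $$\psi_1(q)=\tfrac{(-q)_\infty}{(q)_\infty}\sum_{n\ge0,\,|j|\le n}(-1)^jq^{\frac52n^2+\frac32n-\frac32j^2-\frac12j}(1-q^{2n+1}),$$ $$\phi_0(q)=\tfrac{(-q;q^2)_\infty}{(q^2;q^2)_\infty}\sum_{n\ge0,\,|j|\le n}(-1)^jq^{5n^2+2n-3j^2-j}(1-q^{6n+3}),$$ $$\phi_1(q)=q\,\tfrac{(-q;q^2)_\infty}{(q^2;q^2)_\infty}\sum_{n\ge0,\,|j|\le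 n}(-1)^jq^{5n^2+4n-3j^2-j}(1-q^{2n+1}).$$ Put $E(x)=2\int_0^xe^{-\pi u^2}du$, $\beta(x)=\int_x^\infty u^{-1/2}e^{-\pi u}du$, and for $a,b\in\mathbb R$ $$R_{a,b}(\tau)=\sum_{\nu\in a+\mathbb Z}\operatorname{sgn}(\nu)\,\beta(2\nu^2y)\,e^{-\pi i\nu^2\tau-2\pi i\nu b}.$$ Let $A=\operatorname{diag}(5,-3)$, $B(x,y)=\langle x,Ay\rangle$, $Q(x)=\frac12B(x,x)$, $c_1=(3,5)$, $c_2=(-3,5)$ (so $Q(c_1)=Q(c_2)=-15$), and for $a,b\in\mathbb R^2$ $$\theta_{a,b}(\tau)=\sum_{\nu\in a+\mathbb Z^2}\Bigl\{E\Bigl(\tfrac{B(c_1,\nu)}{\sqrt{-Q(c_1)}}\sqrt y\Bigr)-E\Bigl(\tfrac{B(c_2,\nu)}{\sqrt{-Q(c_2)}}\sqrt y\Bigr)\Bigr\}e^{2\pi iQ(\nu)\tau+2\pi iB(\nu,b)}.$$ Define the vector-valued functions $$F_{5,2}(\tau)=\begin{pmatrix}2q^{-1/60}\psi_0(q)\\2q^{11/60}\psi_1(q)\\q^{-1/240}\phi_0(-q^{1/2})\\-q^{-49/240}\phi_1(-q^{1/2})\\q^{-1/240}\phi_0(q^{1/2})\\q^{-49/240}\phi_1(q^{1/2})\end{pmatrix},\qquad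 H_{5,2}(\tau)=\frac1{2\eta(\tau)^2}\begin{pmatrix}2\zeta_{12}\,\eta(2\tau)\,\theta_{(1/10,1/6),(0,1/6)}(\tau)\\2\zeta_{12}\,\eta(2\tau)\,\theta_{(3/10,1/6),(0,1/6)}(\tau)\\\zeta_{60}^{-1}\eta(\tau/2)\,\theta_{(1/5,1/6),(1/10,1/6)}(\tau)\\\zeta_{60}^{-7}\eta(\tau/2)\,\theta_{(2/5,1/6),(1/10,1/6)}(\tau)\\\zeta_{16}\,\eta((\tau+1)/2)\,\theta_{(1/5,1/6),(0,1/6)}(\tau)\\\zeta_{16}\,\eta((\tau+1)/2)\,\theta_{(2/5,1/6),(0,1/6)}(\tau)\end{pmatrix},$$ $$G_{5,1}(\tau)=\frac12\begin{pmatrix}2\zeta_{12}R_{\frac1{30},\frac52}+2\zeta_{12}^{-1}R_{\frac{11}{30},\frac52}\\2\zeta_{12}R_{\frac{13}{30},\frac52}+2\zeta_{12}^{-1}R_{\frac{23}{30},\frac52}\\-R_{\frac{19}{60},0}-R_{\frac{29}{60},0}+R_{\frac{49}{60},0}+R_{\frac{59}{60},0}\\-R_{\frac{13}{60},0}-R_{\frac{23}{60},0}+R_{\frac{43}{60},0}+R_{\frac{53}{60},0}\\\zeta_{24}^{-5}R_{\frac{19}{60},\frac52}+\zeta_{24}^5R_{\frac{29}{60},\frac52}+\zeta_{24}R_{\frac{49}{60},\frac52}+\zeta_{24}^{-1}R_{\frac{59}{60},\frac52}\\\zeta_{24}R_{\frac{13}{60},\frac52}+\zeta_{24}^{-1}R_{\frac{23}{60},\frac52}+\zeta_{24}^{-5}R_{\frac{43}{60},\frac52}+\zeta_{24}^5R_{\frac{53}{60},\frac52}\end{pmatrix}(30\tau),$$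 and let $G_{5,2}(\tau)$ be $-\frac12$ times the same vector evaluated at $30\tau$. Proposition. On $\mathbb H$ one has $F_{5,2}=H_{5,2}+G_{5,2}$, where: (1) $H_{5,2}$ is a vector-valued real-analytic modular form of weight $1/2$: it is real-analytic on $\mathbb H$, it satisfies $$H_{5,2}(\tau+1)=\begin{pmatrix}\zeta_{60}^{-1}&0&0&0&0&0\\0&\zeta_{60}^{11}&0&0&0&0\\0&0&0&0&\zeta_{240}^{-1}&0\\0&0&0&0&0&\zeta_{240}^{71}\\0&0&\zeta_{240}^{-1}&0&0&0\\0&0&0&\zeta_{240}^{71}&0&0\end{pmatrix}H_{5,2}(\tau),\qquad H_{5,2}\Bigl(-\frac1\tau\Bigr)=\sqrt{-i\tau}\,\frac2{\sqrt5}\,M_5\,H_{5,2}(\tau)$$ (principal branch of the square root) with $$M_5=\begin{pmatrix}0&0&\sqrt2\sin\frac\pi5&\sqrt2\sin\frac{2\pi}5&0&0\\0&0&\sqrt2\sin\frac{2\pi}5&-\sqrt2\sin\frac\pi5&0&0\\\frac1{\sqrt2}\sin\frac\pi5&\frac1{\sqrt2}\sin\frac{2\pi}5&0&0&0&0\\\frac1{\sqrt2}\sin\frac{2\pi}5&-\frac1{\sqrt2}\sin\frac\pi5&0&0&0&0\\0&0&0&0&\sin\frac{2\pi}5&\sin\frac\pi5\\0&0&0&0&\sin\frac\pi5&-\sin\frac{2\pi}5\end{pmatrix},$$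 it is $O(e^{Ky})$ for some real $K$, uniformly for $y\ge1$, and it is a nonzero eigenfunction, with eigenvalue $\frac3{16}$, of the weight $1/2$ Casimir operator $$\Omega_{\frac12}=-4y^2\frac{\partial^2}{\partial\tau\,\partial\bar\tau}+iy\frac{\partial}{\partial\bar\tau}+\frac3{16}.$$ (2) $G_{5,2}=-G_{5,1}$, and $G_{5,2}$ is bounded as $\tau$ tends vertically to any rational point: for every $\xi\in\mathbb Q$, $G_{5,2}(\xi+it)$ remains bounded as $t\downarrow0$. -/

import Mathlib

namespace MockTheta

open Complex Filter Topology MeasureTheory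
open scoped Real Matrix

noncomputable section

/-! ### Elementary notation -/

/-- `ζ n = exp (2πi / n)`. -/
def ζ (n : ℕ) : ℂ := exp (2 * π * I / n)

/-- `qpow r τ` is `q ^ r` for `q = exp (2πiτ)`, that is, `exp (2πirτ)`. -/
def qpow (r : ℚ) (τ : ℂ) : ℂ := exp (2 * π * I * r * τ)

/-- The infinite `q`-Pochhammer symbol `(a; q)_∞ = ∏_{n ≥ 0} (1 - a q ^ n)`. -/
def qPoch (a q : ℂ) : ℂ := ∏' n : ℕ, (1 - a * q ^ n)

/-! ### Fifth order mock theta functions, given by Hecke-type double sums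

They are functions of the nome `q`, used for `0 < ‖q‖ < 1`.  All the integer divisions by `2` in the
exponents are exact. -/

/-- `1 + 2 ψ₀(q) = (-q)_∞ / (q)_∞ * (1 + 2 ∑_{n ≥ 1} (-1)^n q^(n²+n)
  - 2 ∑_{n ≥ 1, |j| < n} (-1)^j q^(5n²/2 - n/2 - 3j²/2 - j/2) (1 - q^n))`. -/
def psi0 (q : ℂ) : ℂ :=
  (qPoch (-q) q / qPoch q q *
      (1 + 2 * (∑' m : ℕ, (-1 : ℂ) ^ (m + 1) * q ^ ((m + 1) ^ 2 + (m + 1)))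
        - 2 * (∑' m : ℕ, ∑ j ∈ Finset.Icc (-(m : ℤ)) m,
            (-1 : ℂ) ^ j *
              q ^ ((5 * ((m : ℤ) + 1) ^ 2 - ((m : ℤ) + 1) - 3 * j ^ 2 - j) / 2) *
                (1 - q ^ (m + 1)))) - 1) / 2

/-- `ψ₁(q) = (-q)_∞ / (q)_∞ *
  ∑_{n ≥ 0, |j| ≤ n} (-1)^j q^(5n²/2 + 3n/2 - 3j²/2 - j/2) (1 - q^(2n+1))`. -/
def psi1 (q : ℂ) : ℂ :=
  qPoch (-q) q / qPoch q q *
    ∑' n : ℕ, ∑ j ∈ Finset.Icc (-(n : ℤ)) n,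
      (-1 : ℂ) ^ j * q ^ ((5 * (n : ℤ) ^ 2 + 3 * n - 3 * j ^ 2 - j) / 2) *
        (1 - q ^ (2 * n + 1))

/-- `φ₀(q) = (-q; q²)_∞ / (q²; q²)_∞ *
  ∑_{n ≥ 0, |j| ≤ n} (-1)^j q^(5n² + 2n - 3j² - j) (1 - q^(6n+3))`. -/
def phi0 (q : ℂ) : ℂ :=
  qPoch (-q) (q ^ 2) / qPoch (q ^ 2) (q ^ 2) *
    ∑' n : ℕ, ∑ j ∈ Finset.Icc (-(n : ℤ)) n,
      (-1 : ℂ) ^ j * q ^ (5 * (n : ℤ) ^ 2 + 2 * n - 3 * j ^ 2 - j) * (1 - q ^ (6 * n + 3))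

/-- `φ₁(q) = q (-q; q²)_∞ / (q²; q²)_∞ *
  ∑_{n ≥ 0, |j| ≤ n} (-1)^j q^(5n² + 4n - 3j² - j) (1 - q^(2n+1))`. -/
def phi1 (q : ℂ) : ℂ :=
  q * (qPoch (-q) (q ^ 2) / qPoch (q ^ 2) (q ^ 2)) *
    ∑' n : ℕ, ∑ j ∈ Finset.Icc (-(n : ℤ)) n,
      (-1 : ℂ) ^ j * q ^ (5 * (n : ℤ) ^ 2 + 4 * n - 3 * j ^ 2 - j) * (1 - q ^ (2 * n + 1))

/-- The vector `F_{5,2}`; here `q = exp (2πiτ)` and `q^(1/2) = exp (πiτ)`. -/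
def F52 (τ : ℂ) : Fin 6 → ℂ :=
  ![2 * qpow (-1 / 60) τ * psi0 (qpow 1 τ),
    2 * qpow (11 / 60) τ * psi1 (qpow 1 τ),
    qpow (-1 / 240) τ * phi0 (-qpow (1 / 2) τ),
    -qpow (-49 / 240) τ * phi1 (-qpow (1 / 2) τ),
    qpow (-1 / 240) τ * phi0 (qpow (1 / 2) τ),
    qpow (-49 / 240) τ * phi1 (qpow (1 / 2) τ)]

/-! ### Indefinite theta functions with characteristics -/

/-- `E(x) = 2 ∫_0^x exp (-π u²) du`. -/
def E (x : ℝ) : ℝ := 2 * ∫ u in (0 : ℝ)..x, Real.exp (-π * u ^ 2)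

/-- The bilinear form `B(x, y) = ⟨x, A y⟩`. -/
def bil {r : ℕ} (A : Matrix (Fin r) (Fin r) ℝ) (x y : Fin r → ℝ) : ℝ := x ⬝ᵥ (A *ᵥ y)

/-- The quadratic form `Q(x) = ⟨x, A x⟩ / 2`. -/
def quad {r : ℕ} (A : Matrix (Fin r) (Fin r) ℝ) (x : Fin r → ℝ) : ℝ := bil A x x / 2

open Classical in
/-- `ρ^c(ν; τ)` as a function of `y = im τ`: the first case is that of a vector `c` inside the
negative cone, the second one that of a vector with `Q(c) = 0`. -/
def rhoOne {r : ℕ} (A : Matrix (Fin r) (Fin r) ℝ) (c ν : Fin r → ℝ) (y : ℝ) : ℝ :=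
  if quad A c < 0 then E (bil A c ν / √(-quad A c) * √y) else Real.sign (bil A c ν)

/-- The indefinite theta function
`θ_{a,b}^{c₁,c₂}(τ) = ∑_{ν ∈ a + ℤ^r} (ρ^{c₁}(ν; τ) - ρ^{c₂}(ν; τ)) exp (2πi Q(ν) τ + 2πi B(ν, b))`. -/
def indefTheta {r : ℕ} (A : Matrix (Fin r) (Fin r) ℝ) (c₁ c₂ a b : Fin r → ℝ) (τ : ℂ) : ℂ :=
  ∑' n : Fin r → ℤ,
    ((rhoOne A c₁ (fun i => a i + n i) τ.im - rhoOne A c₂ (fun i => a i + n i) τ.im : ℝ) : ℂ) *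
      exp (2 * π * I * (quad A (fun i => a i + n i) : ℝ) * τ
        + 2 * π * I * (bil A (fun i => a i + n i) b : ℝ))

/-- `θ_{a,b}` for `A = diag(5, -3)`, `c₁ = (3, 5)`, `c₂ = (-3, 5)`. -/
def theta (a b : Fin 2 → ℝ) (τ : ℂ) : ℂ :=
  indefTheta !![5, 0; 0, -3] ![3, 5] ![-3, 5] a b τ

/-- The vector `H_{5,2}`. -/
def H52 (τ : ℂ) : Fin 6 → ℂ :=
  (1 / (2 * ModularForm.eta τ ^ 2)) •
    ![2 * ζ 12 * ModularForm.eta (2 * τ) * theta ![1 / 10, 1 / 6] ![0, 1 / 6] τ,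
      2 * ζ 12 * ModularForm.eta (2 * τ) * theta ![3 / 10, 1 / 6] ![0, 1 / 6] τ,
      ζ 60 ^ (-1 : ℤ) * ModularForm.eta (τ / 2) * theta ![1 / 5, 1 / 6] ![1 / 10, 1 / 6] τ,
      ζ 60 ^ (-7 : ℤ) * ModularForm.eta (τ / 2) * theta ![2 / 5, 1 / 6] ![1 / 10, 1 / 6] τ,
      ζ 16 * ModularForm.eta ((τ + 1) / 2) * theta ![1 / 5, 1 / 6] ![0, 1 / 6] τ,
      ζ 16 * ModularForm.eta ((τ + 1) / 2) * theta ![2 / 5, 1 / 6] ![0, 1 / 6] τ]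

/-! ### Non-holomorphic unary theta series -/

/-- `β(x) = ∫_x^∞ u^(-1/2) exp (-π u) du`, for `x ≥ 0`. -/
def β (x : ℝ) : ℝ := ∫ u in Set.Ioi x, u ^ (-1 / 2 : ℝ) * Real.exp (-π * u)

/-- `R_{a,b}(τ) = ∑_{ν ∈ a + ℤ} sgn(ν) β(2 ν² y) exp (-πi ν² τ - 2πi ν b)`, `y = im τ`. -/
def R (a b : ℝ) (τ : ℂ) : ℂ :=
  ∑' n : ℤ, ((Real.sign (a + n) * β (2 * (a + n) ^ 2 * τ.im) : ℝ) : ℂ) *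
    exp (-π * I * (a + n) ^ 2 * τ - 2 * π * I * (a + n) * b)

/-- The vector of combinations of unary theta series common to `G_{5,1}` and `G_{5,2}`. -/
def unaryVec (τ : ℂ) : Fin 6 → ℂ :=
  ![2 * ζ 12 * R (1 / 30) (5 / 2) τ + 2 * ζ 12 ^ (-1 : ℤ) * R (11 / 30) (5 / 2) τ,
    2 * ζ 12 * R (13 / 30) (5 / 2) τ + 2 * ζ 12 ^ (-1 : ℤ) * R (23 / 30) (5 / 2) τ,
    -R (19 / 60) 0 τ - R (29 / 60) 0 τ + R (49 / 60) 0 τ + R (59 / 60) 0 τ,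
    -R (13 / 60) 0 τ - R (23 / 60) 0 τ + R (43 / 60) 0 τ + R (53 / 60) 0 τ,
    ζ 24 ^ (-5 : ℤ) * R (19 / 60) (5 / 2) τ + ζ 24 ^ 5 * R (29 / 60) (5 / 2) τ
      + ζ 24 * R (49 / 60) (5 / 2) τ + ζ 24 ^ (-1 : ℤ) * R (59 / 60) (5 / 2) τ,
    ζ 24 * R (13 / 60) (5 / 2) τ + ζ 24 ^ (-1 : ℤ) * R (23 / 60) (5 / 2) τ
      + ζ 24 ^ (-5 : ℤ) * R (43 / 60) (5 / 2) τ + ζ 24 ^ 5 * R (53 / 60) (5 / 2) τ]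

/-- The vector `G_{5,1}`. -/
def G51 (τ : ℂ) : Fin 6 → ℂ := (1 / 2 : ℂ) • unaryVec (30 * τ)

/-- The vector `G_{5,2}`. -/
def G52 (τ : ℂ) : Fin 6 → ℂ := (-(1 / 2) : ℂ) • unaryVec (30 * τ)

/-! ### The Casimir operator and real-analytic modular forms of weight 1/2 -/

/-- `∂/∂τ = (∂/∂x - i ∂/∂y) / 2`. -/
def dTau {V : Type*} [NormedAddCommGroup V] [NormedSpace ℂ V] (f : ℂ → V) (τ : ℂ) : V :=
  (1 / 2 : ℂ) • (fderiv ℝ f τ 1 - I • fderiv ℝ f τ I)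

/-- `∂/∂τ̄ = (∂/∂x + i ∂/∂y) / 2`. -/
def dTauBar {V : Type*} [NormedAddCommGroup V] [NormedSpace ℂ V] (f : ℂ → V) (τ : ℂ) : V :=
  (1 / 2 : ℂ) • (fderiv ℝ f τ 1 + I • fderiv ℝ f τ I)

/-- The weight `1/2` Casimir operator `-4 y² ∂²/∂τ∂τ̄ + i y ∂/∂τ̄ + 3/16`, `y = im τ`. -/
def casimir {V : Type*} [NormedAddCommGroup V] [NormedSpace ℂ V] (f : ℂ → V) (τ : ℂ) : V :=
  (-4 * (τ.im : ℂ) ^ 2) • dTau (dTauBar f) τ + (I * (τ.im : ℂ)) • dTauBar f τ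
    + (3 / 16 : ℂ) • f τ

/-- `f` is an eigenfunction of the weight `1/2` Casimir operator on the upper half-plane, with
eigenvalue `l`. -/
def IsCasimirEigenfunction {V : Type*} [NormedAddCommGroup V] [NormedSpace ℂ V]
    (f : ℂ → V) (l : ℂ) : Prop :=
  (∃ τ : ℂ, 0 < τ.im ∧ f τ ≠ 0) ∧ ∀ τ : ℂ, 0 < τ.im → casimir f τ = l • f τ

/-- `f` is a vector-valued real-analytic modular form of weight `1/2` with eigenvalue `l` whose
transformations under `τ ↦ τ + 1` and `τ ↦ -1/τ` are given by the matrices `T` and `S`.  Poles at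
the cusp are allowed (at most exponential growth as `im τ → ∞`), as for weakly holomorphic forms. -/
structure IsRealAnalyticModularForm {n : ℕ} (T S : Matrix (Fin n) (Fin n) ℂ) (l : ℂ)
    (f : ℂ → Fin n → ℂ) : Prop where
  analytic : AnalyticOnNhd ℝ f {τ : ℂ | 0 < τ.im}
  map_T : ∀ τ : ℂ, 0 < τ.im → f (τ + 1) = T *ᵥ f τ
  map_S : ∀ τ : ℂ, 0 < τ.im → f (-1 / τ) = (-I * τ) ^ (1 / 2 : ℂ) • (S *ᵥ f τ)
  eigen : IsCasimirEigenfunction f l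
  growth : ∃ C K : ℝ, ∀ τ : ℂ, 1 ≤ τ.im → ‖f τ‖ ≤ C * Real.exp (K * τ.im)

/-- `f` is bounded as `τ` tends vertically to any rational point. -/
def BoundedAtRationals {V : Type*} [NormedAddCommGroup V] (f : ℂ → V) : Prop :=
  ∀ ξ : ℚ, ∃ C : ℝ, ∀ᶠ t : ℝ in 𝓝[>] 0, ‖f ((ξ : ℂ) + t * I)‖ ≤ C

/-! ### The transformation matrices -/

/-- The matrix of `τ ↦ τ + 1`. -/
def T5 : Matrix (Fin 6) (Fin 6) ℂ :=
  !![ζ 60 ^ (-1 : ℤ), 0, 0, 0, 0, 0;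
     0, ζ 60 ^ 11, 0, 0, 0, 0;
     0, 0, 0, 0, ζ 240 ^ (-1 : ℤ), 0;
     0, 0, 0, 0, 0, ζ 240 ^ 71;
     0, 0, ζ 240 ^ (-1 : ℤ), 0, 0, 0;
     0, 0, 0, ζ 240 ^ 71, 0, 0]

/-- The matrix `M₅`, with real entries. -/
def M5 : Matrix (Fin 6) (Fin 6) ℝ :=
  !![0, 0, √2 * Real.sin (π / 5), √2 * Real.sin (2 * π / 5), 0, 0;
     0, 0, √2 * Real.sin (2 * π / 5), -(√2 * Real.sin (π / 5)), 0, 0;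
     1 / √2 * Real.sin (π / 5), 1 / √2 * Real.sin (2 * π / 5), 0, 0, 0, 0;
     1 / √2 * Real.sin (2 * π / 5), -(1 / √2 * Real.sin (π / 5)), 0, 0, 0, 0;
     0, 0, 0, 0, Real.sin (2 * π / 5), Real.sin (π / 5);
     0, 0, 0, 0, Real.sin (π / 5), -Real.sin (2 * π / 5)]

/-- The matrix `(2 / √5) M₅` of `τ ↦ -1/τ`, with complex entries. -/
def S5 : Matrix (Fin 6) (Fin 6) ℂ := ((2 / √5 : ℝ) : ℂ) • M5.map (fun x : ℝ => (x : ℂ))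

end

end MockTheta

/-! Each component of `H52` is an eta quotient times a series `signTheta`: a sum over a translate of
ℤ² of characters ε^n (-1)^j, with ε = ±1, against the kernel `ker`. The theorem rests on two
descriptions of this kernel.

Decomposition. Since E(z) = sgn z - sgn z · β(z²) (`E_eq_sign`), the kernel is a sign part minus two
β parts (`signTheta_eq`). The sign part is nonzero only where |x₂| ≤ |x₁|; adding two rows of the
lattice at a time turns it into the Hecke-type double sums. In a β part a shear writes the quadratic
form as -15/2 μ² + 2(x₂ + 5μ/2)² with μ = x₁ - x₂, so that the sum over the second variable is a
unary theta series (`betaTheta_eq_tsum`). In the cases needed it vanishes or equals, up to sign,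
η(τ)²/η(2τ) or η(τ)²/η(τ/2) (`unary_neg_one_zero`, which is Gauss's identity, and
`unary_one_quarter`, its inversion). This cancels the eta quotient and leaves the series `R`; hence
`F52_eq_add`. The last two components come from the third and fourth by τ ↦ τ + 1.

Modularity. The translation is a congruence modulo 2. For the inversion, `ker` is an integral over
an arc of a hyperbola of functions U exp(πiτU²/2 - πiτ̄V²/2) in rotated hyperbolic coordinates
(`ker_eq_integral`). Each of them is reproduced by the Fourier transform with τ replaced by -1/τ,
hence so is `ker` (`integral_ker`). Poisson summation gives fifteen residue classes, which symmetry
reduces to two (`signTheta_inversion`).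

Analysis. `F52` is holomorphic, and √y ∂/∂τ̄ of `R` is antiholomorphic (`hasShadow_R`). The operator
-4y²∂²/∂τ∂τ̄ + iy∂/∂τ̄ kills every function with that property, so H = F - G has eigenvalue 3/16.
Real analyticity, growth and non-vanishing of H are also read off from F - G. At a rational point
p/q the phases of `R` are periodic modulo 2q, and on each residue class the remaining real series is
an alternating sum of interlacing decreasing sequences in [0, 1] (`norm_R_le`). -/

namespace MockTheta

open Complex Filter Topology MeasureTheory
open scoped Real Matrix

noncomputable section

/-! ### Infinite products -/

/-- `∏_{n ≥ 1} (1 - q ^ n)`. -/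
def eulerProd (q : ℂ) : ℂ := ∏' n : ℕ, (1 - q ^ (n + 1))

lemma one_sub_pow_ne_zero {q : ℂ} (hq : ‖q‖ < 1) (n : ℕ) : 1 - q ^ (n + 1) ≠ 0 := by
  intro h
  have h1 : ‖q ^ (n + 1)‖ = 1 := by rw [← sub_eq_zero.mp h, norm_one]
  rw [norm_pow] at h1
  exact (pow_lt_one₀ (norm_nonneg _) hq n.succ_ne_zero).ne h1

lemma one_add_pow_ne_zero {q : ℂ} (hq : ‖q‖ < 1) (n : ℕ) : 1 + q ^ (n + 1) ≠ 0 := by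
  intro h
  have h1 : ‖q ^ (n + 1)‖ = 1 := by rw [← norm_neg, ← eq_neg_of_add_eq_zero_left h, norm_one]
  rw [norm_pow] at h1
  exact (pow_lt_one₀ (norm_nonneg _) hq n.succ_ne_zero).ne h1

lemma norm_sq_lt_one {q : ℂ} (hq : ‖q‖ < 1) : ‖q ^ 2‖ < 1 := by
  rw [norm_pow]; exact pow_lt_one₀ (norm_nonneg _) hq two_ne_zero

lemma multipliable_one_add_pow {q : ℂ} (hq : ‖q‖ < 1) :
    Multipliable fun n : ℕ => 1 + q ^ (n + 1) := by
  apply multipliable_one_add_of_summable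
  simpa using (summable_nat_add_iff 1).mpr (summable_geometric_of_lt_one (norm_nonneg _) hq)

lemma eulerProd_ne_zero {q : ℂ} (hq : ‖q‖ < 1) : eulerProd q ≠ 0 := by
  refine tprod_one_add_ne_zero_of_summable (f := fun n : ℕ => -q ^ (n + 1)) ?_ ?_
  · exact fun i => by simpa [sub_eq_add_neg] using one_sub_pow_ne_zero hq i
  · simpa using (summable_nat_add_iff 1).mpr (summable_geometric_of_lt_one (norm_nonneg _) hq)

lemma tprod_one_add_pow {q : ℂ} (hq : ‖q‖ < 1) :
    ∏' n : ℕ, (1 + q ^ (n + 1)) = eulerProd (q ^ 2) / eulerProd q := by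
  rw [eq_div_iff (eulerProd_ne_zero hq), eulerProd, eulerProd,
    ← (multipliable_one_add_pow hq).tprod_mul (ModularForm.multipliable_one_sub_pow hq)]
  exact tprod_congr fun n => by ring

lemma qPoch_self (q : ℂ) : qPoch q q = eulerProd q :=
  tprod_congr fun n => by ring

lemma qPoch_neg_self {q : ℂ} (hq : ‖q‖ < 1) :
    qPoch (-q) q = eulerProd (q ^ 2) / eulerProd q := by
  rw [← tprod_one_add_pow hq]
  exact tprod_congr fun n => by ring

/-- In the product for `eulerProd (-q)` the even exponents give `eulerProd (q ^ 2)` and the odd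
exponents give the factors 1 + q^(2n+1). -/
lemma qPoch_neg_sq {q : ℂ} (hq : ‖q‖ < 1) :
    qPoch (-q) (q ^ 2) = eulerProd (-q) / eulerProd (q ^ 2) := by
  rw [eq_div_iff (eulerProd_ne_zero (norm_sq_lt_one hq))]
  have hq' : ‖-q‖ < 1 := by rwa [norm_neg]
  have h0 := (summable_nat_add_iff 1).mpr (summable_geometric_of_lt_one (norm_nonneg _) hq)
  have h1 : eulerProd (-q) = _ :=
    (tprod_even_mul_odd (f := fun n : ℕ => 1 - (-q) ^ (n + 1)) ?_ ?_).symm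
  · rw [h1]
    congr 1
    · exact tprod_congr fun n => by rw [pow_succ (-q), pow_mul, neg_sq]; ring
    · exact tprod_congr fun n => by
        rw [show 2 * n + 1 + 1 = 2 * (n + 1) by ring, pow_mul, neg_sq]
  · simp_rw [sub_eq_add_neg]
    apply multipliable_one_add_of_summable
    simp_rw [norm_neg, norm_pow, norm_neg]
    exact h0.comp_injective (mul_right_injective₀ (two_ne_zero : (2 : ℕ) ≠ 0))
  · simp_rw [sub_eq_add_neg]
    apply multipliable_one_add_of_summable
    simp_rw [norm_neg, norm_pow, norm_neg]
    exact h0.comp_injective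
      ((add_left_injective 1).comp (mul_right_injective₀ (two_ne_zero : (2 : ℕ) ≠ 0)))

lemma differentiableOn_eulerProd : DifferentiableOn ℂ eulerProd (Metric.ball 0 1) :=
  ModularForm.differentiableOn_tprod_one_sub_pow

/-! ### Gauss's product formula for `∑ (-1)^n q^(n²)` -/

/-- `∏_{1 ≤ k ≤ n} (1 - q^k) / (1 + q^k)`. -/
def gaussProd (q : ℂ) (n : ℕ) : ℂ :=
  ∏ k ∈ Finset.range n, (1 - q ^ (k + 1)) / (1 + q ^ (k + 1))

lemma gaussProd_succ (q : ℂ) (n : ℕ) :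
    gaussProd q (n + 1) = gaussProd q n * ((1 - q ^ (n + 1)) / (1 + q ^ (n + 1))) :=
  Finset.prod_range_succ _ _

lemma gaussProd_ne_zero {q : ℂ} (hq : ‖q‖ < 1) (n : ℕ) : gaussProd q n ≠ 0 :=
  Finset.prod_ne_zero_iff.mpr fun k _ =>
    div_ne_zero (one_sub_pow_ne_zero hq k) (one_add_pow_ne_zero hq k)

/-- The summand of the finite form of Gauss's formula. -/
def gaussTerm (q : ℂ) (n s : ℕ) : ℂ :=
  (-1) ^ s * (2 / (1 + q ^ s)) * (gaussProd q n / gaussProd q s) * q ^ (s * (n + 1))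

/-- The change of the finite sum under n ↦ n + 1 telescopes in the upper limit m. The term with s =
0 is `gaussProd q n`, which is why it stands apart. -/
lemma gaussTerm_telescope {q : ℂ} (hq : ‖q‖ < 1) (n m : ℕ) :
    gaussProd q (n + 1) - gaussProd q n +
      ∑ s ∈ Finset.range m, (gaussTerm q (n + 1) (s + 1) - gaussTerm q n (s + 1)) =
    -q ^ (n + 1) * ((-1) ^ m * 2 * (gaussProd q n / gaussProd q m) * q ^ (m * (n + 1)) /
      (1 + q ^ (n + 1))) := by
  have h1 := one_add_pow_ne_zero hq n
  induction m with
  | zero =>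
    rw [gaussProd_succ]
    simp only [Finset.range_zero, Finset.sum_empty, gaussProd]
    field_simp
    ring
  | succ m ih =>
    rw [Finset.sum_range_succ, ← add_assoc, ih]
    have h2 := gaussProd_ne_zero hq m
    have h3 := one_sub_pow_ne_zero hq m
    have h4 := one_add_pow_ne_zero hq m
    rw [gaussTerm, gaussTerm, gaussProd_succ q n, gaussProd_succ q m]
    have e1 : q ^ ((m + 1) * (n + 1 + 1)) = q ^ (m * (n + 1)) * q ^ (n + 1) * q ^ (m + 1) := by ring
    have e2 : q ^ ((m + 1) * (n + 1)) = q ^ (m * (n + 1)) * q ^ (n + 1) := by ring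
    rw [e1, e2]
    generalize q ^ (m * (n + 1)) = z
    generalize q ^ (n + 1) = x at *
    generalize q ^ (m + 1) = w at *
    rw [pow_succ]
    field_simp
    ring

/-- Induction on n: the telescoped difference at m = n and the new top term s = n + 1 combine to
twice the next square power. -/
lemma gauss_finite {q : ℂ} (hq : ‖q‖ < 1) (n : ℕ) :
    1 + 2 * ∑ s ∈ Finset.range n, (-1) ^ (s + 1) * q ^ ((s + 1) ^ 2) =
      gaussProd q n + ∑ s ∈ Finset.range n, gaussTerm q n (s + 1) := by
  induction n with
  | zero => simp [gaussProd]
  | succ n ih =>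
    have h := gaussTerm_telescope hq n n
    rw [Finset.sum_sub_distrib, div_self (gaussProd_ne_zero hq n)] at h
    rw [Finset.sum_range_succ, Finset.sum_range_succ, mul_add, ← add_assoc, ih, gaussTerm,
      div_self (gaussProd_ne_zero hq _)]
    have h1 := one_add_pow_ne_zero hq n
    have e1 : q ^ ((n + 1) ^ 2) = q ^ (n * (n + 1)) * q ^ (n + 1) := by ring
    have e2 : q ^ ((n + 1) * (n + 1 + 1)) = q ^ (n * (n + 1)) * q ^ (n + 1) * q ^ (n + 1) := by ring
    rw [e1, e2]
    generalize q ^ (n * (n + 1)) = z at *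
    generalize q ^ (n + 1) = x at *
    have h5 : gaussProd q (n + 1) + ∑ s ∈ Finset.range n, gaussTerm q (n + 1) (s + 1) =
      gaussProd q n + ∑ s ∈ Finset.range n, gaussTerm q n (s + 1) +
      -x * ((-1) ^ n * 2 * 1 * z / (1 + x)) := by linear_combination h
    rw [← add_assoc, h5]
    field_simp
    ring

lemma tendsto_gaussProd {q : ℂ} (hq : ‖q‖ < 1) :
    Tendsto (gaussProd q) atTop (𝓝 (eulerProd q ^ 2 / eulerProd (q ^ 2))) := by
  have h1 := (ModularForm.multipliable_one_sub_pow hq).hasProd.tendsto_prod_nat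
  have h2 := (multipliable_one_add_pow hq).hasProd.tendsto_prod_nat
  rw [tprod_one_add_pow hq] at h2
  have h3 := h1.div h2 (div_ne_zero (eulerProd_ne_zero (norm_sq_lt_one hq)) (eulerProd_ne_zero hq))
  have e : eulerProd q / (eulerProd (q ^ 2) / eulerProd q) =
      eulerProd q ^ 2 / eulerProd (q ^ 2) := by
    rw [div_div_eq_mul_div, ← sq]
  rw [← e]
  refine h3.congr fun n => ?_
  simp only [gaussProd, Pi.div_apply, Finset.prod_div_distrib]

/-- The partial products and their inverses are bounded, because their limit is nonzero. The factor
q^((s+1)(n+1)) is then at most |q|^n |q|^s in modulus, and the sum over s is geometric. -/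
lemma tendsto_sum_gaussTerm {q : ℂ} (hq : ‖q‖ < 1) :
    Tendsto (fun n => ∑ s ∈ Finset.range n, gaussTerm q n (s + 1)) atTop (𝓝 0) := by
  have hP := tendsto_gaussProd hq
  have hL : eulerProd q ^ 2 / eulerProd (q ^ 2) ≠ 0 :=
    div_ne_zero (pow_ne_zero _ (eulerProd_ne_zero hq)) (eulerProd_ne_zero (norm_sq_lt_one hq))
  obtain ⟨C, hC⟩ := hP.norm.bddAbove_range
  obtain ⟨D, hD⟩ := (hP.inv₀ hL).norm.bddAbove_range
  have hC' : ∀ n, ‖gaussProd q n‖ ≤ C := fun n => hC ⟨n, rfl⟩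
  have hD' : ∀ n, ‖(gaussProd q n)⁻¹‖ ≤ D := fun n => hD ⟨n, rfl⟩
  have hC0 : 0 ≤ C := (norm_nonneg _).trans (hC' 0)
  have hr : 0 < 1 - ‖q‖ := by linarith
  have hterm : ∀ n s, ‖gaussTerm q n (s + 1)‖ ≤
      2 / (1 - ‖q‖) * (C * D) * ‖q‖ ^ n * ‖q‖ ^ s := by
    intro n s
    rw [gaussTerm, norm_mul, norm_mul, norm_mul, norm_pow, norm_neg, norm_one, one_pow, one_mul,
      mul_assoc _ (‖q‖ ^ n), ← pow_add, norm_pow, norm_div, div_eq_mul_inv (gaussProd q n),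
      norm_mul, Complex.norm_ofNat]
    have h1 : 1 - ‖q‖ ≤ ‖1 + q ^ (s + 1)‖ := by
      have := norm_sub_norm_le (1 : ℂ) (-q ^ (s + 1))
      rw [norm_neg, norm_pow, norm_one, sub_neg_eq_add] at this
      have h2 : ‖q‖ ^ (s + 1) ≤ ‖q‖ := pow_le_of_le_one (norm_nonneg _) hq.le s.succ_ne_zero
      linarith
    have h3 : ‖q‖ ^ ((s + 1) * (n + 1)) ≤ ‖q‖ ^ (n + s) :=
      pow_le_pow_of_le_one (norm_nonneg _) hq.le (by nlinarith)
    have h4 : 0 ≤ 2 / (1 - ‖q‖) * (C * D) :=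
      mul_nonneg (by positivity) (mul_nonneg hC0 ((norm_nonneg _).trans (hD' 0)))
    gcongr
    · exact hC' n
    · exact hD' _
  have hsum : ∀ n : ℕ, ∑ s ∈ Finset.range n, ‖q‖ ^ s ≤ (1 - ‖q‖)⁻¹ := fun n => by
    rw [← tsum_geometric_of_lt_one (norm_nonneg _) hq]
    exact (summable_geometric_of_lt_one (norm_nonneg _) hq).sum_le_tsum _
      fun _ _ => pow_nonneg (norm_nonneg _) _
  have hD0 : 0 ≤ D := (norm_nonneg _).trans (hD' 0)
  refine squeeze_zero_norm (a := fun n => 2 / (1 - ‖q‖) * (C * D) * ‖q‖ ^ n * (1 - ‖q‖)⁻¹)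
    (fun n => ?_) ?_
  · refine (norm_sum_le _ _).trans ((Finset.sum_le_sum fun s _ => hterm n s).trans ?_)
    rw [← Finset.mul_sum]
    have := hsum n
    gcongr
  · have := ((tendsto_pow_atTop_nhds_zero_of_lt_one (norm_nonneg q) hq).const_mul
      (2 / (1 - ‖q‖) * (C * D))).mul_const (1 - ‖q‖)⁻¹
    simpa using this

lemma summable_pow_sq {q : ℂ} (hq : ‖q‖ < 1) :
    Summable fun s : ℕ => (-1 : ℂ) ^ (s + 1) * q ^ ((s + 1) ^ 2) := by
  refine Summable.of_norm_bounded (summable_geometric_of_lt_one (norm_nonneg _) hq) fun s => ?_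
  rw [norm_mul, norm_pow, norm_neg, norm_one, one_pow, one_mul, norm_pow]
  exact pow_le_pow_of_le_one (norm_nonneg _) hq.le (by nlinarith)

/-- **Gauss's formula**. -/
theorem gauss_tsum {q : ℂ} (hq : ‖q‖ < 1) :
    1 + 2 * ∑' s : ℕ, (-1 : ℂ) ^ (s + 1) * q ^ ((s + 1) ^ 2) =
      eulerProd q ^ 2 / eulerProd (q ^ 2) := by
  have h1 := ((summable_pow_sq hq).hasSum.tendsto_sum_nat.const_mul 2).const_add 1
  have h2 := (tendsto_gaussProd hq).add (tendsto_sum_gaussTerm hq)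
  rw [add_zero] at h2
  exact tendsto_nhds_unique (h1.congr fun n => gauss_finite hq n) h2

/-! ### Powers of the nome -/

lemma qpow_add (r s : ℚ) (τ : ℂ) : qpow (r + s) τ = qpow r τ * qpow s τ := by
  rw [qpow, qpow, qpow, ← Complex.exp_add]; push_cast; ring_nf

lemma qpow_pow (r : ℚ) (τ : ℂ) (n : ℕ) : qpow r τ ^ n = qpow (n * r) τ := by
  rw [qpow, qpow, ← Complex.exp_nat_mul]; push_cast; ring_nf

lemma qpow_ne_zero (r : ℚ) (τ : ℂ) : qpow r τ ≠ 0 := Complex.exp_ne_zero _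

lemma qpow_zpow (r : ℚ) (τ : ℂ) (n : ℤ) : qpow r τ ^ n = qpow (n * r) τ := by
  rw [qpow, qpow, ← Complex.exp_int_mul]; push_cast; ring_nf

lemma norm_qpow (r : ℚ) (τ : ℂ) : ‖qpow r τ‖ = Real.exp (-2 * π * r * τ.im) := by
  rw [qpow, Complex.norm_exp]
  congr 1
  rw [show (2 * π * I * r * τ : ℂ) = ((2 * π * r : ℝ) : ℂ) * (I * τ) by push_cast; ring,
    Complex.re_ofReal_mul]
  simp

lemma norm_qpow_lt_one {r : ℚ} (hr : 0 < r) {τ : ℂ} (hτ : 0 < τ.im) : ‖qpow r τ‖ < 1 := by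
  rw [norm_qpow, Real.exp_lt_one_iff]
  have : (0 : ℝ) < r := by exact_mod_cast hr
  have := mul_pos (mul_pos Real.pi_pos this) hτ
  linarith

/-! ### The square root automorphy factor -/

/-- The principal branch of `√(-iτ)`. -/
def csr (τ : ℂ) : ℂ := (-I * τ) ^ (1 / 2 : ℂ)

lemma neg_I_mul_re (τ : ℂ) : (-I * τ).re = τ.im := by simp

lemma neg_I_mul_ne_zero {τ : ℂ} (hτ : 0 < τ.im) : -I * τ ≠ 0 := fun h => by
  have := neg_I_mul_re τ
  rw [h] at this
  simp only [zero_re] at this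
  linarith

lemma ne_zero_of_im_pos {τ : ℂ} (hτ : 0 < τ.im) : τ ≠ 0 := fun h => by simp [h] at hτ

lemma im_neg_one_div_pos {τ : ℂ} (hτ : 0 < τ.im) : 0 < (-1 / τ).im := by
  rw [neg_div, neg_im, one_div, inv_im, neg_div, neg_neg]
  exact div_pos hτ (normSq_pos.mpr (ne_zero_of_im_pos hτ))

lemma csr_sq (τ : ℂ) : csr τ ^ 2 = -I * τ := by
  have := Complex.cpow_nat_inv_pow (-I * τ) two_ne_zero
  rwa [Nat.cast_ofNat, ← one_div] at this

lemma csr_ne_zero {τ : ℂ} (hτ : 0 < τ.im) : csr τ ≠ 0 := fun h => by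
  have := csr_sq τ
  rw [h] at this
  exact neg_I_mul_ne_zero hτ (by rw [← this]; ring)

lemma csr_inv {τ : ℂ} (hτ : 0 < τ.im) : csr (-1 / τ) = (csr τ)⁻¹ := by
  rw [csr, csr, ← Complex.inv_cpow]
  · congr 1
    have := ne_zero_of_im_pos hτ
    field_simp
    simp
  · intro h
    have h1 := (Complex.arg_eq_pi_iff.mp h).1
    rw [neg_I_mul_re] at h1
    linarith

lemma csr_real_mul {c : ℝ} (hc : 0 < c) {τ : ℂ} (hτ : 0 < τ.im) :
    csr (c * τ) = (√c : ℝ) * csr τ := by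
  have h0 := neg_I_mul_ne_zero hτ
  have h1 : -I * (c * τ) = (c : ℂ) * (-I * τ) := by ring
  have hc' : (c : ℂ) ≠ 0 := by exact_mod_cast hc.ne'
  rw [csr, csr, h1, Complex.cpow_def_of_ne_zero (mul_ne_zero hc' h0),
    Complex.cpow_def_of_ne_zero h0, Complex.log_ofReal_mul hc h0, add_mul, Complex.exp_add,
    Real.sqrt_eq_rpow, Complex.ofReal_cpow hc.le, Complex.cpow_def_of_ne_zero hc',
    Complex.ofReal_log hc.le]
  push_cast
  rfl

/-! ### Dedekind's eta function -/

lemma eta_eq (τ : ℂ) : ModularForm.eta τ = qpow (1 / 24) τ * eulerProd (qpow 1 τ) := by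
  rw [ModularForm.eta, eulerProd]
  congr 1
  · rw [Function.Periodic.qParam, qpow]; push_cast; ring_nf
  · refine tprod_congr fun n => ?_
    rw [ModularForm.eta_q_eq_pow, qpow]; push_cast; ring_nf

lemma eta_ne_zero' {τ : ℂ} (hτ : 0 < τ.im) : ModularForm.eta τ ≠ 0 := ModularForm.eta_ne_zero hτ

lemma eta_two_mul (τ : ℂ) :
    ModularForm.eta (2 * τ) = qpow (1 / 12) τ * eulerProd (qpow 1 τ ^ 2) := by
  rw [eta_eq, qpow_pow]
  simp only [qpow]; push_cast; ring_nf

lemma eta_half (τ : ℂ) :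
    ModularForm.eta (τ / 2) = qpow (1 / 48) τ * eulerProd (qpow (1 / 2) τ) := by
  rw [eta_eq]
  simp only [qpow]; push_cast; ring_nf

lemma eta_half_add (τ : ℂ) :
    ModularForm.eta ((τ + 1) / 2) = ζ 48 * qpow (1 / 48) τ * eulerProd (-qpow (1 / 2) τ) := by
  rw [eta_eq]
  congr 2
  · rw [qpow, qpow, ζ, ← Complex.exp_add]; push_cast; ring_nf
  · rw [qpow, qpow, ← neg_one_mul, ← Complex.exp_pi_mul_I, ← Complex.exp_add]; push_cast; ring_nf

lemma eta_add_one (τ : ℂ) : ModularForm.eta (τ + 1) = ζ 24 * ModularForm.eta τ := by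
  rw [eta_eq, eta_eq, ← mul_assoc]
  congr 2
  · rw [qpow, qpow, ζ, ← Complex.exp_add]; push_cast; ring_nf
  · rw [qpow, qpow, mul_add, Complex.exp_add]; push_cast; simp

/-- The argument of τ lies in [0, π], so adding arg(-i) = -π/2 does not leave the principal range
and the logarithms add. -/
lemma csr_eq_sqrt {τ : ℂ} (hτ : 0 < τ.im) : csr τ = (sqrt I)⁻¹ * sqrt τ := by
  have h0 := ne_zero_of_im_pos hτ
  have hl : Complex.log (-I * τ) = Complex.log τ - Complex.log I := by
    have h1 : Complex.log (-I * τ) = Complex.log (-I) + Complex.log τ := by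
      rw [Complex.log_mul_eq_add_log_iff (by simp) h0, Complex.arg_neg_I]
      have h2 := Complex.arg_le_pi τ
      have h3 := Complex.arg_nonneg_iff.mpr hτ.le
      constructor <;> linarith [Real.pi_pos]
    rw [h1, Complex.log_neg_I, Complex.log_I]; ring
  rw [csr, Complex.cpow_def_of_ne_zero (neg_I_mul_ne_zero hτ), hl, sqrt, sqrt,
    Complex.cpow_def_of_ne_zero h0, Complex.cpow_def_of_ne_zero I_ne_zero, ← Complex.exp_neg,
    ← Complex.exp_add]
  ring_nf

lemma eta_neg_one_div {τ : ℂ} (hτ : 0 < τ.im) :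
    ModularForm.eta (-1 / τ) = csr τ * ModularForm.eta τ := by
  have := ModularForm.eta_comp_eq_csqrt_I_inv hτ
  simp only [Function.comp_apply, Pi.smul_apply, Pi.mul_apply, smul_eq_mul] at this
  rw [this, csr_eq_sqrt hτ]; ring

lemma multipliable_qPoch {q : ℂ} (hq : ‖q‖ < 1) (a : ℂ) :
    Multipliable fun n : ℕ => 1 - a * q ^ n := by
  simp_rw [sub_eq_add_neg]
  apply multipliable_one_add_of_summable
  simpa using (summable_geometric_of_lt_one (norm_nonneg _) hq).mul_left ‖a‖

/-- From (-q; q²)(q; q²) = (q²; q⁴), with each factor rewritten by `qPoch_neg_sq` at q, -q and -q².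
-/
lemma eulerProd_neg_mul {q : ℂ} (hq : ‖q‖ < 1) :
    eulerProd (-q) * eulerProd q * eulerProd ((q ^ 2) ^ 2) = eulerProd (q ^ 2) ^ 3 := by
  have hq2 := norm_sq_lt_one hq
  have h1 := qPoch_neg_sq hq
  have h2 := qPoch_neg_sq (q := -q) (by rwa [norm_neg])
  have h3 := qPoch_neg_sq (q := -q ^ 2) (by rwa [norm_neg])
  rw [neg_neg, neg_sq] at h2 h3
  have h4 : qPoch (-q) (q ^ 2) * qPoch q (q ^ 2) = qPoch (q ^ 2) ((q ^ 2) ^ 2) := by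
    rw [qPoch, qPoch, qPoch,
      ← (multipliable_qPoch hq2 (-q)).tprod_mul (multipliable_qPoch hq2 q)]
    exact tprod_congr fun n => by ring
  rw [h1, h2, h3] at h4
  have n1 := eulerProd_ne_zero hq2
  have n2 := eulerProd_ne_zero (norm_sq_lt_one hq2)
  generalize eulerProd ((q ^ 2) ^ 2) = w at *
  field_simp at h4
  linear_combination h4

lemma ζ_ne_zero (n : ℕ) : ζ n ≠ 0 := Complex.exp_ne_zero _

/-- Used to eliminate η((τ+1)/2), whose inversion is not a direct instance of `eta_neg_one_div`. -/
lemma eta_mul_eta_mul_eta {τ : ℂ} (hτ : 0 < τ.im) :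
    ModularForm.eta (2 * τ) * ModularForm.eta (τ / 2) * ModularForm.eta ((τ + 1) / 2) =
      ζ 48 * ModularForm.eta τ ^ 3 := by
  have h := eulerProd_neg_mul (norm_qpow_lt_one (r := 1 / 2) (by norm_num) hτ)
  have e1 : qpow (1 / 2) τ ^ 2 = qpow 1 τ := by rw [qpow_pow]; norm_num
  rw [e1] at h
  rw [eta_two_mul, eta_half, eta_half_add, eta_eq]
  have e2 : qpow (1 / 12) τ * qpow (1 / 48) τ * qpow (1 / 48) τ = qpow (1 / 24) τ ^ 3 := by
    rw [qpow_pow, ← qpow_add, ← qpow_add]; norm_num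
  linear_combination ζ 48 * qpow (1 / 12) τ * qpow (1 / 48) τ * qpow (1 / 48) τ * h +
    ζ 48 * eulerProd (qpow 1 τ) ^ 3 * e2

lemma psi_prefactor {τ : ℂ} (hτ : 0 < τ.im) :
    qPoch (-qpow 1 τ) (qpow 1 τ) / qPoch (qpow 1 τ) (qpow 1 τ) =
      ModularForm.eta (2 * τ) / ModularForm.eta τ ^ 2 := by
  have hq := norm_qpow_lt_one (r := 1) one_pos hτ
  have e : qpow (1 / 12) τ = qpow (1 / 24) τ ^ 2 := by rw [qpow_pow]; norm_num
  rw [qPoch_self, qPoch_neg_self hq, eta_two_mul, eta_eq, mul_pow, e]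
  have := qpow_ne_zero (1 / 24) τ
  have n1 := eulerProd_ne_zero hq
  field_simp

lemma phi_prefactor {τ : ℂ} (hτ : 0 < τ.im) :
    qpow (-1 / 16) τ * (qPoch (qpow (1 / 2) τ) (qpow (1 / 2) τ ^ 2) /
      qPoch (qpow (1 / 2) τ ^ 2) (qpow (1 / 2) τ ^ 2)) =
      ModularForm.eta (τ / 2) / ModularForm.eta τ ^ 2 := by
  have hq := norm_qpow_lt_one (r := 1 / 2) (by norm_num) hτ
  have hq1 := norm_qpow_lt_one (r := 1) one_pos hτ
  have h2 := qPoch_neg_sq (q := -qpow (1 / 2) τ) (by rwa [norm_neg])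
  rw [neg_neg, neg_sq] at h2
  have e1 : qpow (1 / 2) τ ^ 2 = qpow 1 τ := by rw [qpow_pow]; norm_num
  have e2 : qpow (1 / 48) τ = qpow (-1 / 16) τ * qpow (1 / 24) τ ^ 2 := by
    rw [qpow_pow, ← qpow_add]; norm_num
  rw [h2, qPoch_self, e1, eta_half, eta_eq, e2]
  have := qpow_ne_zero (1 / 24) τ
  have n1 := eulerProd_ne_zero hq1
  field_simp

/-! ### Unary theta series with half-integral characteristics -/

/-- `∑_j δ^j q^((j + c)²)`. -/
def unary (δ : ℂ) (c : ℝ) (τ : ℂ) : ℂ :=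
  ∑' j : ℤ, δ ^ j * exp (2 * π * I * τ * (j + c) ^ 2)

lemma unary_term (c : ℝ) (τ : ℂ) (j : ℤ) :
    exp (2 * π * I * τ * (j + c) ^ 2) =
      exp (2 * π * I * τ * c ^ 2) * jacobiTheta₂_term j (2 * c * τ) (2 * τ) := by
  rw [jacobiTheta₂_term, ← Complex.exp_add]; ring_nf

lemma summable_unary_exp (c : ℝ) {τ : ℂ} (hτ : 0 < τ.im) :
    Summable fun j : ℤ => exp (2 * π * I * τ * (j + c) ^ 2) := by
  simp_rw [unary_term]
  refine Summable.mul_left _ ((summable_jacobiTheta₂_term_iff _ _).mpr ?_)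
  simpa using hτ

lemma unary_add_one {δ : ℂ} (hδ : δ ^ 2 = 1) (c : ℝ) (τ : ℂ) :
    unary δ (c + 1) τ = δ * unary δ c τ := by
  have h0 : δ ≠ 0 := fun h => by simp [h] at hδ
  rw [unary, unary, ← tsum_mul_left, ← (Equiv.addRight (-1 : ℤ)).tsum_eq]
  refine tsum_congr fun j => ?_
  rw [Equiv.coe_addRight, zpow_add₀ h0, zpow_neg_one]
  have : δ⁻¹ = δ := by field_simp; rw [← hδ]
  rw [this]
  push_cast
  ring_nf

lemma unary_neg {δ : ℂ} (hδ : δ ^ 2 = 1) (c : ℝ) (τ : ℂ) : unary δ (-c) τ = unary δ c τ := by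
  have h0 : δ ≠ 0 := fun h => by simp [h] at hδ
  have : δ⁻¹ = δ := by field_simp; rw [← hδ]
  rw [unary, unary, ← (Equiv.neg ℤ).tsum_eq]
  refine tsum_congr fun j => ?_
  rw [Equiv.neg_apply, zpow_neg, ← inv_zpow, this]
  push_cast
  ring_nf

lemma unary_add_int {δ : ℂ} (hδ : δ ^ 2 = 1) (c : ℝ) (k : ℤ) (τ : ℂ) :
    unary δ (c + k) τ = δ ^ k * unary δ c τ := by
  have h0 : δ ≠ 0 := fun h => by simp [h] at hδ
  induction k using Int.induction_on with
  | zero => simp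
  | succ i ih =>
    push_cast at ih ⊢
    rw [← add_assoc, unary_add_one hδ, ih, zpow_add_one₀ h0]; ring
  | pred i ih =>
    have h1 := unary_add_one hδ (c + ((-(i : ℤ) - 1 : ℤ) : ℝ)) τ
    have h2 : c + ((-(i : ℤ) - 1 : ℤ) : ℝ) + 1 = c + ((-(i : ℤ) : ℤ) : ℝ) := by push_cast; ring
    rw [h2, ih] at h1
    have h3 : δ * (δ ^ (-(i : ℤ)) * unary δ c τ) = δ ^ 2 * unary δ (c + ((-(i : ℤ) - 1 : ℤ) : ℝ)) τ := by
      rw [h1]; ring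
    rw [hδ, one_mul] at h3
    rw [← h3, zpow_sub_one₀ h0]
    have : δ⁻¹ = δ := by field_simp; rw [← hδ]
    rw [this]; ring

/-- Reflection sends the shift 1/2 to -1/2 with sign +, the unit translation sends it back with sign
-. This vanishing removes one parity class from each β sum with ε = 1. -/
lemma unary_neg_one_half (τ : ℂ) : unary (-1) (1 / 2) τ = 0 := by
  have h1 := unary_add_one (δ := -1) (by norm_num) (-(1 / 2)) τ
  rw [unary_neg (by norm_num)] at h1
  norm_num at h1
  exact self_eq_neg.mp h1

lemma tsum_int_even_odd {f : ℤ → ℂ} (hf : Summable f) :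
    ∑' n, f n = ∑' k : ℤ, f (2 * k) + ∑' k : ℤ, f (2 * k + 1) := by
  have h1 : Function.Injective fun k : ℤ => 2 * k := mul_right_injective₀ two_ne_zero
  have h2 : Function.Injective fun k : ℤ => 2 * k + 1 := (add_left_injective 1).comp h1
  have h3 := h1.hasSum_range_iff.mpr (hf.comp_injective h1).hasSum
  have h4 := h2.hasSum_range_iff.mpr (hf.comp_injective h2).hasSum
  rw [range_two_mul] at h3
  rw [range_two_mul_add_one] at h4
  exact (h3.add_isCompl Int.isCompl_even_odd h4).tsum_eq

lemma unary_neg_one_zero_eq_tsum {τ : ℂ} (hτ : 0 < τ.im) :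
    unary (-1) 0 τ = 1 + 2 * ∑' s : ℕ, (-1 : ℂ) ^ (s + 1) * qpow 1 τ ^ ((s + 1) ^ 2) := by
  have hq := norm_qpow_lt_one (r := 1) one_pos hτ
  have hs := (summable_pow_sq hq).hasSum
  have e : ∀ s : ℕ, (-1 : ℂ) ^ (s + 1) * qpow 1 τ ^ ((s + 1) ^ 2) =
      (-1 : ℂ) ^ ((s : ℤ) + 1) * exp (2 * π * I * τ * (((s : ℤ) + 1 : ℤ) + (0 : ℝ)) ^ 2) := by
    intro s
    rw [qpow_pow, qpow]
    congr 1
    push_cast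
    ring_nf
  have h2 : HasSum (fun s : ℕ => (-1 : ℂ) ^ (-((s : ℤ) + 1)) *
      exp (2 * π * I * τ * ((-((s : ℤ) + 1) : ℤ) + (0 : ℝ)) ^ 2))
      (∑' s : ℕ, (-1 : ℂ) ^ (s + 1) * qpow 1 τ ^ ((s + 1) ^ 2)) := by
    refine hs.congr_fun fun s => ?_
    rw [e, zpow_neg, ← inv_zpow, inv_neg, inv_one]
    push_cast
    ring_nf
  have h3 := (hs.congr_fun fun s => (e s).symm).of_add_one_of_neg_add_one
    (f := fun j : ℤ => (-1 : ℂ) ^ j * exp (2 * π * I * τ * (j + (0 : ℝ)) ^ 2)) h2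
  rw [unary, h3.tsum_eq]
  norm_num
  ring

/-- Gauss: `∑ (-1)^j q^(j²) = η(τ)² / η(2τ)`. -/
lemma unary_neg_one_zero {τ : ℂ} (hτ : 0 < τ.im) :
    unary (-1) 0 τ = ModularForm.eta τ ^ 2 / ModularForm.eta (2 * τ) := by
  have hq := norm_qpow_lt_one (r := 1) one_pos hτ
  have e : qpow (1 / 12) τ = qpow (1 / 24) τ ^ 2 := by rw [qpow_pow]; norm_num
  rw [unary_neg_one_zero_eq_tsum hτ, gauss_tsum hq, eta_two_mul, eta_eq, mul_pow, e]
  have := qpow_ne_zero (1 / 24) τ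
  field_simp

/-- The functional equation of `jacobiTheta₂` at z = 1/2 moves the sign character into a
half-integral shift. The shifted lattice, scaled by 1/2, is the union of ℤ + 1/4 and ℤ - 1/4, which
contribute equally. -/
lemma unary_neg_one_zero_eq_inversion {τ : ℂ} (hτ : 0 < τ.im) :
    unary (-1) 0 τ = 1 / csr (2 * τ) * (2 * unary 1 (1 / 4) (-1 / τ)) := by
  have h0 := ne_zero_of_im_pos hτ
  have h1 : unary (-1) 0 τ = jacobiTheta₂ (1 / 2) (2 * τ) := by
    refine tsum_congr fun j => ?_
    rw [jacobiTheta₂_term, ← Complex.exp_pi_mul_I, ← Complex.exp_int_mul, ← Complex.exp_add]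
    push_cast
    ring_nf
  have h2 : exp (-π * I * (1 / 2) ^ 2 / (2 * τ)) * jacobiTheta₂ (1 / 2 / (2 * τ)) (-1 / (2 * τ)) =
      ∑' n : ℤ, exp (2 * π * I * (-1 / τ) * ((n + (-1 / 2 : ℝ)) / 2) ^ 2) := by
    rw [jacobiTheta₂, ← tsum_mul_left]
    refine tsum_congr fun n => ?_
    rw [jacobiTheta₂_term, ← Complex.exp_add]
    congr 1
    push_cast
    field_simp
    ring
  have h3 : Summable fun n : ℤ => exp (2 * π * I * (-1 / τ) * ((n + (-1 / 2 : ℝ)) / 2) ^ 2) := by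
    have := summable_unary_exp (-1 / 2) (τ := -1 / τ / 4)
      (by simpa using div_pos (im_neg_one_div_pos hτ) four_pos)
    refine this.congr fun n => ?_
    ring_nf
  rw [h1, jacobiTheta₂_functional_equation, mul_assoc, h2, tsum_int_even_odd h3, csr]
  congr 1
  have h4 : ∑' k : ℤ, exp (2 * π * I * (-1 / τ) * (((2 * k : ℤ) + (-1 / 2 : ℝ)) / 2) ^ 2) =
      unary 1 (-(1 / 4)) (-1 / τ) := by
    refine tsum_congr fun k => ?_
    rw [one_zpow, one_mul]; push_cast; ring_nf
  have h5 : ∑' k : ℤ, exp (2 * π * I * (-1 / τ) * (((2 * k + 1 : ℤ) + (-1 / 2 : ℝ)) / 2) ^ 2) =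
      unary 1 (1 / 4) (-1 / τ) := by
    refine tsum_congr fun k => ?_
    rw [one_zpow, one_mul]; push_cast; ring_nf
  rw [h4, h5, unary_neg (by norm_num)]; ring

/-- The preceding inversion read at -1/τ, with Gauss's value on its left side and the inversion of η
at τ and τ/2. -/
lemma unary_one_quarter {τ : ℂ} (hτ : 0 < τ.im) :
    unary 1 (1 / 4) τ = ModularForm.eta τ ^ 2 / ModularForm.eta (τ / 2) := by
  have h0 := ne_zero_of_im_pos hτ
  have hi := im_neg_one_div_pos hτ
  have h1 := unary_neg_one_zero_eq_inversion hi
  have e1 : -1 / (-1 / τ) = τ := by field_simp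
  have hh : 0 < (τ / 2).im := by simpa using hτ
  have e2 : 2 * (-1 / τ) = -1 / (τ / 2) := by field_simp
  have e3 : csr (τ / 2) = (√(1 / 2) : ℝ) * csr τ := by
    rw [← csr_real_mul (by norm_num) hτ]; congr 1; push_cast; ring
  rw [unary_neg_one_zero hi, e1, e2, eta_neg_one_div hτ, eta_neg_one_div hh, csr_inv hh, e3] at h1
  have n1 := csr_ne_zero hτ
  have n2 := eta_ne_zero' hh
  have hs : ((√(1 / 2) : ℝ) : ℂ) ^ 2 = 1 / 2 := by
    rw [← Complex.ofReal_pow, Real.sq_sqrt (by norm_num)]; norm_num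
  have n3 : ((√(1 / 2) : ℝ) : ℂ) ≠ 0 := by
    intro h; rw [h] at hs; norm_num at hs
  generalize ((√(1 / 2) : ℝ) : ℂ) = r at *
  rw [eq_div_iff n2]
  field_simp at h1
  linear_combination -h1 - 2 * ModularForm.eta (τ / 2) * unary 1 (1 / 4) τ * hs

/-! ### The functions `E` and `β` -/

lemma hasDerivAt_E (x : ℝ) : HasDerivAt E (2 * Real.exp (-π * x ^ 2)) x := by
  have hc : Continuous fun u : ℝ => Real.exp (-π * u ^ 2) := by fun_prop
  exact (intervalIntegral.integral_hasDerivAt_right (hc.intervalIntegrable _ _)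
    (hc.stronglyMeasurableAtFilter _ _) hc.continuousAt).const_mul 2

lemma continuous_E : Continuous E :=
  continuous_iff_continuousAt.mpr fun x => (hasDerivAt_E x).continuousAt

lemma E_zero : E 0 = 0 := by simp [E]

lemma E_neg (x : ℝ) : E (-x) = -E x := by
  have h := intervalIntegral.integral_comp_neg (a := 0) (b := x)
    (fun u : ℝ => Real.exp (-π * u ^ 2))
  simp only [neg_sq, neg_zero] at h
  rw [E, E, h, intervalIntegral.integral_symm]
  ring

/-- The integrand of `β`. -/
def betaIntegrand (u : ℝ) : ℝ := u ^ (-1 / 2 : ℝ) * Real.exp (-π * u)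

lemma betaIntegrand_nonneg {u : ℝ} (hu : 0 ≤ u) : 0 ≤ betaIntegrand u :=
  mul_nonneg (Real.rpow_nonneg hu _) (Real.exp_pos _).le

lemma integrableOn_betaIntegrand : IntegrableOn betaIntegrand (Set.Ioi 0) := by
  have := integrableOn_rpow_mul_exp_neg_mul_rpow (p := 1) (s := -1 / 2) (b := π) (by norm_num)
    one_pos Real.pi_pos
  unfold betaIntegrand
  simpa using this

lemma beta_zero : β 0 = 1 := by
  have h := Real.integral_rpow_mul_exp_neg_mul_Ioi (a := 1 / 2) (r := π) (by norm_num) Real.pi_pos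
  have h2 : β 0 = ∫ t in Set.Ioi (0 : ℝ), t ^ ((1 / 2 : ℝ) - 1) * Real.exp (-(π * t)) := by
    rw [β]; norm_num
  rw [h2, h, Real.Gamma_one_half_eq, Real.sqrt_eq_rpow, ← Real.mul_rpow (by positivity) (by positivity)]
  rw [one_div, inv_mul_cancel₀ Real.pi_pos.ne', Real.one_rpow]

lemma beta_eq_one_sub {x : ℝ} (hx : 0 ≤ x) : β x = 1 - ∫ u in (0 : ℝ)..x, betaIntegrand u := by
  have := intervalIntegral.integral_Ioi_sub_Ioi integrableOn_betaIntegrand hx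
  rw [← this, ← beta_zero]
  simp only [β, betaIntegrand]; ring

lemma intervalIntegrable_betaIntegrand {x : ℝ} (hx : 0 ≤ x) :
    IntervalIntegrable betaIntegrand volume 0 x :=
  (intervalIntegrable_iff_integrableOn_Ioc_of_le hx).mpr
    (integrableOn_betaIntegrand.mono_set Set.Ioc_subset_Ioi_self)

lemma continuousAt_betaIntegrand {x : ℝ} (hx : 0 < x) : ContinuousAt betaIntegrand x :=
  (Real.continuousAt_rpow_const _ _ (Or.inl hx.ne')).mul (by fun_prop)

lemma measurable_betaIntegrand : Measurable betaIntegrand := by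
  unfold betaIntegrand; fun_prop

lemma hasDerivAt_beta {x : ℝ} (hx : 0 < x) : HasDerivAt β (-betaIntegrand x) x := by
  have h := intervalIntegral.integral_hasDerivAt_right
    (intervalIntegrable_betaIntegrand hx.le)
    measurable_betaIntegrand.stronglyMeasurable.stronglyMeasurableAtFilter
    (continuousAt_betaIntegrand hx)
  refine (h.const_sub 1).congr_of_eventuallyEq ?_
  filter_upwards [lt_mem_nhds hx] with u hu
  exact beta_eq_one_sub hu.le

lemma continuousOn_beta : ContinuousOn β (Set.Ici 0) := by
  intro x hx
  have hi : IntegrableOn betaIntegrand (Set.uIcc 0 (x + 1)) := by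
    rw [Set.uIcc_of_le (by linarith [Set.mem_Ici.mp hx]),
      integrableOn_Icc_iff_integrableOn_Ioc]
    exact integrableOn_betaIntegrand.mono_set Set.Ioc_subset_Ioi_self
  have h := intervalIntegral.continuousOn_primitive_interval hi
  have h2 : ContinuousWithinAt (fun x => 1 - ∫ u in (0 : ℝ)..x, betaIntegrand u) (Set.Ici 0) x := by
    refine continuousWithinAt_const.sub ?_
    have h3 : Set.uIcc 0 (x + 1) ∈ 𝓝[Set.Ici 0] x := by
      rw [Set.uIcc_of_le (by linarith [Set.mem_Ici.mp hx]), ← Set.Ici_inter_Iic]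
      exact inter_mem self_mem_nhdsWithin (mem_nhdsWithin_of_mem_nhds (Iic_mem_nhds (by linarith)))
    exact (h x (by rw [Set.uIcc_of_le (by linarith [Set.mem_Ici.mp hx])]; exact ⟨hx, by linarith⟩)).mono_of_mem_nhdsWithin h3
  exact h2.congr (fun y hy => beta_eq_one_sub hy) (beta_eq_one_sub hx)

/-- The derivative of E(z) + β(z²) vanishes for z > 0 and its value at 0 is β(0) = 1. Only
continuity is used at the end point 0, where β is not differentiable. -/
lemma E_of_nonneg {z : ℝ} (hz : 0 ≤ z) : E z = 1 - β (z ^ 2) := by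
  have hcont : ContinuousOn (fun z => E z + β (z ^ 2)) (Set.Icc 0 z) :=
    continuous_E.continuousOn.add
      (continuousOn_beta.comp (by fun_prop) fun x _ => sq_nonneg x)
  have hder : ∀ x ∈ Set.Ioo 0 z,
      HasDerivWithinAt (fun z => E z + β (z ^ 2)) 0 (Set.Ioi x) x := by
    intro x hx
    have h1 := HasDerivAt.comp (h₂ := β) (h := fun z : ℝ => z ^ 2) x
      (hasDerivAt_beta (pow_pos hx.1 2)) (hasDerivAt_pow 2 x)
    have h2 := (hasDerivAt_E x).add h1
    have h3 : 2 * Real.exp (-π * x ^ 2) + -betaIntegrand (x ^ 2) * (((2 : ℕ) : ℝ) * x ^ (2 - 1)) = 0 := by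
      rw [betaIntegrand, ← Real.rpow_natCast x 2, ← Real.rpow_mul hx.1.le]
      norm_num
      rw [Real.rpow_neg_one]
      have := hx.1.ne'
      field_simp
      ring
    rw [h3] at h2
    exact h2.hasDerivWithinAt
  have := intervalIntegral.integral_eq_sub_of_hasDeriv_right_of_le hz hcont hder (by simp)
  simp only [intervalIntegral.integral_zero, E_zero] at this
  norm_num [beta_zero] at this
  linarith

lemma E_eq_sign (z : ℝ) : E z = Real.sign z - Real.sign z * β (z ^ 2) := by
  rcases lt_trichotomy z 0 with h | h | h
  · rw [Real.sign_of_neg h, ← neg_neg z, E_neg, E_of_nonneg (by linarith)]; ring_nf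
  · simp [h, E_zero]
  · rw [Real.sign_of_pos h, E_of_nonneg h.le]; ring

lemma beta_eq_exp_mul {X : ℝ} :
    β X = Real.exp (-π * X) * ∫ s in Set.Ioi (0 : ℝ), (s + X) ^ (-1 / 2 : ℝ) * Real.exp (-π * s) := by
  have h := (measurePreserving_add_right volume X).setIntegral_preimage_emb
    (measurableEmbedding_addRight X) (fun u => u ^ (-1 / 2 : ℝ) * Real.exp (-π * u)) (Set.Ioi X)
  rw [β, ← h, ← integral_const_mul]
  simp only [Set.preimage_add_const_Ioi, sub_self]
  congr 1
  ext s
  rw [mul_add, Real.exp_add]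
  ring

lemma integrableOn_beta_shift {X : ℝ} (hX : 0 ≤ X) :
    IntegrableOn (fun s : ℝ => (s + X) ^ (-1 / 2 : ℝ) * Real.exp (-π * s)) (Set.Ioi 0) := by
  refine Integrable.mono' integrableOn_betaIntegrand (by fun_prop) ?_
  filter_upwards [self_mem_ae_restrict measurableSet_Ioi] with s hs
  have hs' : 0 < s := hs
  rw [Real.norm_of_nonneg (mul_nonneg (Real.rpow_nonneg (by linarith) _) (Real.exp_pos _).le)]
  exact mul_le_mul_of_nonneg_right
    (Real.rpow_le_rpow_of_nonpos hs' (by linarith) (by norm_num)) (Real.exp_pos _).le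

/-- After the substitution u = s + X the factor exp(-πX) splits off, and what remains is the
integral of an integrand that decreases in X. Both the exponential bound for β and the monotonicity
used at rational points come from this. -/
lemma beta_mul_exp_antitone {X Y : ℝ} (hX : 0 ≤ X) (hXY : X ≤ Y) :
    β Y * Real.exp (π * Y) ≤ β X * Real.exp (π * X) := by
  have key : ∀ Z : ℝ, β Z * Real.exp (π * Z) =
      ∫ s in Set.Ioi (0 : ℝ), (s + Z) ^ (-1 / 2 : ℝ) * Real.exp (-π * s) := fun Z => by
    rw [beta_eq_exp_mul, mul_right_comm, ← Real.exp_add, neg_mul, neg_add_cancel, Real.exp_zero,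
      one_mul]
  rw [key, key]
  refine setIntegral_mono_on (integrableOn_beta_shift (hX.trans hXY))
    (integrableOn_beta_shift hX) measurableSet_Ioi fun s hs => ?_
  have hs' : 0 < s := hs
  exact mul_le_mul_of_nonneg_right
    (Real.rpow_le_rpow_of_nonpos (by linarith) (by linarith) (by norm_num)) (Real.exp_pos _).le

lemma beta_nonneg {X : ℝ} (hX : 0 ≤ X) : 0 ≤ β X :=
  setIntegral_nonneg measurableSet_Ioi fun _ hu =>
    betaIntegrand_nonneg (hX.trans (Set.mem_Ioi.mp hu).le)

lemma beta_le_exp {X : ℝ} (hX : 0 ≤ X) : β X ≤ Real.exp (-π * X) := by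
  have h := beta_mul_exp_antitone le_rfl hX
  rw [beta_zero, mul_zero, Real.exp_zero, one_mul] at h
  rw [neg_mul, Real.exp_neg]
  exact (le_div_iff₀ (Real.exp_pos _)).mpr h |>.trans_eq (one_div _)

/-! ### Gaussian sums -/

lemma summable_gauss (a : ℝ) {c : ℝ} (hc : 0 < c) :
    Summable fun n : ℤ => Real.exp (-c * (a + n) ^ 2) := by
  have h := (summable_unary_exp a (τ := (c / (2 * π) : ℝ) * I)
    (by rw [Complex.im_ofReal_mul, Complex.I_im, mul_one]; positivity)).norm
  refine h.congr fun n => ?_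
  rw [Complex.norm_exp]
  congr 1
  have : 2 * π * I * (((c / (2 * π) : ℝ) : ℂ) * I) * (n + a) ^ 2 =
      ((-c * (a + n) ^ 2 : ℝ) : ℂ) := by
    push_cast
    have hpi : (π : ℂ) ≠ 0 := by exact_mod_cast Real.pi_ne_zero
    field_simp
    linear_combination (c : ℂ) * ((n : ℂ) + a) ^ 2 * Complex.I_sq
  rw [this, Complex.ofReal_re]

lemma summable_gauss_prod (a b : ℝ) {c d : ℝ} (hc : 0 < c) (hd : 0 < d) :
    Summable fun p : ℤ × ℤ => Real.exp (-c * (a + p.1) ^ 2) * Real.exp (-d * (b + p.2) ^ 2) :=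
  (summable_gauss a hc).mul_of_nonneg (summable_gauss b hd)
    (fun _ => (Real.exp_pos _).le) fun _ => (Real.exp_pos _).le

/-! ### The kernel of the indefinite theta function -/

/-- The summand of the indefinite theta function without characters. -/
def ker (τ : ℂ) (x₁ x₂ : ℝ) : ℂ :=
  ((E (√(15 * τ.im) * (x₁ - x₂)) + E (√(15 * τ.im) * (x₁ + x₂)) : ℝ) : ℂ) *
    exp (π * I * τ * (5 * x₁ ^ 2 - 3 * x₂ ^ 2))

lemma ker_neg_left (τ : ℂ) (x₁ x₂ : ℝ) : ker τ (-x₁) x₂ = -ker τ x₁ x₂ := by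
  rw [ker, ker, show -x₁ - x₂ = -(x₁ + x₂) by ring, show -x₁ + x₂ = -(x₁ - x₂) by ring,
    mul_neg, mul_neg, E_neg, E_neg]
  push_cast
  ring_nf

lemma ker_neg_right (τ : ℂ) (x₁ x₂ : ℝ) : ker τ x₁ (-x₂) = ker τ x₁ x₂ := by
  rw [ker, ker, sub_neg_eq_add, ← sub_eq_add_neg, add_comm (E _)]
  push_cast
  ring_nf

lemma continuous_ker (τ : ℂ) : Continuous fun x : ℝ × ℝ => ker τ x.1 x.2 := by
  have := continuous_E
  unfold ker
  fun_prop

/-- The coordinate along the tangent of the hyperbola. -/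
def hypU (t x₁ x₂ : ℝ) : ℝ := √10 * x₁ * Real.cosh t + √6 * x₂ * Real.sinh t

/-- The coordinate along the point of the hyperbola. -/
def hypV (t x₁ x₂ : ℝ) : ℝ := √10 * x₁ * Real.sinh t + √6 * x₂ * Real.cosh t

/-- The end point of the path on the hyperbola. -/
def hypT : ℝ := Real.arsinh √(3 / 2)

lemma hypT_nonneg : 0 ≤ hypT := Real.arsinh_nonneg_iff.mpr (Real.sqrt_nonneg _)

lemma sinh_hypT : Real.sinh hypT = √(3 / 2) := Real.sinh_arsinh _

lemma cosh_hypT : Real.cosh hypT = √(5 / 2) := by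
  rw [hypT, Real.cosh_arsinh, Real.sq_sqrt (by norm_num)]; norm_num

/-- `hypT` is chosen so that √y V at the end points t = ±`hypT` gives, up to sign, the two arguments
of E in `ker`. -/
lemma hypV_hypT (x₁ x₂ : ℝ) : hypV hypT x₁ x₂ = √15 * (x₁ + x₂) := by
  have h1 : √10 * √(3 / 2) = √15 := by rw [← Real.sqrt_mul (by norm_num)]; norm_num
  have h2 : √6 * √(5 / 2) = √15 := by rw [← Real.sqrt_mul (by norm_num)]; norm_num
  rw [hypV, sinh_hypT, cosh_hypT]
  linear_combination x₁ * h1 + x₂ * h2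

lemma hypV_neg_hypT (x₁ x₂ : ℝ) : hypV (-hypT) x₁ x₂ = -(√15 * (x₁ - x₂)) := by
  have := hypV_hypT (-x₁) x₂
  rw [hypV] at *
  rw [Real.sinh_neg, Real.cosh_neg]
  linear_combination this

/-- The form is invariant under hyperbolic rotation, since cosh² - sinh² = 1. -/
lemma hypU_sq_sub (t x₁ x₂ : ℝ) :
    hypU t x₁ x₂ ^ 2 - hypV t x₁ x₂ ^ 2 = 10 * x₁ ^ 2 - 6 * x₂ ^ 2 := by
  have h1 : (√10 : ℝ) ^ 2 = 10 := Real.sq_sqrt (by norm_num)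
  have h2 : (√6 : ℝ) ^ 2 = 6 := Real.sq_sqrt (by norm_num)
  have h3 := Real.cosh_sq t
  rw [hypU, hypV]
  linear_combination (x₁ ^ 2 * (Real.cosh t ^ 2 - Real.sinh t ^ 2)) * h1 -
    (x₂ ^ 2 * (Real.cosh t ^ 2 - Real.sinh t ^ 2)) * h2 + (10 * x₁ ^ 2 - 6 * x₂ ^ 2) * h3

/-- U + V and U - V are scaled by exp(t) and exp(-t), and both factors are at least exp(-`hypT`) on
the path. This makes the Gaussian decay uniform in t. -/
lemma hypU_sq_add {t : ℝ} (ht : |t| ≤ hypT) (x₁ x₂ : ℝ) :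
    6 * Real.exp (-2 * hypT) * (x₁ ^ 2 + x₂ ^ 2) ≤ hypU t x₁ x₂ ^ 2 + hypV t x₁ x₂ ^ 2 := by
  have h1 : (√10 : ℝ) ^ 2 = 10 := Real.sq_sqrt (by norm_num)
  have h2 : (√6 : ℝ) ^ 2 = 6 := Real.sq_sqrt (by norm_num)
  have e1 : hypU t x₁ x₂ + hypV t x₁ x₂ = Real.exp t * (√10 * x₁ + √6 * x₂) := by
    rw [← Real.cosh_add_sinh, hypU, hypV]; ring
  have e2 : hypU t x₁ x₂ - hypV t x₁ x₂ = Real.exp (-t) * (√10 * x₁ - √6 * x₂) := by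
    rw [← Real.cosh_sub_sinh, hypU, hypV]; ring
  have e3 : Real.exp (-2 * hypT) ≤ Real.exp t ^ 2 := by
    rw [← Real.exp_nat_mul]
    refine Real.exp_le_exp.mpr ?_
    push_cast; linarith [(abs_le.mp ht).1]
  have e4 : Real.exp (-2 * hypT) ≤ Real.exp (-t) ^ 2 := by
    rw [← Real.exp_nat_mul]
    refine Real.exp_le_exp.mpr ?_
    push_cast; linarith [(abs_le.mp ht).2]
  have e5 := mul_le_mul_of_nonneg_right e3 (sq_nonneg (√10 * x₁ + √6 * x₂))
  have e6 := mul_le_mul_of_nonneg_right e4 (sq_nonneg (√10 * x₁ - √6 * x₂))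
  rw [← mul_pow, ← e1] at e5
  rw [← mul_pow, ← e2] at e6
  have e7 : 6 * (x₁ ^ 2 + x₂ ^ 2) ≤ ((√10 * x₁ + √6 * x₂) ^ 2 + (√10 * x₁ - √6 * x₂) ^ 2) / 2 := by
    have : ((√10 * x₁ + √6 * x₂) ^ 2 + (√10 * x₁ - √6 * x₂) ^ 2) / 2 =
        10 * x₁ ^ 2 + 6 * x₂ ^ 2 := by
      linear_combination x₁ ^ 2 * h1 + x₂ ^ 2 * h2
    rw [this]; nlinarith [sq_nonneg x₁]
  have e8 := mul_le_mul_of_nonneg_left e7 (Real.exp_pos (-2 * hypT)).le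
  linarith

/-- The integrand in the representation of `ker` as an integral along the hyperbola. -/
def hypKer (τ : ℂ) (t x₁ x₂ : ℝ) : ℂ :=
  2 * (√τ.im : ℝ) * (hypU t x₁ x₂ *
    exp (π * I * τ / 2 * hypU t x₁ x₂ ^ 2 - π * I * (starRingEnd ℂ τ) / 2 * hypV t x₁ x₂ ^ 2))

lemma continuous_hypKer (τ : ℂ) :
    Continuous fun p : ℝ × ℝ × ℝ => hypKer τ p.1 p.2.1 p.2.2 := by
  unfold hypKer hypU hypV
  fun_prop

/-- As V' = U, the derivative of E(√y V) in t is 2√y U exp(-πyV²). Writing 10x₁² - 6x₂² as U² - V²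
and τ̄ as τ - 2iy merges the two exponentials into one that is separated in U and V. -/
lemma ker_eq_integral {τ : ℂ} (hτ : 0 < τ.im) (x₁ x₂ : ℝ) :
    ker τ x₁ x₂ = ∫ t in (-hypT)..hypT, hypKer τ t x₁ x₂ := by
  have hV : ∀ t, HasDerivAt (fun t => hypV t x₁ x₂) (hypU t x₁ x₂) t := fun t =>
    ((Real.hasDerivAt_sinh t).const_mul _).add ((Real.hasDerivAt_cosh t).const_mul _)
  have hd : ∀ t ∈ Set.uIcc (-hypT) hypT, HasDerivAt
      (fun t => ((E (√τ.im * hypV t x₁ x₂) : ℝ) : ℂ) * exp (π * I * τ * (5 * x₁ ^ 2 - 3 * x₂ ^ 2)))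
      (hypKer τ t x₁ x₂) t := by
    intro t _
    have h1 := (((hasDerivAt_E (√τ.im * hypV t x₁ x₂)).comp t
      ((hV t).const_mul (√τ.im))).ofReal_comp).mul_const (exp (π * I * τ * (5 * x₁ ^ 2 - 3 * x₂ ^ 2)))
    refine h1.congr_deriv ?_
    have h2 : (hypU t x₁ x₂ : ℂ) ^ 2 - (hypV t x₁ x₂ : ℂ) ^ 2 = 10 * x₁ ^ 2 - 6 * x₂ ^ 2 := by
      exact_mod_cast hypU_sq_sub t x₁ x₂
    have h3 : (starRingEnd ℂ τ) = τ - 2 * τ.im * I := by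
      apply Complex.ext <;> simp; ring
    have h4 : (-π * (√τ.im * hypV t x₁ x₂) ^ 2 : ℝ) = -π * τ.im * hypV t x₁ x₂ ^ 2 := by
      rw [mul_pow, Real.sq_sqrt hτ.le]; ring
    rw [hypKer, h3, h4]
    have h5 : π * I * τ / 2 * (hypU t x₁ x₂ : ℂ) ^ 2 -
        π * I * (τ - 2 * τ.im * I) / 2 * (hypV t x₁ x₂ : ℂ) ^ 2 =
        ((-π * τ.im * hypV t x₁ x₂ ^ 2 : ℝ) : ℂ) + π * I * τ * (5 * x₁ ^ 2 - 3 * x₂ ^ 2) := by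
      push_cast
      linear_combination π * I * τ / 2 * h2 + π * τ.im * (hypV t x₁ x₂ : ℂ) ^ 2 * Complex.I_sq
    rw [h5, Complex.exp_add]
    push_cast
    ring
  have hc : Continuous fun t => hypKer τ t x₁ x₂ :=
    (continuous_hypKer τ).comp (f := fun t : ℝ => ((t, x₁, x₂) : ℝ × ℝ × ℝ)) (by fun_prop)
  rw [intervalIntegral.integral_eq_sub_of_hasDerivAt hd (hc.intervalIntegrable _ _),
    ← sub_mul, hypV_hypT, hypV_neg_hypT, mul_neg, E_neg, ker, ← mul_assoc, ← mul_assoc,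
    ← Real.sqrt_mul hτ.le, mul_comm τ.im 15]
  push_cast
  ring

lemma norm_hypKer (τ : ℂ) (t x₁ x₂ : ℝ) :
    ‖hypKer τ t x₁ x₂‖ = 2 * √τ.im * (|hypU t x₁ x₂| *
      Real.exp (-(π * τ.im / 2) * (hypU t x₁ x₂ ^ 2 + hypV t x₁ x₂ ^ 2))) := by
  rw [hypKer, norm_mul, norm_mul, norm_mul, Complex.norm_exp, Complex.norm_real, Complex.norm_real,
    Complex.norm_ofNat, Real.norm_eq_abs, Real.norm_eq_abs, abs_of_nonneg (Real.sqrt_nonneg _)]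
  congr 3
  have : π * I * τ / 2 * (hypU t x₁ x₂ : ℂ) ^ 2 -
      π * I * (starRingEnd ℂ τ) / 2 * (hypV t x₁ x₂ : ℂ) ^ 2 =
      ((π / 2 * hypU t x₁ x₂ ^ 2 : ℝ) : ℂ) * (I * τ) -
      ((π / 2 * hypV t x₁ x₂ ^ 2 : ℝ) : ℂ) * (I * starRingEnd ℂ τ) := by
    push_cast; ring
  rw [this, Complex.sub_re, Complex.re_ofReal_mul, Complex.re_ofReal_mul]
  simp
  ring

lemma abs_mul_exp_le {a : ℝ} (ha : 0 < a) (u : ℝ) :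
    |u| * Real.exp (-(2 * a) * u ^ 2) ≤ Real.exp (1 / (4 * a)) * Real.exp (-a * u ^ 2) := by
  have h1 : |u| ≤ Real.exp |u| := by linarith [Real.add_one_le_exp |u|]
  have h2 : |u| ≤ a * u ^ 2 + 1 / (4 * a) := by
    have : 0 ≤ a * (|u| - 1 / (2 * a)) ^ 2 := by positivity
    have h3 : a * (|u| - 1 / (2 * a)) ^ 2 = a * u ^ 2 + 1 / (4 * a) - |u| := by
      rw [← sq_abs u]; field_simp; ring
    linarith
  calc |u| * Real.exp (-(2 * a) * u ^ 2)
      ≤ Real.exp |u| * Real.exp (-(2 * a) * u ^ 2) :=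
        mul_le_mul_of_nonneg_right h1 (Real.exp_pos _).le
    _ ≤ _ := by
        rw [← Real.exp_add, ← Real.exp_add]
        exact Real.exp_le_exp.mpr (by linarith)

lemma norm_hypKer_le {τ : ℂ} (hτ : 0 < τ.im) : ∃ C c : ℝ, 0 < c ∧ 0 ≤ C ∧ ∀ t, |t| ≤ hypT →
    ∀ x₁ x₂ : ℝ, ‖hypKer τ t x₁ x₂‖ ≤ C * Real.exp (-c * (x₁ ^ 2 + x₂ ^ 2)) := by
  -- The Gaussian in U has exponent -(2a)U²; half of it is spent on absorbing the factor |U|.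
  set a := π * τ.im / 4 with ha
  have ha0 : 0 < a := by positivity
  refine ⟨2 * √τ.im * Real.exp (1 / (4 * a)), a * (6 * Real.exp (-2 * hypT)), by positivity,
    by positivity, fun t ht x₁ x₂ => ?_⟩
  rw [norm_hypKer, mul_assoc (2 * √τ.im)]
  refine mul_le_mul_of_nonneg_left ?_ (by positivity)
  have h1 := hypU_sq_add ht x₁ x₂
  calc |hypU t x₁ x₂| * Real.exp (-(π * τ.im / 2) * (hypU t x₁ x₂ ^ 2 + hypV t x₁ x₂ ^ 2))
      = |hypU t x₁ x₂| * Real.exp (-(2 * a) * hypU t x₁ x₂ ^ 2) *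
          Real.exp (-(2 * a) * hypV t x₁ x₂ ^ 2) := by
        rw [mul_assoc, ← Real.exp_add]; congr 2; rw [ha]; ring
    _ ≤ Real.exp (1 / (4 * a)) * Real.exp (-a * hypU t x₁ x₂ ^ 2) *
          Real.exp (-a * hypV t x₁ x₂ ^ 2) := by
        refine mul_le_mul (abs_mul_exp_le ha0 _) (Real.exp_le_exp.mpr ?_) (Real.exp_pos _).le
          (by positivity)
        nlinarith [sq_nonneg (hypV t x₁ x₂)]
    _ ≤ _ := by
        rw [mul_assoc, ← Real.exp_add]
        refine mul_le_mul_of_nonneg_left (Real.exp_le_exp.mpr ?_) (Real.exp_pos _).le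
        nlinarith

/-- The exponential in `ker` grows where the indefinite form is negative; the cancellation between
the two values of E is made visible by the path integral, whose integrand is uniformly Gaussian. -/
lemma norm_ker_le {τ : ℂ} (hτ : 0 < τ.im) : ∃ C c : ℝ, 0 < c ∧ 0 ≤ C ∧
    ∀ x₁ x₂ : ℝ, ‖ker τ x₁ x₂‖ ≤ C * Real.exp (-c * (x₁ ^ 2 + x₂ ^ 2)) := by
  obtain ⟨C, c, hc, hC, h⟩ := norm_hypKer_le hτ
  refine ⟨C * |hypT - -hypT|, c, hc, by positivity, fun x₁ x₂ => ?_⟩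
  rw [ker_eq_integral hτ, mul_right_comm]
  refine intervalIntegral.norm_integral_le_of_norm_le_const fun t ht => h t ?_ x₁ x₂
  rw [Set.uIoc_of_le (by linarith [hypT_nonneg])] at ht
  exact abs_le.mpr ⟨ht.1.le, ht.2⟩

lemma summable_ker {τ : ℂ} (hτ : 0 < τ.im) (a b : ℝ) :
    Summable fun p : ℤ × ℤ => ker τ (a + p.1) (b + p.2) := by
  obtain ⟨C, c, hc, hC, h⟩ := norm_ker_le hτ
  refine Summable.of_norm_bounded ((summable_gauss_prod a b hc hc).mul_left C) fun p => ?_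
  rw [← Real.exp_add, ← mul_add]
  exact h _ _

/-! ### Poisson summation in several variables -/

section Poisson

variable {d : Type*}

lemma iUnion_cube : ⋃ n : d → ℤ, {x : d → ℝ | ∀ i, x i ∈ Set.Ioc (n i : ℝ) (n i + 1)} =
    Set.univ := by
  refine Set.eq_univ_of_forall fun x => Set.mem_iUnion.mpr ⟨fun i => ⌈x i⌉ - 1, fun i => ?_⟩
  push_cast
  exact ⟨by linarith [Int.ceil_lt_add_one (x i)], by linarith [Int.le_ceil (x i)]⟩

lemma pairwise_disjoint_cube : Pairwise (Function.onFun Disjoint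
    fun n : d → ℤ => {x : d → ℝ | ∀ i, x i ∈ Set.Ioc (n i : ℝ) (n i + 1)}) := by
  intro m n hmn
  refine Set.disjoint_left.mpr fun x hx hy => hmn ?_
  funext i
  have h1 := hx i
  have h2 := hy i
  have h3 : (m i : ℝ) < n i + 1 := h1.1.trans_le h2.2
  have h4 : (n i : ℝ) < m i + 1 := h2.1.trans_le h1.2
  norm_cast at h3 h4
  lia

variable [Fintype d]

/-- The character `exp (2πi m·x)`. -/
def latticeChar (m : d → ℤ) (x : d → ℝ) : ℂ := exp (2 * π * I * ∑ i, (m i : ℂ) * x i)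

/-- The real vector with given integral coordinates. -/
def intVec (n : d → ℤ) : d → ℝ := fun i => n i

lemma mFourier_coe (m : d → ℤ) (x : d → ℝ) :
    UnitAddTorus.mFourier m (fun i => (x i : UnitAddCircle)) = latticeChar m x := by
  simp only [UnitAddTorus.mFourier, ContinuousMap.coe_mk, fourier_coe_apply, latticeChar,
    ← Complex.exp_sum, Finset.mul_sum]
  congr 1
  refine Finset.sum_congr rfl fun i _ => ?_
  push_cast
  ring

lemma continuous_latticeChar (m : d → ℤ) : Continuous (latticeChar m) := by
  unfold latticeChar; fun_prop

lemma norm_latticeChar (m : d → ℤ) (x : d → ℝ) : ‖latticeChar m x‖ = 1 := by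
  rw [latticeChar, show (2 * π * I * ∑ i, (m i : ℂ) * x i : ℂ) =
    ((2 * π * ∑ i, (m i : ℝ) * x i : ℝ) : ℂ) * I by push_cast; ring]
  exact Complex.norm_exp_ofReal_mul_I _

lemma latticeChar_add_intVec (m n : d → ℤ) (x : d → ℝ) :
    latticeChar m (x + intVec n) = latticeChar m x := by
  rw [latticeChar, latticeChar]
  have : (2 * π * I * ∑ i, (m i : ℂ) * ((x + intVec n) i : ℝ) : ℂ) =
      2 * π * I * ∑ i, (m i : ℂ) * x i + ((∑ i, m i * n i : ℤ) : ℂ) * (2 * π * I) := by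
    simp only [Pi.add_apply, intVec]
    push_cast
    simp only [mul_add, Finset.sum_add_distrib]
    ring
  rw [this, Complex.exp_add, Complex.exp_int_mul_two_pi_mul_I, mul_one]

lemma setIntegral_cube_add {F : Type*} [NormedAddCommGroup F] [NormedSpace ℝ F] (g : (d → ℝ) → F) (n : d → ℤ) :
    ∫ x in {x : d → ℝ | ∀ i, x i ∈ Set.Ioc (0 : ℝ) (0 + 1)}, g (x + intVec n) =
      ∫ x in {x : d → ℝ | ∀ i, x i ∈ Set.Ioc (n i : ℝ) (n i + 1)}, g x := by
  have h := (measurePreserving_add_right (volume : Measure (d → ℝ)) (intVec n)).setIntegral_preimage_emb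
    (measurableEmbedding_addRight (intVec n)) g {x : d → ℝ | ∀ i, x i ∈ Set.Ioc (n i : ℝ) (n i + 1)}
  rw [← h]
  congr 2
  ext x
  refine forall_congr' fun i => ?_
  simp only [Pi.add_apply, intVec, Set.mem_Ioc]
  constructor <;> rintro ⟨h1, h2⟩ <;> constructor <;> linarith

lemma measurableSet_cube (n : d → ℝ) :
    MeasurableSet {x : d → ℝ | ∀ i, x i ∈ Set.Ioc (n i : ℝ) (n i + 1)} := by
  have : {x : d → ℝ | ∀ i, x i ∈ Set.Ioc (n i : ℝ) (n i + 1)} =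
      Set.univ.pi fun i => Set.Ioc (n i) (n i + 1) := by ext; simp
  rw [this]
  exact MeasurableSet.univ_pi fun _ => measurableSet_Ioc

lemma norm_le_of_mem_cube {x : d → ℝ} (hx : ∀ i, x i ∈ Set.Ioc (0 : ℝ) (0 + 1)) : ‖x‖ ≤ 1 :=
  (pi_norm_le_iff_of_nonneg zero_le_one).mpr fun i => by
    rw [Real.norm_of_nonneg (hx i).1.le]; linarith [(hx i).2]

lemma volume_cube : volume {x : d → ℝ | ∀ i, x i ∈ Set.Ioc (0 : ℝ) (0 + 1)} = 1 := by
  have : {x : d → ℝ | ∀ i, x i ∈ Set.Ioc (0 : ℝ) (0 + 1)} =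
      Set.univ.pi fun _ => Set.Ioc (0 : ℝ) (0 + 1) := by ext; simp
  rw [this, Real.volume_pi_Ioc]
  simp

/-- The integral over the space is the integral over the unit cube of the periodization. -/
lemma hasSum_setIntegral_cube {g : (d → ℝ) → ℂ} (hg : Continuous g) {u : (d → ℤ) → ℝ}
    (hu : Summable u) (hb : ∀ x : d → ℝ, ‖x‖ ≤ 1 → ∀ n, ‖g (x + intVec n)‖ ≤ u n) :
    ∫ x in {x : d → ℝ | ∀ i, x i ∈ Set.Ioc (0 : ℝ) (0 + 1)}, ∑' n, g (x + intVec n) =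
      ∫ x, g x := by
  set Q := {x : d → ℝ | ∀ i, x i ∈ Set.Ioc (0 : ℝ) (0 + 1)} with hQ
  have hQm : MeasurableSet Q := measurableSet_cube fun _ => 0
  have hbound : ∀ n, ∀ᵐ x ∂(volume.restrict Q), ‖g (x + intVec n)‖ ≤ u n := fun n => by
    filter_upwards [self_mem_ae_restrict hQm] with x hx
    exact hb x (norm_le_of_mem_cube hx) n
  have : IsFiniteMeasure (volume.restrict Q) := ⟨by
    rw [Measure.restrict_apply_univ, volume_cube]; exact ENNReal.one_lt_top⟩
  have hi : ∀ n, IntegrableOn (fun x => g (x + intVec n)) Q := fun n =>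
    Integrable.mono' (integrable_const (u n)) (by fun_prop) (hbound n)
  have hn : ∀ n, ∫ x in Q, ‖g (x + intVec n)‖ ≤ u n := fun n => by
    have h := integral_mono_ae (hi n).norm (integrable_const (u n)) (hbound n)
    have hv : volume Q = 1 := volume_cube
    simpa only [integral_const, Measure.real, Measure.restrict_apply_univ, hv, ENNReal.toReal_one,
      one_smul] using h
  have hsum : Summable fun n => ∫ x in Q, ‖g (x + intVec n)‖ :=
    Summable.of_nonneg_of_le (fun n => integral_nonneg fun _ => norm_nonneg _) hn hu
  have h1 := hasSum_integral_of_summable_integral_norm hi hsum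
  have hcube : ∀ n : d → ℤ, IntegrableOn g {x | ∀ i, x i ∈ Set.Ioc (n i : ℝ) (n i + 1)} := fun n => by
    have h2 := ((measurePreserving_add_right (volume : Measure (d → ℝ)) (intVec n)).integrableOn_comp_preimage
      (measurableEmbedding_addRight (intVec n)) (f := g)
      (s := {x : d → ℝ | ∀ i, x i ∈ Set.Ioc (n i : ℝ) (n i + 1)})).mp
    refine h2 ?_
    convert! hi n using 1
    ext x
    refine forall_congr' fun i => ?_
    simp only [Pi.add_apply, intVec, Set.mem_Ioc]
    constructor <;> rintro ⟨h1, h2⟩ <;> constructor <;> linarith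
  have h3 : IntegrableOn g (⋃ n : d → ℤ, {x | ∀ i, x i ∈ Set.Ioc (n i : ℝ) (n i + 1)}) := by
    refine integrableOn_iUnion_of_summable_integral_norm hcube ?_
    refine hsum.congr fun n => ?_
    exact setIntegral_cube_add (fun x => ‖g x‖) n
  have h4 := hasSum_integral_iUnion (fun n : d → ℤ => measurableSet_cube fun i => (n i : ℝ))
    pairwise_disjoint_cube h3
  rw [iUnion_cube, Measure.restrict_univ] at h4
  refine h1.unique ?_
  refine h4.congr_fun fun n => ?_
  exact setIntegral_cube_add g n

/-- **Poisson summation** on `ℝ^d`. -/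
theorem poisson_summation {f : (d → ℝ) → ℂ} (hf : Continuous f)
    (hb : ∀ r : ℝ, ∃ u : (d → ℤ) → ℝ, Summable u ∧
      ∀ x : d → ℝ, ‖x‖ ≤ r → ∀ n, ‖f (x + intVec n)‖ ≤ u n)
    (hs : Summable fun m : d → ℤ => ∫ x, latticeChar (-m) x * f x) (x : d → ℝ) :
    ∑' n, f (x + intVec n) =
      ∑' m : d → ℤ, (∫ x, latticeChar (-m) x * f x) * latticeChar m x := by
  set P : (d → ℝ) → ℂ := fun x => ∑' n, f (x + intVec n) with hP
  have hPc : Continuous P := by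
    refine continuous_iff_continuousAt.mpr fun x₀ => ?_
    obtain ⟨u, hu, hub⟩ := hb (‖x₀‖ + 1)
    have h1 : ContinuousOn P (Metric.ball 0 (‖x₀‖ + 1)) :=
      continuousOn_tsum (fun n => by fun_prop) hu fun n x hx =>
        hub x (by rw [mem_ball_zero_iff] at hx; exact hx.le) n
    exact h1.continuousAt (Metric.isOpen_ball.mem_nhds (by simp))
  have hq : IsOpenQuotientMap (Pi.map fun (_ : d) (t : ℝ) => (t : UnitAddCircle)) :=
    IsOpenQuotientMap.piMap fun _ => QuotientAddGroup.isOpenQuotientMap_mk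
  have hfac : Function.FactorsThrough P (Pi.map fun (_ : d) (t : ℝ) => (t : UnitAddCircle)) := by
    intro a b hab
    have h1 : ∀ i, ∃ n : ℤ, a i = b i + n := fun i => by
      have h2 : (a i : UnitAddCircle) = b i := congrFun hab i
      have h3 : ((a i - b i : ℝ) : UnitAddCircle) = 0 := by rw [AddCircle.coe_sub, h2, sub_self]
      obtain ⟨n, hn⟩ := (AddCircle.coe_eq_zero_iff 1).mp h3
      refine ⟨n, ?_⟩
      simp only [zsmul_eq_mul, mul_one] at hn
      linarith
    choose n hn using h1
    have h2 : a = b + intVec n := funext hn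
    rw [h2, hP]
    simp only
    rw [← (Equiv.addLeft n).tsum_eq fun k => f (b + intVec k)]
    refine tsum_congr fun k => ?_
    congr 1
    ext i
    simp [intVec, add_assoc]
  -- The periodization P is continuous and constant on the fibres of the open quotient map to the
  -- torus, so it descends.
  let F : C(UnitAddTorus d, ℂ) :=
    Topology.IsQuotientMap.lift (f := ⟨_, hq.continuous⟩) hq.isQuotientMap ⟨P, hPc⟩ hfac
  have hF : ∀ x : d → ℝ, F (fun i => (x i : UnitAddCircle)) = P x := fun x => by
    have := DFunLike.congr_fun (Topology.IsQuotientMap.lift_comp (f := ⟨_, hq.continuous⟩)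
      hq.isQuotientMap ⟨P, hPc⟩ hfac) x
    exact this
  -- Unfolding: the character is invariant under integral translations, so it enters the
  -- periodization and the integral over the cube becomes one over the whole space.
  have hcoeff : ∀ m, UnitAddTorus.mFourierCoeff F m = ∫ x, latticeChar (-m) x * f x := by
    intro m
    obtain ⟨u, hu, hub⟩ := hb 1
    rw [UnitAddTorus.mFourierCoeff_eq_integral F m fun _ => 0,
      ← hasSum_setIntegral_cube (g := fun x => latticeChar (-m) x * f x)
        ((continuous_latticeChar _).mul hf) hu fun x hx n => by
          rw [norm_mul, norm_latticeChar, one_mul]; exact hub x hx n]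
    congr 1
    ext x
    rw [mFourier_coe, hF, smul_eq_mul, hP]
    simp only [latticeChar_add_intVec]
    rw [tsum_mul_left]
  have hs' : Summable (UnitAddTorus.mFourierCoeff F) := by
    simpa only [funext hcoeff] using hs
  have h := UnitAddTorus.hasSum_mFourier_series_apply_of_summable hs'
    fun i => (x i : UnitAddCircle)
  rw [hF] at h
  change P x = _
  rw [← h.tsum_eq]
  refine tsum_congr fun m => ?_
  rw [mFourier_coe, hcoeff, smul_eq_mul]

end Poisson

/-! ### The Fourier transform of the kernel -/

lemma integrable_mul_cexp {b : ℂ} (hb : b.re < 0) (s : ℝ) :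
    Integrable fun w : ℝ => (w : ℂ) * exp (b * w ^ 2 + (s : ℂ) * I * w) := by
  have hg : Integrable fun w : ℝ => Real.exp (1 / (4 * (-b.re / 2))) * Real.exp (-(-b.re / 2) * w ^ 2) :=
    (integrable_exp_neg_mul_sq (by linarith)).const_mul _
  refine Integrable.mono' hg (by fun_prop) (Eventually.of_forall fun w => ?_)
  have h := abs_mul_exp_le (a := -b.re / 2) (by linarith) w
  rw [norm_mul, Complex.norm_real, Real.norm_eq_abs, Complex.norm_exp]
  have : (b * w ^ 2 + (s : ℂ) * I * w).re = -(2 * (-b.re / 2)) * w ^ 2 := by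
    rw [show (b * w ^ 2 + (s : ℂ) * I * w : ℂ) = b * ((w ^ 2 : ℝ) : ℂ) + ((s * w : ℝ) : ℂ) * I by
      push_cast; ring, Complex.add_re, Complex.re_mul_ofReal, Complex.re_ofReal_mul, Complex.I_re]
    ring
  rw [this]
  exact h

lemma integral_cexp_gauss {b : ℂ} (hb : b.re < 0) (s : ℝ) :
    ∫ w : ℝ, exp (b * w ^ 2 + (s : ℂ) * I * w) =
      (π / -b) ^ (1 / 2 : ℂ) * exp ((s : ℂ) ^ 2 / (4 * b)) := by
  have h := integral_cexp_quadratic hb ((s : ℂ) * I) 0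
  simp only [add_zero, zero_sub, mul_pow, Complex.I_sq] at h
  rw [h]
  congr 2
  ring

/-- The integral of the derivative of the Gaussian is zero, which expresses the first moment through
the Gaussian integral itself. -/
lemma integral_mul_cexp_gauss {b : ℂ} (hb : b.re < 0) (s : ℝ) :
    ∫ w : ℝ, (w : ℂ) * exp (b * w ^ 2 + (s : ℂ) * I * w) =
      -(s * I) / (2 * b) * ((π / -b) ^ (1 / 2 : ℂ) * exp ((s : ℂ) ^ 2 / (4 * b))) := by
  have hb0 : b ≠ 0 := fun h => by simp [h] at hb
  have hi1 := integrable_mul_cexp hb s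
  have hi2 : Integrable fun w : ℝ => exp (b * w ^ 2 + (s : ℂ) * I * w) := by
    simpa using integrable_cexp_quadratic' hb ((s : ℂ) * I) 0
  have hd : ∀ w : ℝ, HasDerivAt (fun w : ℝ => exp (b * w ^ 2 + (s : ℂ) * I * w))
      (2 * b * (w * exp (b * w ^ 2 + (s : ℂ) * I * w)) +
        (s : ℂ) * I * exp (b * w ^ 2 + (s : ℂ) * I * w)) w := fun w => by
    have h1 : HasDerivAt (fun z : ℂ => exp (b * z ^ 2 + (s : ℂ) * I * z))
        (exp (b * (w : ℂ) ^ 2 + (s : ℂ) * I * w) * (b * (((2 : ℕ) : ℂ) * (w : ℂ) ^ (2 - 1)) + (s : ℂ) * I * 1)) (w : ℂ) :=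
      (((hasDerivAt_pow 2 (w : ℂ)).const_mul b).add ((hasDerivAt_id (w : ℂ)).const_mul _)).cexp
    refine h1.comp_ofReal.congr_deriv ?_
    push_cast
    ring
  have h0 := integral_eq_zero_of_hasDerivAt_of_integrable hd
    ((hi1.const_mul (2 * b)).add (hi2.const_mul ((s : ℂ) * I))) hi2
  rw [integral_add (hi1.const_mul (2 * b)) (hi2.const_mul ((s : ℂ) * I)), integral_const_mul,
    integral_const_mul, integral_cexp_gauss hb] at h0
  rw [div_mul_eq_mul_div, eq_div_iff (by simpa using hb0)]
  linear_combination h0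

/-- The Gaussians in U and V have complex conjugate parameters. The product of their principal
square roots is therefore a modulus, and no branch enters the Fourier transform of the kernel. -/
lemma cpow_half_mul_conj {z : ℂ} (hz : 0 < z.re) :
    z ^ (1 / 2 : ℂ) * (starRingEnd ℂ z) ^ (1 / 2 : ℂ) = (‖z‖ : ℝ) := by
  have harg : z.arg ≠ π := fun h => by
    have := (Complex.arg_eq_pi_iff.mp h).1; linarith
  have h1 := Complex.conj_cpow z (1 / 2) harg
  have h2 : starRingEnd ℂ (1 / 2 : ℂ) = 1 / 2 := by
    rw [map_div₀, map_one, Complex.conj_ofNat]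
  rw [h2] at h1
  rw [h1, Complex.mul_conj, Complex.normSq_eq_norm_sq, Complex.norm_cpow_of_ne_zero
    (fun h => by simp [h] at hz)]
  norm_num
  rw [← Complex.ofReal_pow, ← Real.rpow_natCast, ← Real.rpow_mul (norm_nonneg _)]
  norm_num

/-- The matrix of the hyperbolic coordinates. -/
def hypMatrix (t : ℝ) : Matrix (Fin 2) (Fin 2) ℝ :=
  !![√10 * Real.cosh t, √6 * Real.sinh t; √10 * Real.sinh t, √6 * Real.cosh t]

lemma det_hypMatrix (t : ℝ) : (hypMatrix t).det = 2 * √15 := by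
  have h1 : √10 * √6 = 2 * √15 := by
    rw [← Real.sqrt_mul (by norm_num), show (10 * 6 : ℝ) = 2 ^ 2 * 15 by norm_num,
      Real.sqrt_mul (by norm_num), Real.sqrt_sq (by norm_num)]
  rw [hypMatrix, Matrix.det_fin_two_of]
  linear_combination h1 * (Real.cosh t ^ 2 - Real.sinh t ^ 2) + 2 * √15 * Real.cosh_sq t

lemma hypMatrix_apply (t : ℝ) (x : Fin 2 → ℝ) :
    Matrix.toLin' (hypMatrix t) x = ![hypU t (x 0) (x 1), hypV t (x 0) (x 1)] := by
  ext i
  fin_cases i <;>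
    simp [hypMatrix, hypU, hypV, Matrix.toLin'_apply, Matrix.mulVec, dotProduct] <;> ring

lemma integral_comp_hypMatrix (t : ℝ) {g : (Fin 2 → ℝ) → ℂ} (hg : Continuous g) :
    ∫ x : Fin 2 → ℝ, g ![hypU t (x 0) (x 1), hypV t (x 0) (x 1)] =
      (1 / (2 * √15) : ℝ) * ∫ w, g w := by
  have hdet : (hypMatrix t).det ≠ 0 := by rw [det_hypMatrix]; positivity
  have h1 := Real.map_matrix_volume_pi_eq_smul_volume_pi hdet
  have hm : Measurable (Matrix.toLin' (hypMatrix t)) :=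
    (LinearMap.continuous_of_finiteDimensional _).measurable
  have h2 := integral_map (μ := volume) hm.aemeasurable (f := g) hg.aestronglyMeasurable
  rw [h1, integral_smul_measure, det_hypMatrix] at h2
  simp only [hypMatrix_apply] at h2
  rw [← h2, ENNReal.toReal_ofReal (abs_nonneg _), abs_of_nonneg (by positivity), one_div,
    Complex.real_smul]

/-- Polarization of the invariant form at A⁻¹ξ = (ξ₁/5, -ξ₂/3). It splits the Fourier phase into one
phase in U and one in V. -/
lemma hyp_bilinear (t x₁ x₂ ξ₁ ξ₂ : ℝ) :
    hypU t x₁ x₂ * hypU t (ξ₁ / 5) (-ξ₂ / 3) - hypV t x₁ x₂ * hypV t (ξ₁ / 5) (-ξ₂ / 3) =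
      2 * (x₁ * ξ₁ + x₂ * ξ₂) := by
  have h1 : (√10 : ℝ) ^ 2 = 10 := Real.sq_sqrt (by norm_num)
  have h2 : (√6 : ℝ) ^ 2 = 6 := Real.sq_sqrt (by norm_num)
  have h3 := Real.cosh_sq t
  simp only [hypU, hypV]
  linear_combination (x₁ * ξ₁ / 5 * (Real.cosh t ^ 2 - Real.sinh t ^ 2)) * h1 +
    (x₂ * ξ₂ / 3 * (Real.cosh t ^ 2 - Real.sinh t ^ 2)) * h2 + 2 * (x₁ * ξ₁ + x₂ * ξ₂) * h3

lemma im_neg_one_div (τ : ℂ) : (-1 / τ).im = τ.im / ‖τ‖ ^ 2 := by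
  rw [neg_div, neg_im, one_div, inv_im, neg_div, neg_neg, Complex.normSq_eq_norm_sq]

/-- The Fourier transform of a point of the path. -/
lemma integral_hypKer {τ : ℂ} (hτ : 0 < τ.im) (t ξ₁ ξ₂ : ℝ) :
    ∫ x : Fin 2 → ℝ, exp (-(2 * π * I * (x 0 * ξ₁ + x 1 * ξ₂))) * hypKer τ t (x 0) (x 1) =
      1 / (√15 * τ) * hypKer (-1 / τ) t (ξ₁ / 5) (-ξ₂ / 3) := by
  set u := hypU t (ξ₁ / 5) (-ξ₂ / 3) with hu
  set v := hypV t (ξ₁ / 5) (-ξ₂ / 3) with hv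
  have h0 := ne_zero_of_im_pos hτ
  have hc0 : starRingEnd ℂ τ ≠ 0 := by simpa using h0
  let f : Fin 2 → ℝ → ℂ := ![fun w => (w : ℂ) * exp (π * I * τ / 2 * w ^ 2 + ((-π * u : ℝ) : ℂ) * I * w),
    fun w => exp (-(π * I * starRingEnd ℂ τ / 2) * w ^ 2 + ((π * v : ℝ) : ℂ) * I * w)]
  have hcont : Continuous fun w : Fin 2 → ℝ => 2 * ((√τ.im : ℝ) : ℂ) * ∏ i, f i (w i) := by
    simp only [f, Fin.prod_univ_two, Matrix.cons_val_zero, Matrix.cons_val_one]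
    fun_prop
  -- In the coordinates (U, V) the integrand is a product: a first moment of a Gaussian in U times a
  -- Gaussian in V.
  have h1 : ∀ x : Fin 2 → ℝ,
      exp (-(2 * π * I * (x 0 * ξ₁ + x 1 * ξ₂))) * hypKer τ t (x 0) (x 1) =
      (fun w : Fin 2 → ℝ => 2 * ((√τ.im : ℝ) : ℂ) * ∏ i, f i (w i))
        ![hypU t (x 0) (x 1), hypV t (x 0) (x 1)] := by
    intro x
    have hb : (hypU t (x 0) (x 1) : ℂ) * u - (hypV t (x 0) (x 1) : ℂ) * v =
        2 * (x 0 * ξ₁ + x 1 * ξ₂) := by exact_mod_cast hyp_bilinear t (x 0) (x 1) ξ₁ ξ₂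
    simp only [f, Fin.prod_univ_two, Matrix.cons_val_zero, Matrix.cons_val_one, hypKer]
    rw [mul_assoc _ (exp _) (exp _), ← Complex.exp_add, mul_left_comm, mul_left_comm (exp _),
      ← Complex.exp_add]
    congr 3
    push_cast
    linear_combination (π * I) * hb
  have hre1 : (π * I * τ / 2 : ℂ).re < 0 := by
    have : (π * I * τ / 2 : ℂ).re = -(π * τ.im / 2) := by
      rw [show (π * I * τ / 2 : ℂ) = ((π / 2 : ℝ) : ℂ) * (I * τ) by push_cast; ring,
        Complex.re_ofReal_mul]
      simp; ring
    rw [this]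
    have := mul_pos Real.pi_pos hτ
    linarith
  have hconj : -(π * I * starRingEnd ℂ τ / 2) = starRingEnd ℂ (π * I * τ / 2) := by
    simp only [map_div₀, map_mul, Complex.conj_ofReal, Complex.conj_I, Complex.conj_ofNat]; ring
  have hre2 : (-(π * I * starRingEnd ℂ τ / 2)).re < 0 := by rw [hconj, Complex.conj_re]; exact hre1
  have hz : 0 < (π / -(π * I * τ / 2)).re := by
    have : (π / -(π * I * τ / 2)) = 2 * (-1 / τ) * -I := by
      have : (π : ℂ) ≠ 0 := by exact_mod_cast Real.pi_ne_zero
      field_simp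
      linear_combination -Complex.I_sq
    rw [this]
    have := im_neg_one_div_pos hτ
    simpa using this
  have hz2 : (π / - -(π * I * starRingEnd ℂ τ / 2)) = starRingEnd ℂ (π / -(π * I * τ / 2)) := by
    rw [hconj]; simp only [map_div₀, map_neg, Complex.conj_ofReal]
  have hprod := cpow_half_mul_conj hz
  have hnorm : ‖(π / -(π * I * τ / 2) : ℂ)‖ = 2 / ‖τ‖ := by
    rw [norm_div, norm_neg, norm_div, norm_mul, norm_mul, Complex.norm_I, Complex.norm_ofNat,
      Complex.norm_real, Real.norm_of_nonneg Real.pi_pos.le]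
    have := Real.pi_ne_zero
    have := norm_ne_zero_iff.mpr h0
    field_simp
  simp only [h1]
  rw [integral_comp_hypMatrix t hcont, integral_const_mul, integral_fintype_prod_volume_eq_prod,
    Fin.prod_univ_two]
  simp only [f, Matrix.cons_val_zero, Matrix.cons_val_one]
  rw [integral_mul_cexp_gauss hre1, integral_cexp_gauss hre2, hz2, hypKer, ← hu, ← hv,
    im_neg_one_div, Real.sqrt_div hτ.le, Real.sqrt_sq (norm_nonneg _)]
  have e1 : ((-π * u : ℝ) : ℂ) ^ 2 / (4 * (π * I * τ / 2)) = π * I * (-1 / τ) / 2 * (u : ℂ) ^ 2 := by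
    have : (π : ℂ) ≠ 0 := by exact_mod_cast Real.pi_ne_zero
    push_cast
    field_simp
    linear_combination (4 * (u : ℂ) ^ 2) * Complex.I_sq
  have e2 : ((π * v : ℝ) : ℂ) ^ 2 / (4 * (-(π * I * starRingEnd ℂ τ / 2))) =
      -(π * I * (starRingEnd ℂ (-1 / τ)) / 2 * (v : ℂ) ^ 2) := by
    have : (π : ℂ) ≠ 0 := by exact_mod_cast Real.pi_ne_zero
    rw [map_div₀, map_neg, map_one]
    push_cast
    field_simp
    linear_combination (-4 * (v : ℂ) ^ 2) * Complex.I_sq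
  have e3 : -(((-π * u : ℝ) : ℂ) * I) / (2 * (π * I * τ / 2)) = u / τ := by
    have : (π : ℂ) ≠ 0 := by exact_mod_cast Real.pi_ne_zero
    push_cast
    field_simp
  rw [hnorm] at hprod
  rw [e1, e2, e3, sub_eq_add_neg, Complex.exp_add]
  have hs : ((√15 : ℝ) : ℂ) ≠ 0 := by
    rw [Complex.ofReal_ne_zero]; positivity
  have hn : ((‖τ‖ : ℝ) : ℂ) ≠ 0 := by rw [Complex.ofReal_ne_zero]; exact norm_ne_zero_iff.mpr h0
  push_cast at hprod ⊢
  generalize exp (π * I * (-1 / τ) / 2 * (u : ℂ) ^ 2) = X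
  generalize exp (-(π * I * (starRingEnd ℂ (-1 / τ)) / 2 * (v : ℂ) ^ 2)) = Y
  generalize (π / -(π * I * τ / 2) : ℂ) ^ (1 / 2 : ℂ) = p at *
  generalize (starRingEnd ℂ (π / -(π * I * τ / 2) : ℂ)) ^ (1 / 2 : ℂ) = r at *
  calc 1 / (2 * (√15 : ℝ) : ℂ) * (2 * (√τ.im : ℝ) * (u / τ * (p * X) * (r * Y)))
      = 1 / (2 * (√15 : ℝ) : ℂ) * (2 * (√τ.im : ℝ) * (u / τ * X * Y)) * (p * r) := by ring
    _ = _ := by rw [hprod]; field_simp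

lemma integrable_gauss_plane {c : ℝ} (hc : 0 < c) :
    Integrable fun x : Fin 2 → ℝ => Real.exp (-c * (x 0 ^ 2 + x 1 ^ 2)) := by
  have h := Integrable.fintype_prod (f := fun (_ : Fin 2) (w : ℝ) => Real.exp (-c * w ^ 2))
    (μ := fun _ => volume) fun _ => integrable_exp_neg_mul_sq hc
  refine h.congr (Eventually.of_forall fun x => ?_)
  simp only [Fin.prod_univ_two]
  rw [← Real.exp_add]; ring_nf

/-- The Fourier transform of the kernel. -/
lemma integral_ker {τ : ℂ} (hτ : 0 < τ.im) (ξ₁ ξ₂ : ℝ) :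
    ∫ x : Fin 2 → ℝ, exp (-(2 * π * I * (x 0 * ξ₁ + x 1 * ξ₂))) * ker τ (x 0) (x 1) =
      1 / (√15 * τ) * ker (-1 / τ) (ξ₁ / 5) (ξ₂ / 3) := by
  have hT : -hypT ≤ hypT := by linarith [hypT_nonneg]
  have h1 : ∀ x : Fin 2 → ℝ, exp (-(2 * π * I * (x 0 * ξ₁ + x 1 * ξ₂))) * ker τ (x 0) (x 1) =
      ∫ t in Set.Ioc (-hypT) hypT, exp (-(2 * π * I * (x 0 * ξ₁ + x 1 * ξ₂))) *
        hypKer τ t (x 0) (x 1) := fun x => by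
    rw [ker_eq_integral hτ, intervalIntegral.integral_of_le hT, integral_const_mul]
  have hcont : Continuous fun p : (Fin 2 → ℝ) × ℝ =>
      exp (-(2 * π * I * (p.1 0 * ξ₁ + p.1 1 * ξ₂))) * hypKer τ p.2 (p.1 0) (p.1 1) := by
    refine Continuous.mul (by fun_prop) ?_
    exact (continuous_hypKer τ).comp
      (f := fun p : (Fin 2 → ℝ) × ℝ => ((p.2, p.1 0, p.1 1) : ℝ × ℝ × ℝ)) (by fun_prop)
  obtain ⟨C, c, hc, hC, hb⟩ := norm_hypKer_le hτ
  -- Fubini is justified by the Gaussian majorant, which does not depend on t along the bounded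
  -- path.
  have hint : Integrable (Function.uncurry fun (x : Fin 2 → ℝ) (t : ℝ) =>
      exp (-(2 * π * I * (x 0 * ξ₁ + x 1 * ξ₂))) * hypKer τ t (x 0) (x 1))
      (volume.prod (volume.restrict (Set.Ioc (-hypT) hypT))) := by
    have hg : Integrable (fun p : (Fin 2 → ℝ) × ℝ =>
        C * Real.exp (-c * (p.1 0 ^ 2 + p.1 1 ^ 2)) * (1 : ℝ))
        (volume.prod (volume.restrict (Set.Ioc (-hypT) hypT))) :=
      Integrable.mul_prod (f := fun x : Fin 2 → ℝ => C * Real.exp (-c * (x 0 ^ 2 + x 1 ^ 2)))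
        (g := fun _ : ℝ => (1 : ℝ)) ((integrable_gauss_plane hc).const_mul C) (integrable_const 1)
    refine Integrable.mono' hg hcont.aestronglyMeasurable ?_
    have he : (volume : Measure (Fin 2 → ℝ)).prod ((volume : Measure ℝ).restrict (Set.Ioc (-hypT) hypT)) =
        ((volume : Measure (Fin 2 → ℝ)).prod (volume : Measure ℝ)).restrict
          (Set.univ ×ˢ Set.Ioc (-hypT) hypT) := by
      rw [← Measure.prod_restrict, Measure.restrict_univ]
    rw [he]
    filter_upwards [self_mem_ae_restrict (MeasurableSet.univ.prod measurableSet_Ioc)] with p hp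
    have hp2 : p.2 ∈ Set.Ioc (-hypT) hypT := hp.2
    rw [Function.uncurry, norm_mul, mul_one]
    have hn : ‖exp (-(2 * π * I * (p.1 0 * ξ₁ + p.1 1 * ξ₂)))‖ = 1 := by
      rw [show (-(2 * π * I * (p.1 0 * ξ₁ + p.1 1 * ξ₂)) : ℂ) =
        ((-(2 * π * (p.1 0 * ξ₁ + p.1 1 * ξ₂)) : ℝ) : ℂ) * I by push_cast; ring]
      exact Complex.norm_exp_ofReal_mul_I _
    rw [hn, one_mul]
    exact hb p.2 (abs_le.mpr ⟨hp2.1.le, hp2.2⟩) _ _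
  simp only [h1]
  rw [integral_integral_swap hint]
  simp only [integral_hypKer hτ]
  -- The dual vector has second coordinate -ξ₂/3; the sign disappears because `ker` is even in that
  -- variable.
  rw [integral_const_mul, ← intervalIntegral.integral_of_le hT,
    ← ker_eq_integral (im_neg_one_div_pos hτ), neg_div 3 ξ₂, ker_neg_right]

/-! ### Theta series with sign characters -/

/-- `∑_{(n, j)} ε^n (-1)^j ker τ (a₁ + n) (a₂ + j)`. -/
def signTheta (ε : ℂ) (a₁ a₂ : ℝ) (τ : ℂ) : ℂ :=
  ∑' p : ℤ × ℤ, ε ^ p.1 * (-1) ^ p.2 * ker τ (a₁ + p.1) (a₂ + p.2)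

lemma summable_signTheta {ε : ℂ} (hε : ε ^ 2 = 1) (a₁ a₂ : ℝ) {τ : ℂ} (hτ : 0 < τ.im) :
    Summable fun p : ℤ × ℤ => ε ^ p.1 * (-1) ^ p.2 * ker τ (a₁ + p.1) (a₂ + p.2) := by
  have h1 : ‖ε‖ = 1 := by
    have := congrArg norm hε
    rw [norm_pow, norm_one] at this
    exact (pow_eq_one_iff_of_nonneg (norm_nonneg _) two_ne_zero).mp this
  refine Summable.of_norm_bounded (summable_ker hτ a₁ a₂).norm fun p => ?_
  rw [norm_mul, norm_mul, norm_zpow, norm_zpow, h1, norm_neg, norm_one, one_zpow, one_zpow,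
    one_mul, one_mul]

lemma inv_eq_of_sq_eq_one {ε : ℂ} (hε : ε ^ 2 = 1) : ε⁻¹ = ε := by
  have h0 : ε ≠ 0 := fun h => by simp [h] at hε
  field_simp; rw [← hε]

lemma signTheta_neg_left {ε : ℂ} (hε : ε ^ 2 = 1) (a₁ a₂ : ℝ) (τ : ℂ) :
    signTheta ε (-a₁) a₂ τ = -signTheta ε a₁ a₂ τ := by
  rw [signTheta, signTheta, ← tsum_neg, ← ((Equiv.neg ℤ).prodCongr (Equiv.refl ℤ)).tsum_eq]
  refine tsum_congr fun p => ?_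
  simp only [Equiv.prodCongr_apply, Prod.map_fst, Prod.map_snd, Equiv.neg_apply, Equiv.refl_apply]
  rw [zpow_neg, ← inv_zpow, inv_eq_of_sq_eq_one hε, ← mul_neg, ← ker_neg_left]
  push_cast
  ring_nf

lemma signTheta_neg_right (ε : ℂ) (a₁ a₂ : ℝ) (τ : ℂ) :
    signTheta ε a₁ (-a₂) τ = signTheta ε a₁ a₂ τ := by
  rw [signTheta, signTheta, ← ((Equiv.refl ℤ).prodCongr (Equiv.neg ℤ)).tsum_eq]
  refine tsum_congr fun p => ?_
  simp only [Equiv.prodCongr_apply, Prod.map_fst, Prod.map_snd, Equiv.neg_apply, Equiv.refl_apply]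
  rw [zpow_neg, ← inv_zpow, inv_eq_of_sq_eq_one (by norm_num), ← ker_neg_right]
  push_cast
  ring_nf

lemma signTheta_add_one_left {ε : ℂ} (hε : ε ^ 2 = 1) (a₁ a₂ : ℝ) (τ : ℂ) :
    signTheta ε (a₁ + 1) a₂ τ = ε * signTheta ε a₁ a₂ τ := by
  have h0 : ε ≠ 0 := fun h => by simp [h] at hε
  rw [signTheta, signTheta, ← tsum_mul_left,
    ← ((Equiv.addRight (-1 : ℤ)).prodCongr (Equiv.refl ℤ)).tsum_eq]
  refine tsum_congr fun p => ?_
  simp only [Equiv.prodCongr_apply, Prod.map_fst, Prod.map_snd, Equiv.coe_addRight,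
    Equiv.refl_apply]
  rw [zpow_add₀ h0, zpow_neg_one, inv_eq_of_sq_eq_one hε]
  push_cast
  ring_nf

lemma signTheta_add_one_right (ε : ℂ) (a₁ a₂ : ℝ) (τ : ℂ) :
    signTheta ε a₁ (a₂ + 1) τ = -signTheta ε a₁ a₂ τ := by
  rw [signTheta, signTheta, ← tsum_neg,
    ← ((Equiv.refl ℤ).prodCongr (Equiv.addRight (-1 : ℤ))).tsum_eq]
  refine tsum_congr fun p => ?_
  simp only [Equiv.prodCongr_apply, Prod.map_fst, Prod.map_snd, Equiv.coe_addRight,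
    Equiv.refl_apply]
  rw [zpow_add₀ (by norm_num), zpow_neg_one]
  push_cast
  ring_nf

lemma signTheta_zero {ε : ℂ} (hε : ε ^ 2 = 1) (a₂ : ℝ) (τ : ℂ) : signTheta ε 0 a₂ τ = 0 := by
  have := signTheta_neg_left hε 0 a₂ τ
  rw [neg_zero] at this
  exact self_eq_neg.mp this

/-- Evenness in the second characteristic and the sign of the unit shift contradict each other at
1/2, as for `unary_neg_one_half`. -/
lemma signTheta_half (ε : ℂ) (a₁ : ℝ) (τ : ℂ) : signTheta ε a₁ (1 / 2) τ = 0 := by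
  have h := signTheta_add_one_right ε a₁ (-(1 / 2)) τ
  rw [signTheta_neg_right] at h
  norm_num at h
  norm_num
  exact self_eq_neg.mp h

/-! ### Inversion of the theta series -/

lemma norm_sq_shift_le {x n r : ℝ} (hx : |x| ≤ r) : n ^ 2 / 2 - r ^ 2 ≤ (x + n) ^ 2 := by
  have h1 : x ^ 2 ≤ r ^ 2 := by rw [← sq_abs x]; exact pow_le_pow_left₀ (abs_nonneg _) hx 2
  nlinarith [sq_nonneg (2 * x + n)]

/-- Poisson summation for the kernel. -/
lemma signTheta_poisson {τ : ℂ} (hτ : 0 < τ.im) (α : ℝ) :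
    signTheta 1 α (1 / 6) τ = 1 / (√15 * τ) * ∑' p : ℤ × ℤ,
      exp (2 * π * I * α * p.1) * exp (π * I * (2 * p.2 + 1) / 6) *
        ker (-1 / τ) (p.1 / 5) ((2 * p.2 + 1) / 6) := by
  -- The character exp(-πi x₂) interpolates (-1)^j up to the constant phase exp(-πi/6). It moves the
  -- dual lattice by 1/2, which produces (m + 1/2)/3 = (2m + 1)/6.
  set f : (Fin 2 → ℝ) → ℂ := fun x => exp (-(π * I * x 1)) * ker τ (x 0) (x 1) with hf
  have hnorm : ∀ x, ‖f x‖ = ‖ker τ (x 0) (x 1)‖ := fun x => by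
    rw [hf, norm_mul, show (-(π * I * (x 1 : ℝ)) : ℂ) = ((-(π * x 1) : ℝ) : ℂ) * I by push_cast; ring,
      Complex.norm_exp_ofReal_mul_I, one_mul]
  have hcont : Continuous f := by
    refine Continuous.mul (by fun_prop) ?_
    exact (continuous_ker τ).comp (f := fun x : Fin 2 → ℝ => ((x 0, x 1) : ℝ × ℝ)) (by fun_prop)
  have hb : ∀ r : ℝ, ∃ u : (Fin 2 → ℤ) → ℝ, Summable u ∧
      ∀ x : Fin 2 → ℝ, ‖x‖ ≤ r → ∀ n, ‖f (x + intVec n)‖ ≤ u n := by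
    intro r
    obtain ⟨C, c, hc, hC, h⟩ := norm_ker_le hτ
    refine ⟨fun n => C * (Real.exp (2 * c * r ^ 2) *
      (Real.exp (-(c / 2) * (0 + n 0) ^ 2) * Real.exp (-(c / 2) * (0 + n 1) ^ 2))), ?_, ?_⟩
    · exact ((((finTwoArrowEquiv ℤ).summable_iff
        (f := fun p : ℤ × ℤ => Real.exp (-(c / 2) * (0 + p.1) ^ 2) * Real.exp (-(c / 2) * (0 + p.2) ^ 2))).mpr
        (summable_gauss_prod 0 0 (half_pos hc) (half_pos hc))).mul_left _).mul_left C
    · intro x hx n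
      rw [hnorm]
      refine (h _ _).trans (mul_le_mul_of_nonneg_left ?_ hC)
      rw [← Real.exp_add, ← Real.exp_add]
      refine Real.exp_le_exp.mpr ?_
      have h0 := norm_sq_shift_le (n := n 0) ((norm_le_pi_norm x 0).trans hx)
      have h1 := norm_sq_shift_le (n := n 1) ((norm_le_pi_norm x 1).trans hx)
      have h2 := mul_le_mul_of_nonneg_left (add_le_add h0 h1) hc.le
      simp only [Pi.add_apply, intVec]
      linarith
  have hft : ∀ m : Fin 2 → ℤ, ∫ x, latticeChar (-m) x * f x =
      1 / (√15 * τ) * ker (-1 / τ) (m 0 / 5) ((2 * m 1 + 1) / 6) := by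
    intro m
    have h1 := integral_ker hτ (m 0) (m 1 + 1 / 2)
    rw [show ((m 1 + 1 / 2 : ℝ) / 3) = (2 * m 1 + 1) / 6 by ring] at h1
    rw [← h1]
    congr 1
    ext x
    rw [hf, latticeChar, ← mul_assoc, ← Complex.exp_add]
    congr 2
    simp only [Fin.sum_univ_two, Pi.neg_apply]
    push_cast
    ring
  have hs0 : Summable fun p : ℤ × ℤ => ker (-1 / τ) (p.1 / 5) ((2 * p.2 + 1) / 6) := by
    obtain ⟨C, c, hc, hC, h⟩ := norm_ker_le (im_neg_one_div_pos hτ)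
    refine Summable.of_norm_bounded ((summable_gauss_prod 0 (1 / 2) (c := c / 25) (d := c / 9)
      (by positivity) (by positivity)).mul_left C) fun p => ?_
    refine (h _ _).trans_eq ?_
    rw [← Real.exp_add]
    ring_nf
  have hs : Summable fun m : Fin 2 → ℤ => ∫ x, latticeChar (-m) x * f x := by
    simp only [hft]
    exact ((finTwoArrowEquiv ℤ).summable_iff
      (f := fun p : ℤ × ℤ => ker (-1 / τ) (p.1 / 5) ((2 * p.2 + 1) / 6))).mpr hs0 |>.mul_left _
  have hP := poisson_summation hcont hb hs ![α, 1 / 6]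
  simp only [hft] at hP
  have hL : ∑' n : Fin 2 → ℤ, f (![α, 1 / 6] + intVec n) =
      exp (-(π * I / 6)) * signTheta 1 α (1 / 6) τ := by
    rw [signTheta, ← tsum_mul_left, ← (finTwoArrowEquiv ℤ).tsum_eq]
    refine tsum_congr fun n => ?_
    rw [show (finTwoArrowEquiv ℤ) n = (n 0, n 1) from rfl]
    simp only [hf, Pi.add_apply, intVec, Matrix.cons_val_zero,
      Matrix.cons_val_one, one_zpow, one_mul]
    rw [← mul_assoc]
    congr 1
    rw [← inv_neg_one (R := ℂ), inv_zpow, ← zpow_neg, ← Complex.exp_pi_mul_I, ← Complex.exp_int_mul,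
      ← Complex.exp_add]
    congr 1
    push_cast
    ring
  rw [hL, ← (finTwoArrowEquiv ℤ).symm.tsum_eq] at hP
  have hR : ∀ p : ℤ × ℤ, latticeChar ((finTwoArrowEquiv ℤ).symm p) ![α, 1 / 6] =
      exp (-(π * I / 6)) * (exp (2 * π * I * α * p.1) * exp (π * I * (2 * p.2 + 1) / 6)) := by
    intro p
    rw [latticeChar, ← Complex.exp_add, ← Complex.exp_add]
    congr 1
    simp [Fin.sum_univ_two, finTwoArrowEquiv]
    ring
  simp only [hR] at hP
  have hne := Complex.exp_ne_zero (-(π * I / 6))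
  refine mul_left_cancel₀ hne (hP.trans ?_)
  rw [← tsum_mul_left, ← tsum_mul_left]
  refine tsum_congr fun p => ?_
  have h0 : (finTwoArrowEquiv ℤ).symm p 0 = p.1 := rfl
  have h1 : (finTwoArrowEquiv ℤ).symm p 1 = p.2 := rfl
  rw [h0, h1]
  ring

lemma tsum_residues {f : ℤ × ℤ → ℂ} (hf : Summable f) (k l : ℕ) [NeZero k] [NeZero l] :
    ∑' p, f p = ∑ r : Fin k, ∑ s : Fin l, ∑' p : ℤ × ℤ,
      f (p.1 * k + (r : ℕ), p.2 * l + (s : ℕ)) := by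
  let e : (Fin k × Fin l) × (ℤ × ℤ) ≃ ℤ × ℤ :=
    (Equiv.prodComm _ _).trans ((Equiv.prodProdProdComm ℤ ℤ (Fin k) (Fin l)).trans
      ((Int.divModEquiv k).symm.prodCongr (Int.divModEquiv l).symm))
  rw [← e.tsum_eq, (show Summable fun c => f (e c) from e.summable_iff.mpr hf).tsum_prod, tsum_fintype, Fintype.sum_prod_type]
  rfl

/-- The inversion formula for the theta series of characteristic `(α, 1/6)`. -/
lemma signTheta_inversion {τ : ℂ} (hτ : 0 < τ.im) {α : ℝ} {ε : ℂ} (hε : ε ^ 2 = 1)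
    (hα : exp (2 * π * I * α * 5) = ε) :
    signTheta 1 α (1 / 6) τ = 2 / √5 * (I / τ) *
      (Real.sin (2 * π * α) * signTheta ε (1 / 5) (1 / 6) (-1 / τ) +
        Real.sin (4 * π * α) * signTheta ε (2 / 5) (1 / 6) (-1 / τ)) := by
  have hs : Summable fun p : ℤ × ℤ => exp (2 * π * I * α * p.1) *
      exp (π * I * (2 * p.2 + 1) / 6) * ker (-1 / τ) (p.1 / 5) ((2 * p.2 + 1) / 6) := by
    obtain ⟨C, c, hc, hC, h⟩ := norm_ker_le (im_neg_one_div_pos hτ)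
    refine Summable.of_norm_bounded ((summable_gauss_prod 0 (1 / 2) (c := c / 25) (d := c / 9)
      (by positivity) (by positivity)).mul_left C) fun p => ?_
    have h1 : ‖exp (2 * π * I * α * p.1)‖ = 1 := by
      rw [show (2 * π * I * α * p.1 : ℂ) = ((2 * π * α * p.1 : ℝ) : ℂ) * I by push_cast; ring]
      exact Complex.norm_exp_ofReal_mul_I _
    have h2 : ‖exp (π * I * (2 * p.2 + 1) / 6)‖ = 1 := by
      rw [show (π * I * (2 * p.2 + 1) / 6 : ℂ) = ((π * (2 * p.2 + 1) / 6 : ℝ) : ℂ) * I by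
        push_cast; ring]
      exact Complex.norm_exp_ofReal_mul_I _
    rw [norm_mul, norm_mul, h1, h2, one_mul, one_mul]
    refine (h _ _).trans_eq ?_
    rw [← Real.exp_add]
    ring_nf
  -- On the class of r modulo 5 and s modulo 3 the phases become the characters ε^n and (-1)^j, so
  -- each class is again a `signTheta`.
  have hterm : ∀ (r s : ℕ), ∑' p : ℤ × ℤ, exp (2 * π * I * α * ((p.1 * 5 + r : ℤ) : ℂ)) *
      exp (π * I * (2 * ((p.2 * 3 + s : ℤ) : ℂ) + 1) / 6) *
        ker (-1 / τ) (((p.1 * 5 + r : ℤ) : ℝ) / 5) ((2 * ((p.2 * 3 + s : ℤ) : ℝ) + 1) / 6) =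
      exp (2 * π * I * α * r) * exp (π * I * (2 * s + 1) / 6) *
        signTheta ε (r / 5) ((2 * s + 1) / 6) (-1 / τ) := by
    intro r s
    rw [signTheta, ← tsum_mul_left]
    refine tsum_congr fun p => ?_
    have e1 : exp (2 * π * I * α * ((p.1 * 5 + r : ℤ) : ℂ)) =
        exp (2 * π * I * α * r) * ε ^ p.1 := by
      rw [← hα, ← Complex.exp_int_mul, ← Complex.exp_add]; push_cast; ring_nf
    have e2 : exp (π * I * (2 * ((p.2 * 3 + s : ℤ) : ℂ) + 1) / 6) =
        exp (π * I * (2 * s + 1) / 6) * (-1) ^ p.2 := by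
      rw [← Complex.exp_pi_mul_I, ← Complex.exp_int_mul, ← Complex.exp_add]; push_cast; ring_nf
    rw [e1, e2]
    push_cast
    ring_nf
  have hsum := tsum_residues hs 5 3
  -- The class r = 0 vanishes by oddness and s = 1 by `signTheta_half`; reflections and shifts carry
  -- the other eight classes to first characteristic 1/5 or 2/5 and second characteristic 1/6.
  have h30 : signTheta ε (3 / 5) (1 / 6) (-1 / τ) = -(ε * signTheta ε (2 / 5) (1 / 6) (-1 / τ)) := by
    rw [show (3 / 5 : ℝ) = -(2 / 5) + 1 by norm_num, signTheta_add_one_left hε,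
      signTheta_neg_left hε]; ring
  have h40 : signTheta ε (4 / 5) (1 / 6) (-1 / τ) = -(ε * signTheta ε (1 / 5) (1 / 6) (-1 / τ)) := by
    rw [show (4 / 5 : ℝ) = -(1 / 5) + 1 by norm_num, signTheta_add_one_left hε,
      signTheta_neg_left hε]; ring
  have h5 : ∀ a, signTheta ε a (5 / 6) (-1 / τ) = -signTheta ε a (1 / 6) (-1 / τ) := fun a => by
    rw [show (5 / 6 : ℝ) = -(1 / 6) + 1 by norm_num, signTheta_add_one_right, signTheta_neg_right]
  rw [signTheta_poisson hτ, hsum]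
  push_cast at hterm ⊢
  simp only [hterm]
  simp only [Fin.sum_univ_five, Fin.sum_univ_three]
  norm_num [-one_div]
  simp only [signTheta_zero hε, h5, signTheta_half, h30, h40]
  have hpow : ∀ n : ℕ, exp (2 * π * I * α * n) = exp (2 * π * I * α) ^ n := fun n => by
    rw [← Complex.exp_nat_mul]; ring_nf
  have hw : exp (2 * π * I * α * 5) = exp (2 * π * I * α) ^ 5 := mod_cast hpow 5
  -- With w = exp(2πiα) one has w⁵ = ε and ε² = 1, so εw⁴ = w⁻¹ and εw³ = w⁻²; the paired classes
  -- then give sines.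
  have e4 : exp (2 * π * I * α * 4) * ε = exp (-(2 * π * I * α)) := by
    rw [Complex.exp_neg, show exp (2 * π * I * α * 4) = exp (2 * π * I * α) ^ 4 from mod_cast hpow 4]
    refine eq_inv_of_mul_eq_one_left ?_
    rw [hw] at hα
    linear_combination ε * hα + hε
  have e3 : exp (2 * π * I * α * 3) * ε = exp (-(2 * (2 * π * I * α))) := by
    rw [Complex.exp_neg, show exp (2 * π * I * α * 3) = exp (2 * π * I * α) ^ 3 from mod_cast hpow 3,
      show exp (2 * (2 * π * I * α)) = exp (2 * π * I * α) ^ 2 by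
        rw [← hpow]; push_cast; ring_nf]
    refine eq_inv_of_mul_eq_one_left ?_
    rw [hw] at hα
    linear_combination ε * hα + hε
  have s1 : exp (2 * π * I * α) - exp (-(2 * π * I * α)) = 2 * I * sin (2 * π * α) := by
    rw [Complex.sin, show (2 * π * I * α : ℂ) = 2 * π * α * I by ring,
      show -(2 * π * α : ℂ) * I = -(2 * π * α * I) by ring]
    linear_combination -(exp (-(2 * π * α * I)) - exp (2 * π * α * I)) * I_sq
  have s2 : exp (2 * π * I * α * 2) - exp (-(2 * (2 * π * I * α))) = 2 * I * sin (4 * π * α) := by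
    rw [Complex.sin, show (2 * π * I * α * 2 : ℂ) = 4 * π * α * I by ring,
      show (2 * (2 * π * I * α) : ℂ) = 4 * π * α * I by ring,
      show -(4 * π * α : ℂ) * I = -(4 * π * α * I) by ring]
    linear_combination -(exp (-(4 * π * α * I)) - exp (4 * π * α * I)) * I_sq
  -- The sum over s modulo 3; it reduces √15 to √5.
  have s3 : exp (π * I / 6) - exp (π * I * 5 / 6) = √3 := by
    have h6 : exp (π * I / 6) = √3 / 2 + 1 / 2 * I := by
      rw [show (π * I / 6 : ℂ) = ((π / 6 : ℝ) : ℂ) * I by push_cast; ring, Complex.exp_mul_I,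
        ← Complex.ofReal_cos, ← Complex.ofReal_sin, Real.cos_pi_div_six, Real.sin_pi_div_six]
      push_cast; ring
    have h56 : exp (π * I * 5 / 6) = -√3 / 2 + 1 / 2 * I := by
      rw [show (π * I * 5 / 6 : ℂ) = ((π - π / 6 : ℝ) : ℂ) * I by push_cast; ring,
        Complex.exp_mul_I, ← Complex.ofReal_cos, ← Complex.ofReal_sin, Real.cos_pi_sub,
        Real.sin_pi_sub, Real.cos_pi_div_six, Real.sin_pi_div_six]
      push_cast; ring
    rw [h6, h56]; ring
  have hsq : (√15 : ℂ) = √3 * √5 := by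
    rw [← Complex.ofReal_mul, ← Real.sqrt_mul (by norm_num)]; norm_num
  have n3 : (√3 : ℂ) ≠ 0 := by simp
  have n5 : (√5 : ℂ) ≠ 0 := by simp
  have hτ0 := ne_zero_of_im_pos hτ
  clear hterm hsum h30 h40 h5 hs hw hpow hα
  revert e4 e3 s1 s2 s3
  generalize signTheta ε (1 / 5) (1 / 6) (-1 / τ) = X₁, signTheta ε (2 / 5) (1 / 6) (-1 / τ) = X₂,
    exp (2 * π * I * α * 4) = E₄, exp (2 * π * I * α * 3) = E₃, exp (2 * π * I * α * 2) = E₂,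
    exp (2 * π * I * α) = E₁, exp (-(2 * π * I * α)) = F₁, exp (-(2 * (2 * π * I * α))) = F₂,
    sin (2 * π * α : ℂ) = S₁, sin (4 * π * α : ℂ) = S₂, exp (π * I / 6) = Z₁,
    exp (π * I * 5 / 6) = Z₅
  intro e4 e3 s1 s2 s3
  rw [hsq]
  field_simp
  linear_combination X₁ * (√3 * s1 + (E₁ - F₁) * s3 - (Z₁ - Z₅) * e4) +
    X₂ * (√3 * s2 + (E₂ - F₂) * s3 - (Z₁ - Z₅) * e3)

/-! ### The components of the modular vector -/

/-- The components of `H_{5,2}`, in terms of `signTheta`. -/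
def compA (α : ℝ) (τ : ℂ) : ℂ :=
  ModularForm.eta (2 * τ) / ModularForm.eta τ ^ 2 * signTheta 1 α (1 / 6) τ

/-- The components of `H_{5,2}`, in terms of `signTheta`. -/
def compB (α : ℝ) (τ : ℂ) : ℂ :=
  ModularForm.eta (τ / 2) / (2 * ModularForm.eta τ ^ 2) * signTheta (-1) α (1 / 6) τ

/-- The components of `H_{5,2}`, in terms of `signTheta`. -/
def compC (α : ℝ) (τ : ℂ) : ℂ :=
  (ζ 48)⁻¹ * ModularForm.eta ((τ + 1) / 2) / (2 * ModularForm.eta τ ^ 2) * signTheta 1 α (1 / 6) τ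

/-- For ν = (ν₁, ν₂) one has B(c₁, ν) = 15(ν₁ - ν₂) and B(c₂, ν) = -15(ν₁ + ν₂). As E is odd, the
difference of the two values of E becomes the sum in `ker`. -/
lemma theta_eq_tsum (α β : ℝ) (τ : ℂ) :
    theta ![α, 1 / 6] ![β, 1 / 6] τ = ∑' p : ℤ × ℤ,
      exp (π * I * (10 * β * (α + p.1) - (1 / 6 + p.2))) * ker τ (α + p.1) (1 / 6 + p.2) := by
  rw [theta, indefTheta, ← (finTwoArrowEquiv ℤ).symm.tsum_eq]
  refine tsum_congr fun p => ?_
  have h0 : (finTwoArrowEquiv ℤ).symm p 0 = p.1 := rfl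
  have h1 : (finTwoArrowEquiv ℤ).symm p 1 = p.2 := rfl
  have hc1 : quad !![5, 0; 0, -3] ![3, 5] = -15 := by
    simp [quad, bil, Matrix.mulVec, dotProduct, Fin.sum_univ_two]; norm_num
  have hc2 : quad !![5, 0; 0, -3] ![-3, 5] = -15 := by
    simp [quad, bil, Matrix.mulVec, dotProduct, Fin.sum_univ_two]; norm_num
  have hE : ∀ x : ℝ, 15 * x / √15 * √τ.im = √(15 * τ.im) * x := fun x => by
    rw [Real.sqrt_mul (by norm_num)]
    have h15 : √15 * √15 = (15 : ℝ) := Real.mul_self_sqrt (by norm_num)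
    field_simp
    linear_combination -x * √τ.im * h15
  set v : Fin 2 → ℝ := fun i => ![α, 1 / 6] i + ((finTwoArrowEquiv ℤ).symm p i : ℝ) with hv
  have hv0 : v 0 = α + p.1 := by simp [hv]
  have hv1 : v 1 = 1 / 6 + p.2 := by simp [hv]
  have hb1 : bil !![5, 0; 0, -3] ![3, 5] v = 15 * (v 0 - v 1) := by
    simp [bil, Matrix.mulVec, dotProduct, Fin.sum_univ_two]; ring
  have hb2 : bil !![5, 0; 0, -3] ![-3, 5] v = 15 * (-(v 0 + v 1)) := by
    simp [bil, Matrix.mulVec, dotProduct, Fin.sum_univ_two]; ring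
  have hb : bil !![5, 0; 0, -3] v ![β, 1 / 6] = 5 * β * v 0 - v 1 / 2 := by
    simp [bil, Matrix.mulVec, dotProduct, Fin.sum_univ_two]; ring
  have hq : quad !![5, 0; 0, -3] v = (5 * v 0 ^ 2 - 3 * v 1 ^ 2) / 2 := by
    simp [quad, bil, Matrix.mulVec, dotProduct, Fin.sum_univ_two]; ring
  rw [rhoOne, rhoOne, hc1, hc2, if_pos (by norm_num), if_pos (by norm_num), hb1, hb2, neg_neg, hE,
    hE, hb, hq, mul_neg, E_neg, sub_neg_eq_add, hv0, hv1, ker]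
  rw [mul_left_comm, ← Complex.exp_add]
  congr 2
  push_cast
  ring

lemma theta_zero (α : ℝ) (τ : ℂ) :
    theta ![α, 1 / 6] ![0, 1 / 6] τ = exp (-(π * I / 6)) * signTheta 1 α (1 / 6) τ := by
  rw [theta_eq_tsum, signTheta, ← tsum_mul_left]
  refine tsum_congr fun p => ?_
  rw [← mul_assoc]
  congr 1
  rw [one_zpow, one_mul, ← inv_neg_one (R := ℂ), inv_zpow, ← zpow_neg, ← Complex.exp_pi_mul_I,
    ← Complex.exp_int_mul, ← Complex.exp_add]
  push_cast
  ring_nf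

/-- The first coordinate 1/10 contributes exp(πi ν₁), hence the character ε = -1 up to a constant
phase. -/
lemma theta_one_tenth (α : ℝ) (τ : ℂ) :
    theta ![α, 1 / 6] ![1 / 10, 1 / 6] τ =
      exp (π * I * (α - 1 / 6)) * signTheta (-1) α (1 / 6) τ := by
  rw [theta_eq_tsum, signTheta, ← tsum_mul_left]
  refine tsum_congr fun p => ?_
  rw [← mul_assoc]
  congr 1
  rw [show (-1 : ℂ) ^ p.2 = (-1) ^ (-p.2) by rw [zpow_neg, ← inv_zpow, inv_neg_one],
    ← Complex.exp_pi_mul_I, ← Complex.exp_int_mul, ← Complex.exp_int_mul, ← Complex.exp_add,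
    ← Complex.exp_add]
  push_cast
  ring_nf

/-- The roots of unity in `H52` are there to cancel the constant phases of the theta series; only (ζ
48)⁻¹ survives, in the last two components. -/
lemma H52_eq (τ : ℂ) : H52 τ = ![compA (1 / 10) τ, compA (3 / 10) τ, compB (1 / 5) τ,
    compB (2 / 5) τ, compC (1 / 5) τ, compC (2 / 5) τ] := by
  have e12 : ζ 12 * exp (-(π * I / 6)) = 1 := by
    rw [ζ, ← Complex.exp_add]; push_cast; ring_nf; exact Complex.exp_zero
  have e48 : ζ 16 * exp (-(π * I / 6)) = (ζ 48)⁻¹ := by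
    rw [ζ, ζ, ← Complex.exp_add, ← Complex.exp_neg]; push_cast; ring_nf
  have e1 : ζ 60 ^ (-1 : ℤ) * exp (π * I * (1 / 5 - 1 / 6)) = 1 := by
    rw [ζ, ← Complex.exp_int_mul, ← Complex.exp_add]; push_cast; ring_nf; exact Complex.exp_zero
  have e7 : ζ 60 ^ (-7 : ℤ) * exp (π * I * (2 / 5 - 1 / 6)) = 1 := by
    rw [ζ, ← Complex.exp_int_mul, ← Complex.exp_add]; push_cast; ring_nf; exact Complex.exp_zero
  rw [H52]
  simp only [theta_zero, theta_one_tenth, compA, compB, compC, Matrix.smul_cons, smul_eq_mul,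
    Matrix.smul_empty]
  push_cast
  refine congrArg₂ Matrix.vecCons ?_ (congrArg₂ Matrix.vecCons ?_ (congrArg₂ Matrix.vecCons ?_
    (congrArg₂ Matrix.vecCons ?_ (congrArg₂ Matrix.vecCons ?_ (congrArg₂ Matrix.vecCons ?_ rfl)))))
  · linear_combination (1 / ModularForm.eta τ ^ 2 * ModularForm.eta (2 * τ) *
      signTheta 1 (1 / 10) (1 / 6) τ) * e12
  · linear_combination (1 / ModularForm.eta τ ^ 2 * ModularForm.eta (2 * τ) *
      signTheta 1 (3 / 10) (1 / 6) τ) * e12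
  · linear_combination (1 / (2 * ModularForm.eta τ ^ 2) * ModularForm.eta (τ / 2) *
      signTheta (-1) (1 / 5) (1 / 6) τ) * e1
  · linear_combination (1 / (2 * ModularForm.eta τ ^ 2) * ModularForm.eta (τ / 2) *
      signTheta (-1) (2 / 5) (1 / 6) τ) * e7
  · linear_combination (1 / (2 * ModularForm.eta τ ^ 2) * ModularForm.eta ((τ + 1) / 2) *
      signTheta 1 (1 / 5) (1 / 6) τ) * e48
  · linear_combination (1 / (2 * ModularForm.eta τ ^ 2) * ModularForm.eta ((τ + 1) / 2) *
      signTheta 1 (2 / 5) (1 / 6) τ) * e48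

/-! ### The translation -/

/-- Modulo 2 the exponent 5n² + 10αn - 3j² - j agrees with (10α + 1)n, because n² - n and j² + j are
even. Thus translation multiplies the character ε by δ. -/
lemma signTheta_translate (ε : ℂ) {α : ℝ} {δ : ℂ} (hδ : exp (π * I * (10 * α + 1)) = δ) (τ : ℂ) :
    signTheta ε α (1 / 6) (τ + 1) =
      exp (π * I * (5 * α ^ 2 - 1 / 12)) * signTheta (ε * δ) α (1 / 6) τ := by
  rw [signTheta, signTheta, ← tsum_mul_left]
  refine tsum_congr fun p => ?_
  have h1 : exp (π * I * (5 * (α + p.1) ^ 2 - 3 * (1 / 6 + p.2) ^ 2)) =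
      exp (π * I * (5 * α ^ 2 - 1 / 12)) * δ ^ p.1 := by
    have h2 : Even (5 * p.1 ^ 2 - p.1 - p.2 - 3 * p.2 ^ 2) := by
      have h3 : Even (p.1 * (p.1 - 1)) := Int.even_mul_pred_self _
      have h4 : Even (p.2 * (p.2 + 1)) := Int.even_mul_succ_self _
      rw [show 5 * p.1 ^ 2 - p.1 - p.2 - 3 * p.2 ^ 2 =
        p.1 * (p.1 - 1) - p.2 * (p.2 + 1) + 2 * (2 * p.1 ^ 2 - p.2 ^ 2) by ring]
      exact (h3.sub h4).add (even_two_mul _)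
    obtain ⟨m, hm⟩ := h2
    have hm' : (5 * p.1 ^ 2 - p.1 - p.2 - 3 * p.2 ^ 2 : ℂ) = m + m := by exact_mod_cast hm
    rw [← hδ, ← Complex.exp_int_mul, ← Complex.exp_add, Complex.exp_eq_exp_iff_exists_int]
    refine ⟨m, ?_⟩
    linear_combination π * I * hm'
  have h3 : ker (τ + 1) (α + p.1) (1 / 6 + p.2) =
      exp (π * I * (5 * (α + p.1) ^ 2 - 3 * (1 / 6 + p.2) ^ 2)) * ker τ (α + p.1) (1 / 6 + p.2) := by
    rw [ker, ker, mul_left_comm, ← Complex.exp_add, Complex.add_im, Complex.one_im, add_zero]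
    push_cast
    ring_nf
  rw [h3, h1, mul_zpow]
  ring

lemma exp_pi_odd {x : ℂ} (n : ℤ) (hx : x = 2 * n + 1) : exp (π * I * x) = -1 := by
  rw [hx, ← Complex.exp_pi_mul_I, Complex.exp_eq_exp_iff_exists_int]
  exact ⟨n, by ring⟩

lemma exp_pi_even {x : ℂ} (n : ℤ) (hx : x = 2 * n) : exp (π * I * x) = 1 := by
  rw [hx, Complex.exp_eq_one_iff]
  exact ⟨n, by ring⟩

lemma ζ_pow_eq (n : ℕ) (k : ℕ) : ζ n ^ k = exp (2 * π * I * k / n) := by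
  rw [ζ, ← Complex.exp_nat_mul]; ring_nf

lemma ζ_inv (n : ℕ) : (ζ n)⁻¹ = exp (-(2 * π * I / n)) := by
  rw [ζ, ← Complex.exp_neg]

lemma eta_two_mul_add_one (τ : ℂ) :
    ModularForm.eta (2 * (τ + 1)) = ζ 24 ^ 2 * ModularForm.eta (2 * τ) := by
  rw [show 2 * (τ + 1) = 2 * τ + 1 + 1 by ring, eta_add_one, eta_add_one]; ring

lemma compA_add_one {α : ℝ} (hα : exp (π * I * (10 * α + 1)) = 1) (τ : ℂ) :
    compA α (τ + 1) = exp (π * I * (5 * α ^ 2 - 1 / 12)) * compA α τ := by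
  have hz := ζ_ne_zero 24
  rw [compA, compA, eta_two_mul_add_one, eta_add_one, signTheta_translate 1 hα, mul_one]
  field_simp

/-- Here δ = -1 switches ε = -1 to ε = 1 while η(τ/2) becomes η((τ+1)/2), so the types B and C are
exchanged. -/
lemma compB_add_one {α : ℝ} (hα : exp (π * I * (10 * α + 1)) = -1) (τ : ℂ) :
    compB α (τ + 1) = exp (π * I * (5 * α ^ 2 - 5 / 24)) * compC α τ := by
  have e : exp (π * I * (5 * α ^ 2 - 1 / 12)) =
      exp (π * I * (5 * α ^ 2 - 5 / 24)) * ((ζ 48)⁻¹ * ζ 24 ^ 2) := by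
    rw [ζ_inv, ζ_pow_eq, ← Complex.exp_add, ← Complex.exp_add]; push_cast; ring_nf
  have hz := ζ_ne_zero 24
  rw [compB, compC, eta_add_one, signTheta_translate (-1) hα, e]
  norm_num
  field_simp

lemma compC_add_one {α : ℝ} (hα : exp (π * I * (10 * α + 1)) = -1) (τ : ℂ) :
    compC α (τ + 1) = exp (π * I * (5 * α ^ 2 - 5 / 24)) * compB α τ := by
  have e : exp (π * I * (5 * α ^ 2 - 1 / 12)) * ((ζ 48)⁻¹ * ζ 24) =
      exp (π * I * (5 * α ^ 2 - 5 / 24)) * ζ 24 ^ 2 := by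
    rw [ζ_inv, ζ_pow_eq, ζ, ← Complex.exp_add, ← Complex.exp_add, ← Complex.exp_add]
    push_cast; ring_nf
  have hz := ζ_ne_zero 24
  rw [compB, compC, eta_add_one, signTheta_translate 1 hα,
    show (τ + 1 + 1) / 2 = τ / 2 + 1 by ring, eta_add_one]
  norm_num
  have h3 : exp (π * I * (5 * α ^ 2 - 1 / 12)) * ((ζ 48)⁻¹ * ζ 24) / ζ 24 ^ 2 =
      exp (π * I * (5 * α ^ 2 - 5 / 24)) := by rw [e]; field_simp
  rw [← h3]
  field_simp

lemma H52_map_T (τ : ℂ) : H52 (τ + 1) = T5 *ᵥ H52 τ := by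
  have a1 := compA_add_one (α := 1 / 10) (exp_pi_even 1 (by push_cast; ring)) τ
  have a3 := compA_add_one (α := 3 / 10) (exp_pi_even 2 (by push_cast; ring)) τ
  have b1 := compB_add_one (α := 1 / 5) (exp_pi_odd 1 (by push_cast; ring)) τ
  have b2 := compB_add_one (α := 2 / 5) (exp_pi_odd 2 (by push_cast; ring)) τ
  have c1 := compC_add_one (α := 1 / 5) (exp_pi_odd 1 (by push_cast; ring)) τ
  have c2 := compC_add_one (α := 2 / 5) (exp_pi_odd 2 (by push_cast; ring)) τ
  have e1 : ζ 60 ^ (-1 : ℤ) = exp (π * I * (5 * ((1 / 10 : ℝ) : ℂ) ^ 2 - 1 / 12)) := by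
    rw [zpow_neg_one, ζ_inv]; push_cast; ring_nf
  have e2 : ζ 60 ^ 11 = exp (π * I * (5 * ((3 / 10 : ℝ) : ℂ) ^ 2 - 1 / 12)) := by
    rw [ζ_pow_eq]; push_cast; ring_nf
  have e3 : ζ 240 ^ (-1 : ℤ) = exp (π * I * (5 * ((1 / 5 : ℝ) : ℂ) ^ 2 - 5 / 24)) := by
    rw [zpow_neg_one, ζ_inv]; push_cast; ring_nf
  have e4 : ζ 240 ^ 71 = exp (π * I * (5 * ((2 / 5 : ℝ) : ℂ) ^ 2 - 5 / 24)) := by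
    rw [ζ_pow_eq]; push_cast; ring_nf
  rw [H52_eq, H52_eq, a1, a3, b1, b2, c1, c2, T5, e1, e2, e3, e4]
  ext i
  fin_cases i <;> simp [Matrix.mulVec, dotProduct, Fin.sum_univ_succ]

/-! ### The inversion -/

lemma eta_two_mul_neg_one_div {τ : ℂ} (hτ : 0 < τ.im) :
    ModularForm.eta (2 * (-1 / τ)) = csr τ / √2 * ModularForm.eta (τ / 2) := by
  have h2 : 0 < (τ / 2).im := by
    rw [show τ / 2 = ((1 / 2 : ℝ) : ℂ) * τ by push_cast; ring, Complex.im_ofReal_mul]; positivity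
  rw [show 2 * (-1 / τ) = -1 / (τ / 2) by field_simp, eta_neg_one_div h2,
    show csr (τ / 2) = csr (((1 / 2 : ℝ) : ℂ) * τ) by push_cast; ring_nf,
    csr_real_mul (by norm_num) hτ, Real.sqrt_div (by norm_num), Real.sqrt_one]
  push_cast
  ring

lemma eta_half_neg_one_div {τ : ℂ} (hτ : 0 < τ.im) :
    ModularForm.eta (-1 / τ / 2) = √2 * csr τ * ModularForm.eta (2 * τ) := by
  have h2 : 0 < (2 * τ).im := by
    rw [show 2 * τ = ((2 : ℝ) : ℂ) * τ by push_cast; ring, Complex.im_ofReal_mul]; positivity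
  rw [show -1 / τ / 2 = -1 / (2 * τ) by field_simp, eta_neg_one_div h2,
    show csr (2 * τ) = csr (((2 : ℝ) : ℂ) * τ) by push_cast; ring_nf,
    csr_real_mul (by norm_num) hτ]

lemma signTheta_neg_one_div {τ : ℂ} (hτ : 0 < τ.im) {α : ℝ} {ε : ℂ} (hε : ε ^ 2 = 1)
    (hα : exp (2 * π * I * α * 5) = ε) :
    signTheta 1 α (1 / 6) (-1 / τ) = 2 / √5 * csr τ ^ 2 *
      (Real.sin (2 * π * α) * signTheta ε (1 / 5) (1 / 6) τ +
        Real.sin (4 * π * α) * signTheta ε (2 / 5) (1 / 6) τ) := by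
  have h0 := ne_zero_of_im_pos hτ
  rw [signTheta_inversion (im_neg_one_div_pos hτ) hε hα, csr_sq,
    show -1 / (-1 / τ) = τ by field_simp, show I / (-1 / τ) = -I * τ by field_simp]

lemma compA_neg_one_div {τ : ℂ} (hτ : 0 < τ.im) {α : ℝ} (hα : exp (2 * π * I * α * 5) = -1) :
    compA α (-1 / τ) = csr τ * (2 / √5) * √2 *
      (Real.sin (2 * π * α) * compB (1 / 5) τ + Real.sin (4 * π * α) * compB (2 / 5) τ) := by
  have h1 := csr_ne_zero hτ
  have h2 := eta_ne_zero' hτ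
  have h3 : (√2 : ℂ) * √2 = 2 := by
    rw [← Complex.ofReal_mul, Real.mul_self_sqrt (by norm_num)]; norm_num
  have n2 : (√2 : ℂ) ≠ 0 := by simp
  have n5 : (√5 : ℂ) ≠ 0 := by simp
  rw [compA, signTheta_neg_one_div hτ (by norm_num) hα, eta_two_mul_neg_one_div hτ,
    eta_neg_one_div hτ, compB, compB]
  have h4 : csr τ / √2 = csr τ * √2 / 2 := by rw [← h3]; field_simp
  rw [h4]
  field_simp

/-- In this form the eta factors invert by known rules: τ ↦ -1/τ exchanges η(2τ) and η(τ/2) up to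
constants and `csr τ`. -/
lemma compC_eq {τ : ℂ} (hτ : 0 < τ.im) (α : ℝ) :
    compC α τ = ModularForm.eta τ / (2 * ModularForm.eta (2 * τ) * ModularForm.eta (τ / 2)) *
      signTheta 1 α (1 / 6) τ := by
  have h := eta_mul_eta_mul_eta hτ
  have h0 := eta_ne_zero' hτ
  have hz := ζ_ne_zero 48
  have h1 : ModularForm.eta (2 * τ) ≠ 0 ∧ ModularForm.eta (τ / 2) ≠ 0 := by
    have : ζ 48 * ModularForm.eta τ ^ 3 ≠ 0 := mul_ne_zero hz (pow_ne_zero _ h0)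
    rw [← h] at this
    exact ⟨left_ne_zero_of_mul (left_ne_zero_of_mul this),
      right_ne_zero_of_mul (left_ne_zero_of_mul this)⟩
  obtain ⟨h1, h2⟩ := h1
  rw [compC]
  congr 1
  generalize ModularForm.eta (2 * τ) = x, ModularForm.eta (τ / 2) = y,
    ModularForm.eta ((τ + 1) / 2) = z at *
  field_simp
  linear_combination h

lemma compC_neg_one_div {τ : ℂ} (hτ : 0 < τ.im) {α : ℝ} (hα : exp (2 * π * I * α * 5) = 1) :
    compC α (-1 / τ) = csr τ * (2 / √5) *
      (Real.sin (2 * π * α) * compC (1 / 5) τ + Real.sin (4 * π * α) * compC (2 / 5) τ) := by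
  have h1 := csr_ne_zero hτ
  have h2 := eta_ne_zero' hτ
  have n2 : (√2 : ℂ) ≠ 0 := by simp
  have n5 : (√5 : ℂ) ≠ 0 := by simp
  rw [compC_eq (im_neg_one_div_pos hτ), compC_eq hτ, compC_eq hτ,
    signTheta_neg_one_div hτ (by norm_num) hα, eta_two_mul_neg_one_div hτ,
    eta_neg_one_div hτ, eta_half_neg_one_div hτ]
  field_simp

lemma sin_three_pi_div_five : Real.sin (3 * π / 5) = Real.sin (2 * π / 5) := by
  rw [show 3 * π / 5 = π - 2 * π / 5 by ring, Real.sin_pi_sub]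

lemma sin_four_pi_div_five : Real.sin (4 * π / 5) = Real.sin (π / 5) := by
  rw [show 4 * π / 5 = π - π / 5 by ring, Real.sin_pi_sub]

lemma sin_six_pi_div_five : Real.sin (6 * π / 5) = -Real.sin (π / 5) := by
  rw [show 6 * π / 5 = π / 5 + π by ring, Real.sin_add_pi]

lemma sin_eight_pi_div_five : Real.sin (8 * π / 5) = -Real.sin (2 * π / 5) := by
  rw [show 8 * π / 5 = 2 * π - 2 * π / 5 by ring, Real.sin_two_pi_sub]

/-- This value makes 2/√5 times the symmetric 2 × 2 block of sines an involution. -/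
lemma sin_sq_add_sin_sq : Real.sin (π / 5) ^ 2 + Real.sin (2 * π / 5) ^ 2 = 5 / 4 := by
  have hc := Real.cos_pi_div_five
  have h5 : √5 * √5 = (5 : ℝ) := Real.mul_self_sqrt (by norm_num)
  rw [show 2 * π / 5 = 2 * (π / 5) by ring, Real.sin_sq, Real.sin_sq, Real.cos_two_mul, hc]
  linear_combination (1 / 64 - √5 / 16 - √5 ^ 2 / 64) * h5

lemma H52_map_S {τ : ℂ} (hτ : 0 < τ.im) :
    H52 (-1 / τ) = (-I * τ) ^ (1 / 2 : ℂ) • (S5 *ᵥ H52 τ) := by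
  have hA1 : ∀ {τ : ℂ}, 0 < τ.im → compA (1 / 10) (-1 / τ) = csr τ * (2 / √5) * √2 *
      (Real.sin (π / 5) * compB (1 / 5) τ + Real.sin (2 * π / 5) * compB (2 / 5) τ) := fun hτ => by
    rw [compA_neg_one_div hτ, show 2 * π * (1 / 10) = π / 5 by ring,
      show 4 * π * (1 / 10) = 2 * π / 5 by ring]
    rw [← exp_pi_odd 0 rfl]; push_cast; ring_nf
  have hA3 : ∀ {τ : ℂ}, 0 < τ.im → compA (3 / 10) (-1 / τ) = csr τ * (2 / √5) * √2 *
      (Real.sin (2 * π / 5) * compB (1 / 5) τ - Real.sin (π / 5) * compB (2 / 5) τ) := fun hτ => by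
    rw [compA_neg_one_div hτ, show 2 * π * (3 / 10) = 3 * π / 5 by ring,
      show 4 * π * (3 / 10) = 6 * π / 5 by ring, sin_three_pi_div_five, sin_six_pi_div_five]
    · push_cast; ring
    · rw [← exp_pi_odd 1 rfl]; push_cast; ring_nf
  have hC1 : compC (1 / 5) (-1 / τ) = csr τ * (2 / √5) *
      (Real.sin (2 * π / 5) * compC (1 / 5) τ + Real.sin (π / 5) * compC (2 / 5) τ) := by
    rw [compC_neg_one_div hτ, show 2 * π * (1 / 5) = 2 * π / 5 by ring,
      show 4 * π * (1 / 5) = 4 * π / 5 by ring, sin_four_pi_div_five]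
    rw [← exp_pi_even 1 rfl]; push_cast; ring_nf
  have hC2 : compC (2 / 5) (-1 / τ) = csr τ * (2 / √5) *
      (Real.sin (π / 5) * compC (1 / 5) τ - Real.sin (2 * π / 5) * compC (2 / 5) τ) := by
    rw [compC_neg_one_div hτ, show 2 * π * (2 / 5) = 4 * π / 5 by ring,
      show 4 * π * (2 / 5) = 8 * π / 5 by ring, sin_four_pi_div_five, sin_eight_pi_div_five]
    · push_cast; ring
    · rw [← exp_pi_even 2 rfl]; push_cast; ring_nf
  have h0 := ne_zero_of_im_pos hτ
  have hi := im_neg_one_div_pos hτ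
  have k1 := hA1 hi
  have k3 := hA3 hi
  rw [show -1 / (-1 / τ) = τ by field_simp, csr_inv hτ] at k1 k3
  have hc := csr_ne_zero hτ
  have h2 : (√2 : ℂ) * √2 = 2 := by
    rw [← Complex.ofReal_mul, Real.mul_self_sqrt (by norm_num)]; norm_num
  have h5 : (√5 : ℂ) * √5 = 5 := by
    rw [← Complex.ofReal_mul, Real.mul_self_sqrt (by norm_num)]; norm_num
  have n2 : (√2 : ℂ) ≠ 0 := by simp
  have n5 : (√5 : ℂ) ≠ 0 := by simp
  have hs : (Real.sin (π / 5) : ℂ) ^ 2 + (Real.sin (2 * π / 5) : ℂ) ^ 2 = 5 / 4 := by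
    rw [← Complex.ofReal_pow, ← Complex.ofReal_pow, ← Complex.ofReal_add, sin_sq_add_sin_sq]
    norm_num
  -- `signTheta_inversion` starts from ε = 1 only. For type B the formula for type A is used at -1/τ
  -- and solved for the B components by the involution.
  have hB1 : compB (1 / 5) (-1 / τ) = csr τ * (2 / √5) * (1 / √2) *
      (Real.sin (π / 5) * compA (1 / 10) τ + Real.sin (2 * π / 5) * compA (3 / 10) τ) := by
    rw [k1, k3]
    generalize (Real.sin (π / 5) : ℂ) = s₁ at *
    generalize (Real.sin (2 * π / 5) : ℂ) = s₂ at *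
    generalize compB (1 / 5) (-1 / τ) = x, compB (2 / 5) (-1 / τ) = y
    field_simp
    linear_combination x * h5 - 4 * x * hs
  have hB2 : compB (2 / 5) (-1 / τ) = csr τ * (2 / √5) * (1 / √2) *
      (Real.sin (2 * π / 5) * compA (1 / 10) τ - Real.sin (π / 5) * compA (3 / 10) τ) := by
    rw [k1, k3]
    generalize (Real.sin (π / 5) : ℂ) = s₁ at *
    generalize (Real.sin (2 * π / 5) : ℂ) = s₂ at *
    generalize compB (1 / 5) (-1 / τ) = x, compB (2 / 5) (-1 / τ) = y
    field_simp
    linear_combination y * h5 - 4 * y * hs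
  change _ = csr τ • _
  rw [H52_eq, H52_eq, hA1 hτ, hA3 hτ, hB1, hB2, hC1, hC2, S5, M5]
  ext i
  fin_cases i <;> simp [Matrix.mulVec, dotProduct, Fin.sum_univ_succ] <;> ring

/-! ### The non-holomorphic part of the indefinite theta series -/

/-- The summand of the non-holomorphic part of `signTheta`. -/
def betaKer (τ : ℂ) (x₁ x₂ : ℝ) : ℂ :=
  ((Real.sign (x₁ - x₂) * β (15 * (x₁ - x₂) ^ 2 * τ.im) : ℝ) : ℂ) *
    exp (π * I * τ * (5 * x₁ ^ 2 - 3 * x₂ ^ 2))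

/-- Half of the non-holomorphic part of `signTheta`. -/
def betaTheta (ε : ℂ) (a₁ a₂ : ℝ) (τ : ℂ) : ℂ :=
  ∑' p : ℤ × ℤ, ε ^ p.1 * (-1) ^ p.2 * betaKer τ (a₁ + p.1) (a₂ + p.2)

lemma abs_sign_le_one (x : ℝ) : |Real.sign x| ≤ 1 := by
  rcases Real.sign_apply_eq x with h | h | h <;> rw [h] <;> norm_num

lemma norm_of_sq_eq_one {ε : ℂ} (hε : ε ^ 2 = 1) : ‖ε‖ = 1 := by
  have := congrArg norm hε
  rw [norm_pow, norm_one] at this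
  exact (pow_eq_one_iff_of_nonneg (norm_nonneg _) two_ne_zero).mp this

lemma norm_zpow_of_sq_eq_one {ε : ℂ} (hε : ε ^ 2 = 1) (n : ℤ) : ‖ε ^ n‖ = 1 := by
  rw [norm_zpow, norm_of_sq_eq_one hε, one_zpow]

/-- The bound β(X) ≤ exp(-πX) adds 15(x₁ - x₂)² to the indefinite form, and the total 20x₁² - 30x₁x₂
+ 12x₂² is positive definite. -/
lemma norm_betaKer_le {τ : ℂ} (hτ : 0 < τ.im) (x₁ x₂ : ℝ) :
    ‖betaKer τ x₁ x₂‖ ≤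
      Real.exp (-(π * τ.im / 4) * x₁ ^ 2) * Real.exp (-(π * τ.im / 4) * x₂ ^ 2) := by
  have h1 : ‖exp (π * I * τ * (5 * x₁ ^ 2 - 3 * x₂ ^ 2))‖ =
      Real.exp (-(π * τ.im * (5 * x₁ ^ 2 - 3 * x₂ ^ 2))) := by
    rw [Complex.norm_exp]
    congr 1
    rw [show (π * I * τ * (5 * x₁ ^ 2 - 3 * x₂ ^ 2) : ℂ) =
      ((π * (5 * x₁ ^ 2 - 3 * x₂ ^ 2) : ℝ) : ℂ) * (I * τ) by push_cast; ring, Complex.re_ofReal_mul,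
      Complex.I_mul_re]
    ring
  have hy : 0 ≤ 15 * (x₁ - x₂) ^ 2 * τ.im := by positivity
  have h2 : ‖((Real.sign (x₁ - x₂) * β (15 * (x₁ - x₂) ^ 2 * τ.im) : ℝ) : ℂ)‖ ≤
      Real.exp (-π * (15 * (x₁ - x₂) ^ 2 * τ.im)) := by
    rw [Complex.norm_real, Real.norm_eq_abs, abs_mul, abs_of_nonneg (beta_nonneg hy)]
    exact (mul_le_of_le_one_left (beta_nonneg hy) (abs_sign_le_one _)).trans (beta_le_exp hy)
  rw [betaKer, norm_mul, h1, ← Real.exp_add]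
  refine (mul_le_mul_of_nonneg_right h2 (Real.exp_pos _).le).trans ?_
  rw [← Real.exp_add]
  refine Real.exp_le_exp.mpr ?_
  -- The total form minus (x₁² + x₂²)/4; its discriminant is still negative.
  have h3 : 0 ≤ 79 / 4 * x₁ ^ 2 - 30 * x₁ * x₂ + 47 / 4 * x₂ ^ 2 := by
    nlinarith [sq_nonneg (79 / 4 * x₁ - 15 * x₂), sq_nonneg x₂]
  have h4 : 0 ≤ π * τ.im := by positivity
  nlinarith [mul_nonneg h4 h3]

lemma summable_betaTheta {ε : ℂ} (hε : ε ^ 2 = 1) (a₁ a₂ : ℝ) {τ : ℂ} (hτ : 0 < τ.im) :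
    Summable fun p : ℤ × ℤ => ε ^ p.1 * (-1) ^ p.2 * betaKer τ (a₁ + p.1) (a₂ + p.2) := by
  have hc : 0 < π * τ.im / 4 := by positivity
  refine Summable.of_norm_bounded (summable_gauss_prod a₁ a₂ hc hc) fun p => ?_
  rw [norm_mul, norm_mul, norm_zpow_of_sq_eq_one hε, norm_zpow_of_sq_eq_one (by norm_num), one_mul,
    one_mul]
  exact norm_betaKer_le hτ _ _

/-- `(sgn (x₁ - x₂) + sgn (x₁ + x₂)) exp (πiτ(5x₁² - 3x₂²))`. -/
def signKer (τ : ℂ) (x₁ x₂ : ℝ) : ℂ :=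
  ((Real.sign (x₁ - x₂) + Real.sign (x₁ + x₂) : ℝ) : ℂ) * exp (π * I * τ * (5 * x₁ ^ 2 - 3 * x₂ ^ 2))

lemma ker_eq_signKer {τ : ℂ} (hτ : 0 < τ.im) (x₁ x₂ : ℝ) :
    ker τ x₁ x₂ = signKer τ x₁ x₂ - betaKer τ x₁ x₂ - betaKer τ x₁ (-x₂) := by
  have h : 0 < √(15 * τ.im) := Real.sqrt_pos.mpr (by positivity)
  have hs : ∀ x, Real.sign (√(15 * τ.im) * x) = Real.sign x := fun x => by
    rcases lt_trichotomy x 0 with hx | hx | hx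
    · rw [Real.sign_of_neg hx, Real.sign_of_neg (mul_neg_of_pos_of_neg h hx)]
    · rw [hx, mul_zero]
    · rw [Real.sign_of_pos hx, Real.sign_of_pos (mul_pos h hx)]
  have hb : ∀ x, (√(15 * τ.im) * x) ^ 2 = 15 * x ^ 2 * τ.im := fun x => by
    rw [mul_pow, Real.sq_sqrt (by positivity)]; ring
  rw [ker, signKer, betaKer, betaKer, E_eq_sign, E_eq_sign, hs, hs, hb, hb, sub_neg_eq_add]
  push_cast
  ring_nf

/-- The holomorphic part of `signTheta`. -/
def holTheta (ε : ℂ) (a₁ a₂ : ℝ) (τ : ℂ) : ℂ :=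
  ∑' p : ℤ × ℤ, ε ^ p.1 * (-1) ^ p.2 * signKer τ (a₁ + p.1) (a₂ + p.2)

lemma summable_betaTheta_neg {ε : ℂ} (hε : ε ^ 2 = 1) (a₁ a₂ : ℝ) {τ : ℂ} (hτ : 0 < τ.im) :
    Summable fun p : ℤ × ℤ => ε ^ p.1 * (-1) ^ p.2 * betaKer τ (a₁ + p.1) (-(a₂ + p.2)) := by
  refine ((((Equiv.refl ℤ).prodCongr (Equiv.neg ℤ)).summable_iff).mpr
    (summable_betaTheta hε a₁ (-a₂) hτ)).congr fun p => ?_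
  simp only [Function.comp_apply, Equiv.prodCongr_apply, Prod.map_fst, Prod.map_snd,
    Equiv.neg_apply, Equiv.refl_apply]
  rw [show (-1 : ℂ) ^ (-p.2) = (-1) ^ p.2 by rw [zpow_neg, ← inv_zpow, inv_neg_one]]
  push_cast
  rw [neg_add]

lemma tsum_betaTheta_neg (ε : ℂ) (a₁ a₂ : ℝ) (τ : ℂ) :
    ∑' p : ℤ × ℤ, ε ^ p.1 * (-1) ^ p.2 * betaKer τ (a₁ + p.1) (-(a₂ + p.2)) =
      betaTheta ε a₁ (-a₂) τ := by
  rw [betaTheta, ← ((Equiv.refl ℤ).prodCongr (Equiv.neg ℤ)).tsum_eq]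
  refine tsum_congr fun p => ?_
  simp only [Equiv.prodCongr_apply, Prod.map_fst, Prod.map_snd,
    Equiv.neg_apply, Equiv.refl_apply]
  rw [show (-1 : ℂ) ^ (-p.2) = (-1) ^ p.2 by rw [zpow_neg, ← inv_zpow, inv_neg_one]]
  push_cast
  rw [neg_add, neg_neg]

/-- No estimate on the cone is needed: the terms are sums of three families already known to be
summable. -/
lemma summable_holTheta {ε : ℂ} (hε : ε ^ 2 = 1) (a₁ a₂ : ℝ) {τ : ℂ} (hτ : 0 < τ.im) :
    Summable fun p : ℤ × ℤ => ε ^ p.1 * (-1) ^ p.2 * signKer τ (a₁ + p.1) (a₂ + p.2) := by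
  refine (((summable_signTheta hε a₁ a₂ hτ).add (summable_betaTheta hε a₁ a₂ hτ)).add
    (summable_betaTheta_neg hε a₁ a₂ hτ)).congr fun p => ?_
  rw [ker_eq_signKer hτ]
  ring

lemma signTheta_eq {ε : ℂ} (hε : ε ^ 2 = 1) (a₁ a₂ : ℝ) {τ : ℂ} (hτ : 0 < τ.im) :
    signTheta ε a₁ a₂ τ =
      holTheta ε a₁ a₂ τ - betaTheta ε a₁ a₂ τ - betaTheta ε a₁ (-a₂) τ := by
  rw [← tsum_betaTheta_neg, holTheta, betaTheta, ← (summable_holTheta hε a₁ a₂ hτ).tsum_sub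
    (summable_betaTheta hε a₁ a₂ hτ), ← ((summable_holTheta hε a₁ a₂ hτ).sub
    (summable_betaTheta hε a₁ a₂ hτ)).tsum_sub (summable_betaTheta_neg hε a₁ a₂ hτ), signTheta]
  refine tsum_congr fun p => ?_
  rw [ker_eq_signKer hτ]
  ring

/-! ### Reduction of the β part to unary series -/

/-- `∑ δ^l sgn(b+l) β(60 (b+l)² y) exp (-30πi(b+l)²τ)`. -/
def twistedR (δ : ℂ) (b : ℝ) (τ : ℂ) : ℂ :=
  ∑' l : ℤ, δ ^ l * (((Real.sign (b + l) * β (60 * (b + l) ^ 2 * τ.im) : ℝ) : ℂ) *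
    exp (-(30 * π * I * τ * (b + l) ^ 2)))

lemma im_thirty_mul (τ : ℂ) : (30 * τ).im = 30 * τ.im := by
  rw [show 30 * τ = ((30 : ℝ) : ℂ) * τ by push_cast; rfl, Complex.im_ofReal_mul]

lemma twistedR_one (b : ℝ) (τ : ℂ) : twistedR 1 b τ = R b 0 (30 * τ) := by
  rw [twistedR, R]
  refine tsum_congr fun l => ?_
  rw [one_zpow, one_mul, im_thirty_mul]
  congr 2
  · ring_nf
  · push_cast; ring

lemma twistedR_neg_one (b : ℝ) (τ : ℂ) :
    twistedR (-1) b τ = exp (5 * π * I * b) * R b (5 / 2) (30 * τ) := by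
  rw [twistedR, R, ← tsum_mul_left]
  refine tsum_congr fun l => ?_
  rw [im_thirty_mul, mul_left_comm, mul_left_comm (exp _)]
  congr 1
  · ring_nf
  · have : (-1 : ℂ) ^ l = exp (-(5 * π * I * l)) := by
      rw [← Complex.exp_pi_mul_I, ← Complex.exp_int_mul, Complex.exp_eq_exp_iff_exists_int]
      exact ⟨3 * l, by push_cast; ring⟩
    rw [this, ← Complex.exp_add, ← Complex.exp_add]
    push_cast
    ring_nf

lemma twistedR_neg {δ : ℂ} (hδ : δ ^ 2 = 1) (b : ℝ) (τ : ℂ) :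
    twistedR δ (-b) τ = -twistedR δ b τ := by
  rw [twistedR, twistedR, ← tsum_neg, ← (Equiv.neg ℤ).tsum_eq]
  refine tsum_congr fun l => ?_
  rw [Equiv.neg_apply, zpow_neg, ← inv_zpow, inv_eq_of_sq_eq_one hδ]
  push_cast
  rw [show -b + -(l : ℝ) = -(b + l) by ring, Real.sign_neg, show (-b + -l : ℂ) = -(b + l) by ring,
    neg_sq, neg_sq]
  push_cast
  ring

lemma twistedR_add_one {δ : ℂ} (hδ : δ ^ 2 = 1) (b : ℝ) (τ : ℂ) :
    twistedR δ (b + 1) τ = δ * twistedR δ b τ := by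
  have h0 : δ ≠ 0 := fun h => by simp [h] at hδ
  rw [twistedR, twistedR, ← tsum_mul_left, ← (Equiv.addRight (-1 : ℤ)).tsum_eq]
  refine tsum_congr fun l => ?_
  rw [Equiv.coe_addRight, zpow_add₀ h0, zpow_neg_one, inv_eq_of_sq_eq_one hδ]
  push_cast
  rw [show b + 1 + ((l : ℝ) + -1) = b + l by ring, show (b + 1 + (l + -1) : ℂ) = b + l by ring]
  ring

lemma twistedR_one_sub {δ : ℂ} (hδ : δ ^ 2 = 1) (b : ℝ) (τ : ℂ) :
    twistedR δ (1 - b) τ = -(δ * twistedR δ b τ) := by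
  rw [show 1 - b = -b + 1 by ring, twistedR_add_one hδ, twistedR_neg hδ]; ring

/-- The coefficients in the expansion of `betaTheta` in terms of theta functions. -/
def betaCoeff (μ : ℝ) (τ : ℂ) : ℂ :=
  ((Real.sign μ * β (15 * μ ^ 2 * τ.im) : ℝ) : ℂ) * exp (-(15 / 2 * π * I * τ * μ ^ 2))

lemma betaCoeff_two_mul (x : ℝ) (τ : ℂ) : betaCoeff (2 * x) τ =
    ((Real.sign x * β (60 * x ^ 2 * τ.im) : ℝ) : ℂ) * exp (-(30 * π * I * τ * x ^ 2)) := by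
  have : Real.sign (2 * x) = Real.sign x := by
    rcases lt_trichotomy x 0 with hx | hx | hx
    · rw [Real.sign_of_neg hx, Real.sign_of_neg (by linarith)]
    · rw [hx, mul_zero]
    · rw [Real.sign_of_pos hx, Real.sign_of_pos (by linarith)]
  rw [betaCoeff, this]
  push_cast
  ring_nf

/-- `betaTheta` is a combination of products of one-dimensional theta series. -/
lemma betaTheta_eq_tsum {ε : ℂ} (hε : ε ^ 2 = 1) (a₁ a₂ : ℝ) {τ : ℂ} (hτ : 0 < τ.im) :
    betaTheta ε a₁ a₂ τ = (∑' k : ℤ, betaCoeff (2 * ((a₁ - a₂) / 2 + k)) τ *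
        unary (-ε) ((5 * a₁ - 3 * a₂) / 2 + 5 * k) τ) +
      ε * ∑' k : ℤ, betaCoeff (2 * ((a₁ - a₂) / 2 + 1 / 2 + k)) τ *
        unary (-ε) ((5 * a₁ - 3 * a₂) / 2 + 5 / 2 + 5 * k) τ := by
  have h0 : ε ≠ 0 := fun h => by simp [h] at hε
  -- The shear n = k + j, after which x₁ - x₂ depends on k alone.
  let e : ℤ × ℤ ≃ ℤ × ℤ :=
    { toFun := fun p => (p.1 + p.2, p.2)
      invFun := fun p => (p.1 - p.2, p.2)
      left_inv := fun p => by simp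
      right_inv := fun p => by simp }
  have hterm : ∀ k j : ℤ, ε ^ (k + j) * (-1) ^ j * betaKer τ (a₁ + ((k + j : ℤ) : ℝ)) (a₂ + j) =
      ε ^ k * betaCoeff (a₁ - a₂ + k) τ *
        ((-ε) ^ j * exp (2 * π * I * τ * (j + (((5 * a₁ - 3 * a₂) / 2 + 5 / 2 * k : ℝ) : ℂ)) ^ 2)) := by
    intro k j
    have h1 : a₁ + ((k + j : ℤ) : ℝ) - (a₂ + j) = a₁ - a₂ + k := by push_cast; ring
    -- Completing the square: 5x₁² - 3x₂² = -15/2 μ² + 2(x₂ + 5μ/2)² for μ = x₁ - x₂.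
    have h2 : exp (π * I * τ * (5 * ((a₁ + ((k + j : ℤ) : ℝ) : ℝ) : ℂ) ^ 2 - 3 * ((a₂ + j : ℝ) : ℂ) ^ 2)) =
        exp (-(15 / 2 * π * I * τ * ((a₁ - a₂ + k : ℝ) : ℂ) ^ 2)) *
        exp (2 * π * I * τ * (j + (((5 * a₁ - 3 * a₂) / 2 + 5 / 2 * k : ℝ) : ℂ)) ^ 2) := by
      rw [← Complex.exp_add]; push_cast; ring_nf
    rw [betaKer, h1, h2, betaCoeff, zpow_add₀ h0, show (-ε) = ε * (-1) by ring, mul_zpow]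
    ring
  have hs' : Summable fun p : ℤ × ℤ => ε ^ p.1 * betaCoeff (a₁ - a₂ + p.1) τ *
      ((-ε) ^ p.2 * exp (2 * π * I * τ *
        (p.2 + (((5 * a₁ - 3 * a₂) / 2 + 5 / 2 * p.1 : ℝ) : ℂ)) ^ 2)) :=
    ((e.summable_iff).mpr (summable_betaTheta hε a₁ a₂ hτ)).congr fun p => hterm p.1 p.2
  have hsum : betaTheta ε a₁ a₂ τ = ∑' k : ℤ, ε ^ k * betaCoeff (a₁ - a₂ + k) τ *
      unary (-ε) ((5 * a₁ - 3 * a₂) / 2 + 5 / 2 * k) τ := by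
    rw [betaTheta, ← e.tsum_eq]
    refine (tsum_congr (fun p : ℤ × ℤ => hterm p.1 p.2)).trans (hs'.tsum_prod.trans ?_)
    exact tsum_congr fun k => by dsimp only; rw [tsum_mul_left, unary]
  have hs1 : Summable fun k : ℤ => ε ^ k * betaCoeff (a₁ - a₂ + k) τ *
      unary (-ε) ((5 * a₁ - 3 * a₂) / 2 + 5 / 2 * k) τ := by
    exact hs'.prod.congr fun k => by dsimp only; rw [tsum_mul_left, unary]
  -- The unary shift moves by 5k/2, so its class modulo 1 depends only on the parity of k; the sum
  -- is split accordingly.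
  have he : ∀ k : ℤ, ε ^ (2 * k) = 1 := fun k => by
    rw [zpow_mul, zpow_ofNat, hε, one_zpow]
  rw [hsum, tsum_int_even_odd hs1, ← tsum_mul_left]
  congr 1
  · refine tsum_congr fun k => ?_
    rw [he, one_mul]
    congr 2 <;> push_cast <;> ring
  · refine tsum_congr fun k => ?_
    rw [zpow_add₀ h0, he, one_mul, zpow_one, mul_assoc]
    congr 3 <;> push_cast <;> ring

lemma unary_neg_one_half_add (m : ℤ) (τ : ℂ) : unary (-1) (1 / 2 + m) τ = 0 := by
  rw [unary_add_int (by norm_num), unary_neg_one_half, mul_zero]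

lemma neg_one_zpow_five_mul (k : ℤ) : (-1 : ℂ) ^ (5 * k) = (-1) ^ k := by
  rw [zpow_mul]; norm_num

/-- For ε = 1 the inner series is `unary (-1)`. Even k has an integral shift and gives ±`unary (-1)
0`; odd k has a half-integral shift and gives 0. In the companion lemma with m + 1/2 the parities
change roles. -/
lemma betaTheta_one_of_int {a₁ a₂ : ℝ} {m : ℤ} (h : (5 * a₁ - 3 * a₂) / 2 = m) {τ : ℂ}
    (hτ : 0 < τ.im) :
    betaTheta 1 a₁ a₂ τ = (-1) ^ m * unary (-1) 0 τ * twistedR (-1) ((a₁ - a₂) / 2) τ := by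
  have h1 : ∀ k : ℤ, unary (-1) ((m : ℝ) + 5 * k) τ = (-1) ^ m * (-1) ^ k * unary (-1) 0 τ := by
    intro k
    rw [show (m : ℝ) + 5 * k = 0 + ((m + 5 * k : ℤ) : ℝ) by push_cast; ring,
      unary_add_int (by norm_num), zpow_add₀ (by norm_num), neg_one_zpow_five_mul]
  have h2 : ∀ k : ℤ, unary (-1) ((m : ℝ) + 5 / 2 + 5 * k) τ = 0 := by
    intro k
    rw [show (m : ℝ) + 5 / 2 + 5 * k = 1 / 2 + ((m + 2 + 5 * k : ℤ) : ℝ) by push_cast; ring,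
      unary_neg_one_half_add]
  rw [betaTheta_eq_tsum (by norm_num) a₁ a₂ hτ, h]
  simp only [h1, h2, mul_zero, tsum_zero, add_zero, betaCoeff_two_mul]
  rw [twistedR, ← tsum_mul_left]
  refine tsum_congr fun k => ?_
  push_cast
  ring

lemma betaTheta_one_of_half_int {a₁ a₂ : ℝ} {m : ℤ} (h : (5 * a₁ - 3 * a₂) / 2 = m + 1 / 2) {τ : ℂ}
    (hτ : 0 < τ.im) :
    betaTheta 1 a₁ a₂ τ =
      -((-1) ^ m * unary (-1) 0 τ * twistedR (-1) ((a₁ - a₂) / 2 + 1 / 2) τ) := by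
  have h1 : ∀ k : ℤ, unary (-1) ((m : ℝ) + 1 / 2 + 5 / 2 + 5 * k) τ =
      -((-1) ^ m * (-1) ^ k * unary (-1) 0 τ) := by
    intro k
    rw [show (m : ℝ) + 1 / 2 + 5 / 2 + 5 * k = 0 + ((m + 3 + 5 * k : ℤ) : ℝ) by push_cast; ring,
      unary_add_int (by norm_num), zpow_add₀ (by norm_num), zpow_add₀ (by norm_num),
      neg_one_zpow_five_mul]
    norm_num
  have h2 : ∀ k : ℤ, unary (-1) ((m : ℝ) + 1 / 2 + 5 * k) τ = 0 := by
    intro k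
    rw [show (m : ℝ) + 1 / 2 + 5 * k = 1 / 2 + ((m + 5 * k : ℤ) : ℝ) by push_cast; ring,
      unary_neg_one_half_add]
  rw [betaTheta_eq_tsum (by norm_num) a₁ a₂ hτ, h]
  simp only [h1, h2, mul_zero, tsum_zero, zero_add, betaCoeff_two_mul]
  rw [twistedR, ← tsum_mul_left, ← tsum_mul_left, ← tsum_neg]
  refine tsum_congr fun k => ?_
  push_cast
  ring

lemma unary_one_add_int (c : ℝ) (m : ℤ) (τ : ℂ) : unary 1 (c + m) τ = unary 1 c τ := by
  rw [unary_add_int (by norm_num), one_zpow, one_mul]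

lemma unary_one_three_quarters (τ : ℂ) : unary 1 (3 / 4) τ = unary 1 (1 / 4) τ := by
  rw [show (3 / 4 : ℝ) = -(1 / 4) + (1 : ℤ) by norm_num, unary_one_add_int, unary_neg (by norm_num)]

/-- For ε = -1 the inner series is `unary 1`, and every shift is 1/4 or 3/4 modulo 1, with the same
value by reflection. Both parities of k contribute, with opposite signs from ε. -/
lemma betaTheta_neg_one {a₁ a₂ : ℝ} {m : ℤ} (h : (5 * a₁ - 3 * a₂) / 2 = m / 2 + 1 / 4) {τ : ℂ}
    (hτ : 0 < τ.im) :
    betaTheta (-1) a₁ a₂ τ = unary 1 (1 / 4) τ *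
      (R ((a₁ - a₂) / 2) 0 (30 * τ) - R ((a₁ - a₂) / 2 + 1 / 2) 0 (30 * τ)) := by
  have hq : ∀ n : ℤ, unary 1 ((n : ℝ) / 2 + 1 / 4) τ = unary 1 (1 / 4) τ := fun n => by
    obtain ⟨k, rfl | rfl⟩ := n.even_or_odd'
    · rw [show ((2 * k : ℤ) : ℝ) / 2 + 1 / 4 = 1 / 4 + (k : ℤ) by push_cast; ring,
        unary_one_add_int]
    · rw [show ((2 * k + 1 : ℤ) : ℝ) / 2 + 1 / 4 = 3 / 4 + (k : ℤ) by push_cast; ring,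
        unary_one_add_int, unary_one_three_quarters]
  have h1 : ∀ k : ℤ, unary 1 ((m : ℝ) / 2 + 1 / 4 + 5 * k) τ = unary 1 (1 / 4) τ := fun k => by
    rw [← hq (m + 10 * k)]; push_cast; ring_nf
  have h2 : ∀ k : ℤ, unary 1 ((m : ℝ) / 2 + 1 / 4 + 5 / 2 + 5 * k) τ = unary 1 (1 / 4) τ :=
    fun k => by
      rw [← hq (m + 5 + 10 * k)]; push_cast; ring_nf
  rw [betaTheta_eq_tsum (by norm_num) a₁ a₂ hτ, h, neg_neg]
  simp only [h1, h2, betaCoeff_two_mul, tsum_mul_right]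
  rw [← twistedR_one, ← twistedR_one, twistedR, twistedR]
  simp only [one_zpow, one_mul]
  push_cast
  ring

lemma nonhol_one_tenth {τ : ℂ} (hτ : 0 < τ.im) :
    betaTheta 1 (1 / 10) (1 / 6) τ + betaTheta 1 (1 / 10) (-(1 / 6)) τ =
      -unary (-1) 0 τ * (ζ 12 * R (1 / 30) (5 / 2) (30 * τ) +
        ζ 12 ^ (-1 : ℤ) * R (11 / 30) (5 / 2) (30 * τ)) := by
  have e1 : ζ 12 = exp (5 * π * I * (1 / 30 : ℝ)) := by rw [ζ]; push_cast; ring_nf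
  have e2 : ζ 12 ^ (-1 : ℤ) = exp (5 * π * I * (11 / 30 : ℝ)) := by
    rw [zpow_neg_one, ζ_inv, Complex.exp_eq_exp_iff_exists_int]
    exact ⟨-1, by push_cast; ring⟩
  rw [betaTheta_one_of_int (m := 0) (by norm_num) hτ,
    betaTheta_one_of_half_int (m := 0) (by norm_num) hτ, e2, e1, ← twistedR_neg_one,
    ← twistedR_neg_one, show (1 / 10 - 1 / 6 : ℝ) / 2 = -(1 / 30) by norm_num,
    show (1 / 10 - -(1 / 6) : ℝ) / 2 + 1 / 2 = 1 - 11 / 30 by norm_num,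
    twistedR_neg (by norm_num), twistedR_one_sub (by norm_num)]
  norm_num
  ring

lemma nonhol_three_tenths {τ : ℂ} (hτ : 0 < τ.im) :
    betaTheta 1 (3 / 10) (1 / 6) τ + betaTheta 1 (3 / 10) (-(1 / 6)) τ =
      -unary (-1) 0 τ * (ζ 12 * R (13 / 30) (5 / 2) (30 * τ) +
        ζ 12 ^ (-1 : ℤ) * R (23 / 30) (5 / 2) (30 * τ)) := by
  have e1 : ζ 12 = exp (5 * π * I * (13 / 30 : ℝ)) := by
    rw [ζ, Complex.exp_eq_exp_iff_exists_int]
    exact ⟨-1, by push_cast; ring⟩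
  have e2 : ζ 12 ^ (-1 : ℤ) = exp (5 * π * I * (23 / 30 : ℝ)) := by
    rw [zpow_neg_one, ζ_inv, Complex.exp_eq_exp_iff_exists_int]
    exact ⟨-2, by push_cast; ring⟩
  rw [betaTheta_one_of_half_int (m := 0) (by norm_num) hτ,
    betaTheta_one_of_int (m := 1) (by norm_num) hτ, e2, e1, ← twistedR_neg_one,
    ← twistedR_neg_one, show (3 / 10 - 1 / 6 : ℝ) / 2 + 1 / 2 = 1 - 13 / 30 by norm_num,
    show (3 / 10 - -(1 / 6) : ℝ) / 2 = 1 - 23 / 30 by norm_num,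
    twistedR_one_sub (by norm_num), twistedR_one_sub (by norm_num)]
  norm_num
  ring

lemma R_one_sub (b : ℝ) (τ : ℂ) : R (1 - b) 0 (30 * τ) = -R b 0 (30 * τ) := by
  rw [← twistedR_one, ← twistedR_one, twistedR_one_sub (by norm_num), one_mul]

lemma nonhol_one_fifth {τ : ℂ} (hτ : 0 < τ.im) :
    betaTheta (-1) (1 / 5) (1 / 6) τ + betaTheta (-1) (1 / 5) (-(1 / 6)) τ =
      -unary 1 (1 / 4) τ * (-R (19 / 60) 0 (30 * τ) - R (29 / 60) 0 (30 * τ) +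
        R (49 / 60) 0 (30 * τ) + R (59 / 60) 0 (30 * τ)) := by
  rw [betaTheta_neg_one (m := 0) (by norm_num) hτ, betaTheta_neg_one (m := 1) (by norm_num) hτ,
    show (1 / 5 - 1 / 6 : ℝ) / 2 = 1 - 59 / 60 by norm_num,
    show (1 - 59 / 60 : ℝ) + 1 / 2 = 1 - 29 / 60 by norm_num,
    show (1 / 5 - -(1 / 6) : ℝ) / 2 = 1 - 49 / 60 by norm_num,
    show (1 - 49 / 60 : ℝ) + 1 / 2 = 1 - 19 / 60 by norm_num, R_one_sub, R_one_sub, R_one_sub,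
    R_one_sub]
  ring

lemma nonhol_two_fifths {τ : ℂ} (hτ : 0 < τ.im) :
    betaTheta (-1) (2 / 5) (1 / 6) τ + betaTheta (-1) (2 / 5) (-(1 / 6)) τ =
      -unary 1 (1 / 4) τ * (-R (13 / 60) 0 (30 * τ) - R (23 / 60) 0 (30 * τ) +
        R (43 / 60) 0 (30 * τ) + R (53 / 60) 0 (30 * τ)) := by
  rw [betaTheta_neg_one (m := 1) (by norm_num) hτ, betaTheta_neg_one (m := 2) (by norm_num) hτ,
    show (2 / 5 - 1 / 6 : ℝ) / 2 = 1 - 53 / 60 by norm_num,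
    show (1 - 53 / 60 : ℝ) + 1 / 2 = 1 - 23 / 60 by norm_num,
    show (2 / 5 - -(1 / 6) : ℝ) / 2 = 1 - 43 / 60 by norm_num,
    show (1 - 43 / 60 : ℝ) + 1 / 2 = 1 - 13 / 60 by norm_num, R_one_sub, R_one_sub, R_one_sub,
    R_one_sub]
  ring

/-! ### The holomorphic part and Hecke-type sums -/

lemma tsum_eq_tsum_nat_sum {F : ℤ × ℤ → ℂ} (hF : Summable F) (s : ℕ → Finset ℤ)
    (hp : ∀ (n : ℕ), ∀ j ∉ s n, F (n, j) = 0) (hn : ∀ (n : ℕ), ∀ j ∉ s n, F (-(n + 1), j) = 0) :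
    ∑' p, F p = ∑' n : ℕ, ∑ j ∈ s n, (F (n, j) + F (-(n + 1), j)) := by
  have hg := hF.prod
  have i1 : Function.Injective fun n : ℕ => (n : ℤ) := Nat.cast_injective
  have i2 : Function.Injective fun n : ℕ => -((n : ℤ) + 1) := fun m n h => by simpa using h
  have s1 : Summable fun n : ℕ => ∑' j, F ((n : ℤ), j) := hg.comp_injective i1
  have s2 : Summable fun n : ℕ => ∑' j, F (-((n : ℤ) + 1), j) := hg.comp_injective i2
  have h := (s1.hasSum.of_nat_of_neg_add_one s2.hasSum (f := fun n => ∑' j, F (n, j))).tsum_eq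
  rw [hF.tsum_prod, h, ← s1.tsum_add s2]
  refine tsum_congr fun n => ?_
  rw [tsum_eq_sum (hp n), tsum_eq_sum (hn n), ← Finset.sum_add_distrib]

lemma tsum_eq_tsum_nat_sum' {F : ℤ × ℤ → ℂ} (hF : Summable F) (s : ℕ → Finset ℤ)
    (h0 : ∀ j, F (0, j) = 0) (hp : ∀ (n : ℕ), ∀ j ∉ s n, F (n + 1, j) = 0)
    (hn : ∀ (n : ℕ), ∀ j ∉ s n, F (-(n + 1), j) = 0) :
    ∑' p, F p = ∑' n : ℕ, ∑ j ∈ s n, (F (n + 1, j) + F (-(n + 1), j)) := by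
  have hg := hF.prod
  have i1 : Function.Injective fun n : ℕ => (n : ℤ) + 1 := fun m n h => by simpa using h
  have i2 : Function.Injective fun n : ℕ => -((n : ℤ) + 1) := fun m n h => by simpa using h
  have s1 : Summable fun n : ℕ => ∑' j, F ((n : ℤ) + 1, j) := hg.comp_injective i1
  have s2 : Summable fun n : ℕ => ∑' j, F (-((n : ℤ) + 1), j) := hg.comp_injective i2
  have h := (s1.hasSum.of_add_one_of_neg_add_one s2.hasSum (f := fun n => ∑' j, F (n, j))).tsum_eq
  rw [hF.tsum_prod, h]
  simp only [h0, tsum_zero, add_zero]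
  rw [← s1.tsum_add s2]
  refine tsum_congr fun n => ?_
  rw [tsum_eq_sum (hp n), tsum_eq_sum (hn n), ← Finset.sum_add_distrib]

/-- The sum of the two signs at the lattice point `p` of the translate by `(a, 1/6)`. -/
def latSign (a : ℝ) (p : ℤ × ℤ) : ℝ :=
  Real.sign (a + p.1 - (1 / 6 + p.2)) + Real.sign (a + p.1 + (1 / 6 + p.2))

section LatSign

variable {a : ℝ} {n j : ℤ}

lemma latSign_eq_two (h1 : 0 < a + n - (1 / 6 + j)) (h2 : 0 < a + n + (1 / 6 + j)) :
    latSign a (n, j) = 2 := by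
  rw [latSign, Real.sign_of_pos h1, Real.sign_of_pos h2]; norm_num

lemma latSign_eq_neg_two (h1 : a + n - (1 / 6 + j) < 0) (h2 : a + n + (1 / 6 + j) < 0) :
    latSign a (n, j) = -2 := by
  rw [latSign, Real.sign_of_neg h1, Real.sign_of_neg h2]; norm_num

lemma latSign_eq_zero (h1 : 0 < a + n - (1 / 6 + j)) (h2 : a + n + (1 / 6 + j) < 0) :
    latSign a (n, j) = 0 := by
  rw [latSign, Real.sign_of_pos h1, Real.sign_of_neg h2]; norm_num

lemma latSign_eq_zero' (h1 : a + n - (1 / 6 + j) < 0) (h2 : 0 < a + n + (1 / 6 + j)) :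
    latSign a (n, j) = 0 := by
  rw [latSign, Real.sign_of_neg h1, Real.sign_of_pos h2]; norm_num

end LatSign

/-- For these a the cone |1/6 + j| < |a + n| meets each of the rows n and -(n+1), n ≥ 0, exactly in
|j| ≤ n, and the two rows carry opposite signs. -/
lemma tsum_latSign {f : ℤ × ℤ → ℂ} {a : ℝ} (ha : 1 / 6 < a) (ha' : a < 5 / 6)
    (hs : Summable fun p : ℤ × ℤ => (latSign a p : ℂ) * f p) :
    ∑' p : ℤ × ℤ, (latSign a p : ℂ) * f p =
    ∑' n : ℕ, ∑ j ∈ Finset.Icc (-(n : ℤ)) n, 2 * (f (n, j) - f (-(n + 1), j)) := by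
  rw [tsum_eq_tsum_nat_sum hs fun n => Finset.Icc (-(n : ℤ)) n]
  · refine tsum_congr fun n => Finset.sum_congr rfl fun j hj => ?_
    rw [Finset.mem_Icc] at hj
    have h1 : (j : ℝ) ≤ n := by exact_mod_cast hj.2
    have h2 : -(n : ℝ) ≤ j := by exact_mod_cast hj.1
    rw [latSign_eq_two (by push_cast; linarith) (by push_cast; linarith),
      latSign_eq_neg_two (by push_cast; linarith) (by push_cast; linarith)]
    push_cast
    ring
  · intro n j hj
    rw [Finset.mem_Icc, not_and_or, not_le, not_le] at hj
    have h0 : (0 : ℝ) ≤ n := n.cast_nonneg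
    rcases hj with hj | hj
    · have h1 : (j : ℝ) + 1 ≤ -(n : ℝ) := by exact_mod_cast hj
      rw [latSign_eq_zero (by push_cast; linarith) (by push_cast; linarith)]; simp
    · have h1 : (n : ℝ) + 1 ≤ j := by exact_mod_cast hj
      rw [latSign_eq_zero' (by push_cast; linarith) (by push_cast; linarith)]; simp
  · intro n j hj
    rw [Finset.mem_Icc, not_and_or, not_le, not_le] at hj
    have h0 : (0 : ℝ) ≤ n := n.cast_nonneg
    rcases hj with hj | hj
    · have h1 : (j : ℝ) + 1 ≤ -(n : ℝ) := by exact_mod_cast hj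
      rw [latSign_eq_zero (by push_cast; linarith) (by push_cast; linarith)]; simp
    · have h1 : (n : ℝ) + 1 ≤ j := by exact_mod_cast hj
      rw [latSign_eq_zero' (by push_cast; linarith) (by push_cast; linarith)]; simp

/-- For small a the cone misses row 0, and the rows ±(n+1) meet it in -(n+1) ≤ j ≤ n. The
unsymmetric column j = -(n+1) is responsible for the extra theta series in ψ₀. -/
lemma tsum_latSign' {f : ℤ × ℤ → ℂ} {a : ℝ} (ha : -(1 / 6) < a) (ha' : a < 1 / 6)
    (hs : Summable fun p : ℤ × ℤ => (latSign a p : ℂ) * f p) :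
    ∑' p : ℤ × ℤ, (latSign a p : ℂ) * f p =
    ∑' n : ℕ, ∑ j ∈ Finset.Icc (-((n : ℤ) + 1)) n, 2 * (f (n + 1, j) - f (-(n + 1), j)) := by
  rw [tsum_eq_tsum_nat_sum' hs fun n => Finset.Icc (-((n : ℤ) + 1)) n]
  · refine tsum_congr fun n => Finset.sum_congr rfl fun j hj => ?_
    rw [Finset.mem_Icc] at hj
    have h1 : (j : ℝ) ≤ n := by exact_mod_cast hj.2
    have h2 : -((n : ℝ) + 1) ≤ j := by exact_mod_cast hj.1
    rw [latSign_eq_two (by push_cast; linarith) (by push_cast; linarith),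
      latSign_eq_neg_two (by push_cast; linarith) (by push_cast; linarith)]
    push_cast
    ring
  · intro j
    rcases lt_or_ge j 0 with hj | hj
    · have h1 : (j : ℝ) + 1 ≤ 0 := by exact_mod_cast hj
      rw [latSign_eq_zero (by push_cast; linarith) (by push_cast; linarith)]; simp
    · have h1 : (0 : ℝ) ≤ j := by exact_mod_cast hj
      rw [latSign_eq_zero' (by push_cast; linarith) (by push_cast; linarith)]; simp
  · intro n j hj
    rw [Finset.mem_Icc, not_and_or, not_le, not_le] at hj
    have h0 : (0 : ℝ) ≤ n := n.cast_nonneg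
    rcases hj with hj | hj
    · have h1 : (j : ℝ) + 1 ≤ -((n : ℝ) + 1) := by exact_mod_cast hj
      rw [latSign_eq_zero (by push_cast; linarith) (by push_cast; linarith)]; simp
    · have h1 : (n : ℝ) + 1 ≤ j := by exact_mod_cast hj
      rw [latSign_eq_zero' (by push_cast; linarith) (by push_cast; linarith)]; simp
  · intro n j hj
    rw [Finset.mem_Icc, not_and_or, not_le, not_le] at hj
    have h0 : (0 : ℝ) ≤ n := n.cast_nonneg
    rcases hj with hj | hj
    · have h1 : (j : ℝ) + 1 ≤ -((n : ℝ) + 1) := by exact_mod_cast hj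
      rw [latSign_eq_zero (by push_cast; linarith) (by push_cast; linarith)]; simp
    · have h1 : (n : ℝ) + 1 ≤ j := by exact_mod_cast hj
      rw [latSign_eq_zero' (by push_cast; linarith) (by push_cast; linarith)]; simp

/-- The exponential in the summand of the theta series of characteristic `(a, 1/6)`. -/
def latExp (a : ℝ) (τ : ℂ) (p : ℤ × ℤ) : ℂ :=
  exp (π * I * τ * (5 * (a + p.1) ^ 2 - 3 * (1 / 6 + p.2) ^ 2))

lemma holTheta_term (ε : ℂ) (a : ℝ) (τ : ℂ) (p : ℤ × ℤ) :
    ε ^ p.1 * (-1) ^ p.2 * signKer τ (a + p.1) (1 / 6 + p.2) =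
      (latSign a p : ℂ) * (ε ^ p.1 * (-1) ^ p.2 * latExp a τ p) := by
  rw [signKer, latExp, latSign]
  push_cast
  ring

lemma holTheta_eq {ε : ℂ} (hε : ε ^ 2 = 1) {a : ℝ} (ha : 1 / 6 < a) (ha' : a < 5 / 6) {τ : ℂ}
    (hτ : 0 < τ.im) :
    holTheta ε a (1 / 6) τ = ∑' n : ℕ, ∑ j ∈ Finset.Icc (-(n : ℤ)) n,
      2 * (ε ^ n * (-1) ^ j * (latExp a τ (n, j) - ε * latExp a τ (-(n + 1), j))) := by
  have h0 : ε ≠ 0 := fun h => by simp [h] at hε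
  rw [holTheta, tsum_congr (holTheta_term ε a τ), tsum_latSign ha ha'
    ((summable_holTheta hε a (1 / 6) hτ).congr (holTheta_term ε a τ))]
  refine tsum_congr fun n => Finset.sum_congr rfl fun j _ => ?_
  dsimp only
  rw [zpow_neg, ← inv_zpow, inv_eq_of_sq_eq_one hε, zpow_add₀ h0, zpow_one, zpow_natCast]
  ring

lemma holTheta_eq' {a : ℝ} (ha : -(1 / 6) < a) (ha' : a < 1 / 6) {τ : ℂ}
    (hτ : 0 < τ.im) :
    holTheta 1 a (1 / 6) τ = ∑' n : ℕ, ∑ j ∈ Finset.Icc (-((n : ℤ) + 1)) n,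
      2 * ((-1) ^ j * (latExp a τ (n + 1, j) - latExp a τ (-(n + 1), j))) := by
  rw [holTheta, tsum_congr (holTheta_term 1 a τ), tsum_latSign' ha ha'
    ((summable_holTheta (by norm_num) a (1 / 6) hτ).congr (holTheta_term 1 a τ))]
  refine tsum_congr fun n => Finset.sum_congr rfl fun j _ => ?_
  dsimp only
  rw [one_zpow, one_zpow]
  ring

/-! ### Hecke-type sums -/

/-- The terms of the Hecke-type sums. -/
def heckeTerm (e : ℕ → ℤ → ℤ) (k : ℕ → ℕ) (n : ℕ) (q : ℂ) : ℂ :=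
  ∑ j ∈ Finset.Icc (-(n : ℤ)) n, (-1 : ℂ) ^ j * q ^ e n j * (1 - q ^ k n)

/-- Hecke-type sums. -/
def heckeSum (e : ℕ → ℤ → ℤ) (k : ℕ → ℕ) (q : ℂ) : ℂ := ∑' n : ℕ, heckeTerm e k n q

lemma norm_heckeTerm_le {e : ℕ → ℤ → ℤ}
    (he : ∀ (n : ℕ) (j : ℤ), -(n : ℤ) ≤ j → j ≤ n → (n : ℤ) ≤ e n j) (k : ℕ → ℕ)
    {q : ℂ} {r : ℝ} (hq : ‖q‖ ≤ r) (hr : r < 1) (n : ℕ) :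
    ‖heckeTerm e k n q‖ ≤ (2 * n + 1) * (r ^ n * 2) := by
  have hr0 := (norm_nonneg q).trans hq
  have h1 : ∀ j ∈ Finset.Icc (-(n : ℤ)) n,
      ‖(-1 : ℂ) ^ j * q ^ e n j * (1 - q ^ k n)‖ ≤ r ^ n * 2 := by
    intro j hj
    rw [Finset.mem_Icc] at hj
    obtain ⟨m, hm⟩ := Int.eq_ofNat_of_zero_le ((Int.natCast_nonneg n).trans (he n j hj.1 hj.2))
    have hnm : n ≤ m := by have := he n j hj.1 hj.2; omega
    rw [hm, norm_mul, norm_mul, norm_zpow_of_sq_eq_one (by norm_num), one_mul, zpow_natCast, norm_pow]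
    refine mul_le_mul ?_ ?_ (norm_nonneg _) (by positivity)
    · exact (pow_le_pow_left₀ (norm_nonneg _) hq m).trans (pow_le_pow_of_le_one hr0 hr.le hnm)
    · refine (norm_sub_le _ _).trans ?_
      rw [norm_one, norm_pow]
      have := pow_le_one₀ (n := k n) (norm_nonneg q) (hq.trans hr.le)
      linarith
  refine (norm_sum_le _ _).trans ((Finset.sum_le_sum h1).trans_eq ?_)
  rw [Finset.sum_const, Int.card_Icc, nsmul_eq_mul]
  congr 1
  have : ((n : ℤ) + 1 - -(n : ℤ)).toNat = 2 * n + 1 := by omega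
  rw [this]
  push_cast
  ring

lemma summable_hecke_bound {r : ℝ} (hr0 : 0 ≤ r) (hr : r < 1) :
    Summable fun n : ℕ => (2 * n + 1) * (r ^ n * 2) := by
  have h1 := summable_pow_mul_geometric_of_norm_lt_one 1
    (show ‖r‖ < 1 by rwa [Real.norm_of_nonneg hr0])
  have h0 := summable_geometric_of_lt_one hr0 hr
  refine ((h1.mul_left 4).add (h0.mul_left 2)).congr fun n => ?_
  ring

lemma summable_heckeTerm {e : ℕ → ℤ → ℤ}
    (he : ∀ (n : ℕ) (j : ℤ), -(n : ℤ) ≤ j → j ≤ n → (n : ℤ) ≤ e n j) (k : ℕ → ℕ)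
    {q : ℂ} (hq : ‖q‖ < 1) : Summable fun n => heckeTerm e k n q :=
  Summable.of_norm_bounded (summable_hecke_bound (norm_nonneg q) hq)
    (norm_heckeTerm_le he k le_rfl hq)

lemma latExp_eq {a : ℝ} {n j N : ℤ} (h : (N : ℝ) = 5 * n ^ 2 + 10 * a * n - 3 * j ^ 2 - j) (τ : ℂ) :
    latExp a τ (n, j) = exp (π * I * τ * (5 * a ^ 2 - 1 / 12)) * qpow (1 / 2) τ ^ N := by
  have h' : (N : ℂ) = 5 * n ^ 2 + 10 * a * n - 3 * j ^ 2 - j := by exact_mod_cast congrArg ofReal h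
  rw [latExp, qpow_zpow, qpow, ← Complex.exp_add]
  congr 1
  push_cast
  rw [h']
  ring

lemma latExp_eq' {a : ℝ} {n j N : ℤ} (h : (2 * N : ℝ) = 5 * n ^ 2 + 10 * a * n - 3 * j ^ 2 - j)
    (τ : ℂ) :
    latExp a τ (n, j) = exp (π * I * τ * (5 * a ^ 2 - 1 / 12)) * qpow 1 τ ^ N := by
  rw [latExp_eq (N := 2 * N) (by push_cast; exact h), zpow_mul]
  congr 2
  rw [zpow_ofNat, qpow_pow]
  norm_num

lemma psi1_eq (q : ℂ) : psi1 q = qPoch (-q) q / qPoch q q *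
    heckeSum (fun n j => (5 * (n : ℤ) ^ 2 + 3 * n - 3 * j ^ 2 - j) / 2) (fun n => 2 * n + 1) q := rfl

lemma phi0_eq (q : ℂ) : phi0 q = qPoch (-q) (q ^ 2) / qPoch (q ^ 2) (q ^ 2) *
    heckeSum (fun n j => 5 * (n : ℤ) ^ 2 + 2 * n - 3 * j ^ 2 - j) (fun n => 6 * n + 3) q := rfl

lemma phi1_eq (q : ℂ) : phi1 q = q * (qPoch (-q) (q ^ 2) / qPoch (q ^ 2) (q ^ 2)) *
    heckeSum (fun n j => 5 * (n : ℤ) ^ 2 + 4 * n - 3 * j ^ 2 - j) (fun n => 2 * n + 1) q := rfl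

lemma psi0_eq (q : ℂ) : psi0 q = (qPoch (-q) q / qPoch q q *
      (1 + 2 * (∑' m : ℕ, (-1 : ℂ) ^ (m + 1) * q ^ ((m + 1) ^ 2 + (m + 1))) -
        2 * heckeSum (fun m j => (5 * ((m : ℤ) + 1) ^ 2 - ((m : ℤ) + 1) - 3 * j ^ 2 - j) / 2)
          (fun m => m + 1) q) - 1) / 2 := rfl

lemma sq_le_of_mem {n : ℕ} {j : ℤ} (h1 : -(n : ℤ) ≤ j) (h2 : j ≤ n) : j ^ 2 ≤ (n : ℤ) ^ 2 :=
  sq_le_sq' h1 h2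

lemma le_exponent_psi0 (n : ℕ) (j : ℤ) (h1 : -(n : ℤ) ≤ j) (h2 : j ≤ n) :
    (n : ℤ) ≤ (5 * ((n : ℤ) + 1) ^ 2 - ((n : ℤ) + 1) - 3 * j ^ 2 - j) / 2 := by
  rw [Int.le_ediv_iff_mul_le two_pos]
  nlinarith [sq_le_of_mem h1 h2]

lemma le_exponent_psi1 (n : ℕ) (j : ℤ) (h1 : -(n : ℤ) ≤ j) (h2 : j ≤ n) :
    (n : ℤ) ≤ (5 * (n : ℤ) ^ 2 + 3 * n - 3 * j ^ 2 - j) / 2 := by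
  rw [Int.le_ediv_iff_mul_le two_pos]
  nlinarith [sq_le_of_mem h1 h2]

lemma le_exponent_phi0 (n : ℕ) (j : ℤ) (h1 : -(n : ℤ) ≤ j) (h2 : j ≤ n) :
    (n : ℤ) ≤ 5 * (n : ℤ) ^ 2 + 2 * n - 3 * j ^ 2 - j := by
  nlinarith [sq_le_of_mem h1 h2]

lemma le_exponent_phi1 (n : ℕ) (j : ℤ) (h1 : -(n : ℤ) ≤ j) (h2 : j ≤ n) :
    (n : ℤ) ≤ 5 * (n : ℤ) ^ 2 + 4 * n - 3 * j ^ 2 - j := by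
  nlinarith [sq_le_of_mem h1 h2]

lemma even_sub_hecke (a b n j : ℤ) (h : Even (a * n ^ 2 + b * n)) :
    Even (a * n ^ 2 + b * n - 3 * j ^ 2 - j) := by
  have h4 : Even (j * (j + 1)) := Int.even_mul_succ_self _
  rw [show a * n ^ 2 + b * n - 3 * j ^ 2 - j =
    (a * n ^ 2 + b * n) - j * (j + 1) - 2 * j ^ 2 by ring]
  exact (h.sub h4).sub (even_two_mul _)

lemma even_five_mul_sq_add (n : ℤ) {b : ℤ} (hb : Odd b) : Even (5 * n ^ 2 + b * n) := by
  obtain ⟨c, rfl⟩ := hb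
  have h4 : Even (n * (n + 1)) := Int.even_mul_succ_self _
  rw [show 5 * n ^ 2 + (2 * c + 1) * n = n * (n + 1) + 2 * (2 * n ^ 2 + c * n) by ring]
  exact h4.add (even_two_mul _)

/-- The exponents in rows n and -(n+1) differ by 2n + 1, which produces the factor 1 - q^(2n+1). -/
lemma holTheta_three_tenths {τ : ℂ} (hτ : 0 < τ.im) :
    holTheta 1 (3 / 10) (1 / 6) τ = 2 * qpow (11 / 60) τ *
      heckeSum (fun n j => (5 * (n : ℤ) ^ 2 + 3 * n - 3 * j ^ 2 - j) / 2) (fun n => 2 * n + 1)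
        (qpow 1 τ) := by
  have hE : exp (π * I * τ * (5 * ((3 / 10 : ℝ) : ℂ) ^ 2 - 1 / 12)) = qpow (11 / 60) τ := by
    rw [qpow]; push_cast; ring_nf
  rw [holTheta_eq (by norm_num) (by norm_num) (by norm_num) hτ, heckeSum, ← tsum_mul_left]
  refine tsum_congr fun n => ?_
  rw [heckeTerm, Finset.mul_sum]
  refine Finset.sum_congr rfl fun j _ => ?_
  obtain ⟨M, hM⟩ := even_iff_exists_two_mul.mp
    (even_sub_hecke 5 3 n j (even_five_mul_sq_add n (b := 3) (by decide)))
  have hM' : (5 * (n : ℝ) ^ 2 + 3 * n - 3 * j ^ 2 - j) = 2 * M := by exact_mod_cast hM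
  rw [hM, Int.mul_ediv_cancel_left _ two_ne_zero, latExp_eq' (N := M) (by push_cast; linarith),
    latExp_eq' (N := M + (2 * n + 1 : ℕ)) (by push_cast; linarith), hE,
    zpow_add₀ (qpow_ne_zero 1 τ), zpow_natCast, one_pow]
  ring

lemma Icc_neg_succ (n : ℕ) : Finset.Icc (-((n : ℤ) + 1)) n =
    insert (-((n : ℤ) + 1)) (Finset.Icc (-(n : ℤ)) n) := by
  ext j; simp only [Finset.mem_Icc, Finset.mem_insert]; omega

/-- The column j = -(n+1) gives the powers q^((n+1)²+(n+1)) and the Gauss terms q^((n+1)²); the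
remaining columns |j| ≤ n give the Hecke-type sum. -/
lemma holTheta_one_tenth {τ : ℂ} (hτ : 0 < τ.im) :
    holTheta 1 (1 / 10) (1 / 6) τ = qpow (-1 / 60) τ *
      (2 * (∑' m : ℕ, (-1 : ℂ) ^ (m + 1) * qpow 1 τ ^ ((m + 1) ^ 2 + (m + 1))) -
        2 * (∑' m : ℕ, (-1 : ℂ) ^ (m + 1) * qpow 1 τ ^ ((m + 1) ^ 2)) -
        2 * heckeSum (fun m j => (5 * ((m : ℤ) + 1) ^ 2 - ((m : ℤ) + 1) - 3 * j ^ 2 - j) / 2)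
          (fun m => m + 1) (qpow 1 τ)) := by
  have hq := norm_qpow_lt_one (r := 1) one_pos hτ
  have hE : exp (π * I * τ * (5 * ((1 / 10 : ℝ) : ℂ) ^ 2 - 1 / 12)) = qpow (-1 / 60) τ := by
    rw [qpow]; push_cast; ring_nf
  have s1 : Summable fun s : ℕ => (-1 : ℂ) ^ (s + 1) * qpow 1 τ ^ ((s + 1) ^ 2 + (s + 1)) := by
    refine Summable.of_norm_bounded (summable_geometric_of_lt_one (norm_nonneg _) hq) fun s => ?_
    rw [norm_mul, norm_pow, norm_neg, norm_one, one_pow, one_mul, norm_pow]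
    exact pow_le_pow_of_le_one (norm_nonneg _) hq.le (by nlinarith)
  have s2 := summable_pow_sq hq
  have s3 := summable_heckeTerm le_exponent_psi0 (fun m => m + 1) hq
  rw [holTheta_eq' (by norm_num) (by norm_num) hτ, heckeSum, ← tsum_mul_left, ← tsum_mul_left,
    ← tsum_mul_left, ← (s1.mul_left 2).tsum_sub (s2.mul_left 2),
    ← ((s1.mul_left 2).sub (s2.mul_left 2)).tsum_sub (s3.mul_left 2), ← tsum_mul_left]
  refine tsum_congr fun n => ?_
  rw [Icc_neg_succ, Finset.sum_insert (by simp [Finset.mem_Icc]), heckeTerm,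
    sub_eq_add_neg (_ - _) (2 * _), Finset.mul_sum, ← Finset.sum_neg_distrib, mul_add (qpow _ _),
    Finset.mul_sum]
  congr 1
  · have e1 : (-1 : ℂ) ^ (-((n : ℤ) + 1)) = (-1) ^ (n + 1) := by
      rw [zpow_neg, ← inv_zpow, inv_neg_one]; exact_mod_cast zpow_natCast (-1 : ℂ) (n + 1)
    rw [latExp_eq' (N := ((n + 1) ^ 2 + (n + 1) : ℕ)) (by push_cast; ring),
      latExp_eq' (N := ((n + 1) ^ 2 : ℕ)) (by push_cast; ring), hE, zpow_natCast, zpow_natCast, e1]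
    ring
  · refine Finset.sum_congr rfl fun j _ => ?_
    obtain ⟨M, hM⟩ := even_iff_exists_two_mul.mp
      (even_sub_hecke 5 (-1) (n + 1) j (even_five_mul_sq_add (n + 1) (b := -1) (by decide)))
    have hM' : (5 * ((n : ℝ) + 1) ^ 2 + -1 * ((n : ℝ) + 1) - 3 * j ^ 2 - j) = 2 * M := by
      exact_mod_cast hM
    rw [show 5 * ((n : ℤ) + 1) ^ 2 - ((n : ℤ) + 1) - 3 * j ^ 2 - j = 2 * M by rw [← hM]; ring,
      Int.mul_ediv_cancel_left _ two_ne_zero,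
      latExp_eq' (N := M + (n + 1 : ℕ)) (by push_cast; linarith),
      latExp_eq' (N := M) (by push_cast; linarith), hE,
      zpow_add₀ (qpow_ne_zero 1 τ), zpow_natCast]
    ring

lemma neg_zpow_of_even_sub {h : ℂ} (N : ℤ) (n : ℕ) (hN : Even (N - n)) :
    (-h) ^ N = (-1) ^ n * h ^ N := by
  have e : (-1 : ℂ) ^ N = (-1) ^ n := by
    obtain ⟨m, hm⟩ := hN
    rw [show N = n + 2 * m by omega, zpow_add₀ (by norm_num), zpow_mul]
    norm_num
  rw [← e, ← mul_zpow, neg_one_mul]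

lemma neg_pow_odd {h : ℂ} {n : ℕ} (hn : Odd n) : (-h) ^ n = -h ^ n := hn.neg_pow h

/-- Each exponent of q^(1/2) is congruent to n modulo 2 and the row difference 6n + 3 is odd.
Passing to the nome -q^(1/2) therefore absorbs both ε^n and the sign between the rows. -/
lemma holTheta_one_fifth {τ : ℂ} (hτ : 0 < τ.im) :
    holTheta (-1) (1 / 5) (1 / 6) τ = 2 * qpow (7 / 120) τ *
      heckeSum (fun n j => 5 * (n : ℤ) ^ 2 + 2 * n - 3 * j ^ 2 - j) (fun n => 6 * n + 3)
        (-qpow (1 / 2) τ) := by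
  have hE : exp (π * I * τ * (5 * ((1 / 5 : ℝ) : ℂ) ^ 2 - 1 / 12)) = qpow (7 / 120) τ := by
    rw [qpow]; push_cast; ring_nf
  rw [holTheta_eq (by norm_num) (by norm_num) (by norm_num) hτ, heckeSum, ← tsum_mul_left]
  refine tsum_congr fun n => ?_
  rw [heckeTerm, Finset.mul_sum]
  refine Finset.sum_congr rfl fun j _ => ?_
  have hev : Even (5 * (n : ℤ) ^ 2 + 2 * n - 3 * j ^ 2 - j - n) := by
    have := even_sub_hecke 5 1 n j (even_five_mul_sq_add n (b := 1) (by decide))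
    rwa [show 5 * (n : ℤ) ^ 2 + 2 * n - 3 * j ^ 2 - j - n = 5 * n ^ 2 + 1 * n - 3 * j ^ 2 - j by
      ring]
  rw [neg_zpow_of_even_sub _ n hev, neg_pow_odd (n := 6 * n + 3) ⟨3 * n + 1, by ring⟩,
    latExp_eq (N := 5 * (n : ℤ) ^ 2 + 2 * n - 3 * j ^ 2 - j) (by push_cast; ring),
    latExp_eq (N := 5 * (n : ℤ) ^ 2 + 2 * n - 3 * j ^ 2 - j + (6 * n + 3 : ℕ)) (by push_cast; ring),
    hE, zpow_add₀ (qpow_ne_zero _ τ), zpow_natCast]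
  ring

lemma holTheta_two_fifths {τ : ℂ} (hτ : 0 < τ.im) :
    holTheta (-1) (2 / 5) (1 / 6) τ = 2 * qpow (43 / 120) τ *
      heckeSum (fun n j => 5 * (n : ℤ) ^ 2 + 4 * n - 3 * j ^ 2 - j) (fun n => 2 * n + 1)
        (-qpow (1 / 2) τ) := by
  have hE : exp (π * I * τ * (5 * ((2 / 5 : ℝ) : ℂ) ^ 2 - 1 / 12)) = qpow (43 / 120) τ := by
    rw [qpow]; push_cast; ring_nf
  rw [holTheta_eq (by norm_num) (by norm_num) (by norm_num) hτ, heckeSum, ← tsum_mul_left]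
  refine tsum_congr fun n => ?_
  rw [heckeTerm, Finset.mul_sum]
  refine Finset.sum_congr rfl fun j _ => ?_
  have hev : Even (5 * (n : ℤ) ^ 2 + 4 * n - 3 * j ^ 2 - j - n) := by
    have := even_sub_hecke 5 3 n j (even_five_mul_sq_add n (b := 3) (by decide))
    rwa [show 5 * (n : ℤ) ^ 2 + 4 * n - 3 * j ^ 2 - j - n = 5 * n ^ 2 + 3 * n - 3 * j ^ 2 - j by
      ring]
  rw [neg_zpow_of_even_sub _ n hev, neg_pow_odd (n := 2 * n + 1) ⟨n, by ring⟩,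
    latExp_eq (N := 5 * (n : ℤ) ^ 2 + 4 * n - 3 * j ^ 2 - j) (by push_cast; ring),
    latExp_eq (N := 5 * (n : ℤ) ^ 2 + 4 * n - 3 * j ^ 2 - j + (2 * n + 1 : ℕ)) (by push_cast; ring),
    hE, zpow_add₀ (qpow_ne_zero _ τ), zpow_natCast]
  ring

/-! ### The decomposition of the mock theta functions -/

lemma eta_two_mul_ne_zero {τ : ℂ} (hτ : 0 < τ.im) : ModularForm.eta (2 * τ) ≠ 0 :=
  eta_ne_zero' (by
    rw [show 2 * τ = ((2 : ℝ) : ℂ) * τ by push_cast; ring, Complex.im_ofReal_mul]; positivity)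

lemma eta_half_ne_zero {τ : ℂ} (hτ : 0 < τ.im) : ModularForm.eta (τ / 2) ≠ 0 :=
  eta_ne_zero' (by
    rw [show τ / 2 = ((1 / 2 : ℝ) : ℂ) * τ by push_cast; ring, Complex.im_ofReal_mul]; positivity)

/-- The identity `hu` is used twice: it cancels the unary factor of the β part and, with the unary
series written out as 1 plus twice the Gauss sum, trades the Gauss terms for the constants 1 and -1
in the definition of ψ₀. -/
lemma psi0_decomposition {τ : ℂ} (hτ : 0 < τ.im) :
    2 * qpow (-1 / 60) τ * psi0 (qpow 1 τ) = compA (1 / 10) τ -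
      (ζ 12 * R (1 / 30) (5 / 2) (30 * τ) + ζ 12 ^ (-1 : ℤ) * R (11 / 30) (5 / 2) (30 * τ)) := by
  have h1 := eta_ne_zero' hτ
  have h2 := eta_two_mul_ne_zero hτ
  have hu : ModularForm.eta (2 * τ) / ModularForm.eta τ ^ 2 * unary (-1) 0 τ = 1 := by
    rw [unary_neg_one_zero hτ]; field_simp
  rw [psi0_eq, psi_prefactor hτ, compA, signTheta_eq (by norm_num) _ _ hτ, holTheta_one_tenth hτ]
  have hn := nonhol_one_tenth hτ
  have hu' := hu
  rw [unary_neg_one_zero_eq_tsum hτ] at hu'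
  linear_combination qpow (-1 / 60) τ * hu' +
    (ModularForm.eta (2 * τ) / ModularForm.eta τ ^ 2) * hn -
    (ζ 12 * R (1 / 30) (5 / 2) (30 * τ) + ζ 12 ^ (-1 : ℤ) * R (11 / 30) (5 / 2) (30 * τ)) * hu

lemma psi1_decomposition {τ : ℂ} (hτ : 0 < τ.im) :
    2 * qpow (11 / 60) τ * psi1 (qpow 1 τ) = compA (3 / 10) τ -
      (ζ 12 * R (13 / 30) (5 / 2) (30 * τ) + ζ 12 ^ (-1 : ℤ) * R (23 / 30) (5 / 2) (30 * τ)) := by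
  have h1 := eta_ne_zero' hτ
  have h2 := eta_two_mul_ne_zero hτ
  have hu : ModularForm.eta (2 * τ) / ModularForm.eta τ ^ 2 * unary (-1) 0 τ = 1 := by
    rw [unary_neg_one_zero hτ]; field_simp
  rw [psi1_eq, psi_prefactor hτ, compA, signTheta_eq (by norm_num) _ _ hτ, holTheta_three_tenths hτ]
  have hn := nonhol_three_tenths hτ
  linear_combination (ModularForm.eta (2 * τ) / ModularForm.eta τ ^ 2) * hn -
    (ζ 12 * R (13 / 30) (5 / 2) (30 * τ) + ζ 12 ^ (-1 : ℤ) * R (23 / 30) (5 / 2) (30 * τ)) * hu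

lemma phi0_decomposition {τ : ℂ} (hτ : 0 < τ.im) :
    qpow (-1 / 240) τ * phi0 (-qpow (1 / 2) τ) = compB (1 / 5) τ -
      1 / 2 * (-R (19 / 60) 0 (30 * τ) - R (29 / 60) 0 (30 * τ) +
        R (49 / 60) 0 (30 * τ) + R (59 / 60) 0 (30 * τ)) := by
  have h1 := eta_ne_zero' hτ
  have h2 := eta_half_ne_zero hτ
  have hu : ModularForm.eta (τ / 2) / ModularForm.eta τ ^ 2 * unary 1 (1 / 4) τ = 1 := by
    rw [unary_one_quarter hτ]; field_simp
  have hp := phi_prefactor hτ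
  have hq : qpow (7 / 120) τ * qpow (-1 / 16) τ = qpow (-1 / 240) τ := by
    rw [← qpow_add]; norm_num
  rw [phi0_eq, neg_neg, neg_sq, compB, signTheta_eq (by norm_num) _ _ hτ, holTheta_one_fifth hτ,
    ← hq]
  have hn := nonhol_one_fifth hτ
  linear_combination (qpow (7 / 120) τ * heckeSum
      (fun n j => 5 * (n : ℤ) ^ 2 + 2 * n - 3 * j ^ 2 - j) (fun n => 6 * n + 3)
        (-qpow (1 / 2) τ)) * hp +
    (ModularForm.eta (τ / 2) / (2 * ModularForm.eta τ ^ 2)) * hn -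
    1 / 2 * (-R (19 / 60) 0 (30 * τ) - R (29 / 60) 0 (30 * τ) +
        R (49 / 60) 0 (30 * τ) + R (59 / 60) 0 (30 * τ)) * hu

lemma phi1_decomposition {τ : ℂ} (hτ : 0 < τ.im) :
    -qpow (-49 / 240) τ * phi1 (-qpow (1 / 2) τ) = compB (2 / 5) τ -
      1 / 2 * (-R (13 / 60) 0 (30 * τ) - R (23 / 60) 0 (30 * τ) +
        R (43 / 60) 0 (30 * τ) + R (53 / 60) 0 (30 * τ)) := by
  have h1 := eta_ne_zero' hτ
  have h2 := eta_half_ne_zero hτ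
  have hu : ModularForm.eta (τ / 2) / ModularForm.eta τ ^ 2 * unary 1 (1 / 4) τ = 1 := by
    rw [unary_one_quarter hτ]; field_simp
  have hp := phi_prefactor hτ
  have hq : qpow (43 / 120) τ * qpow (-1 / 16) τ = qpow (-49 / 240) τ * qpow (1 / 2) τ := by
    rw [← qpow_add, ← qpow_add]; norm_num
  rw [phi1_eq, neg_neg, neg_sq, compB, signTheta_eq (by norm_num) _ _ hτ, holTheta_two_fifths hτ]
  have hn := nonhol_two_fifths hτ
  linear_combination -(heckeSum (fun n j => 5 * (n : ℤ) ^ 2 + 4 * n - 3 * j ^ 2 - j)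
      (fun n => 2 * n + 1) (-qpow (1 / 2) τ) * (qPoch (qpow (1 / 2) τ) (qpow (1 / 2) τ ^ 2) /
      qPoch (qpow (1 / 2) τ ^ 2) (qpow (1 / 2) τ ^ 2))) * hq +
    (qpow (43 / 120) τ * heckeSum
      (fun n j => 5 * (n : ℤ) ^ 2 + 4 * n - 3 * j ^ 2 - j) (fun n => 2 * n + 1)
        (-qpow (1 / 2) τ)) * hp +
    (ModularForm.eta (τ / 2) / (2 * ModularForm.eta τ ^ 2)) * hn -
    1 / 2 * (-R (13 / 60) 0 (30 * τ) - R (23 / 60) 0 (30 * τ) +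
        R (43 / 60) 0 (30 * τ) + R (53 / 60) 0 (30 * τ)) * hu

/-! ### The last two components, by translation -/

lemma R_translate {a : ℝ} {s : ℤ} (ha : 60 * a = 2 * s + 1) (τ : ℂ) :
    R a 0 (30 * (τ + 1)) = exp (π * I * (5 * a - 30 * a ^ 2)) * R a (5 / 2) (30 * τ) := by
  rw [R, R, ← tsum_mul_left]
  refine tsum_congr fun n => ?_
  rw [im_thirty_mul, im_thirty_mul, Complex.add_im, Complex.one_im, add_zero, mul_left_comm (exp _)]
  congr 1
  rw [← Complex.exp_add, Complex.exp_eq_exp_iff_exists_int]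
  have ha' : (60 * a : ℂ) = 2 * s + 1 := by exact_mod_cast congrArg ofReal ha
  refine ⟨-(15 * n ^ 2 + s * n) + 2 * n, ?_⟩
  push_cast
  linear_combination -π * I * n * ha'

lemma qpow_half_add_one (τ : ℂ) : qpow (1 / 2) (τ + 1) = -qpow (1 / 2) τ := by
  rw [qpow, qpow, ← neg_one_mul, ← Complex.exp_pi_mul_I, ← Complex.exp_add]; push_cast; ring_nf

/-- The earlier decomposition at τ + 1: the nome -q^(1/2) becomes q^(1/2), type B becomes type C,
and since 60a is odd each R with b = 0 becomes one with b = 5/2. A common phase is cancelled at the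
end. -/
lemma phi0_decomposition' {τ : ℂ} (hτ : 0 < τ.im) :
    qpow (-1 / 240) τ * phi0 (qpow (1 / 2) τ) = compC (1 / 5) τ -
      1 / 2 * (ζ 24 ^ (-5 : ℤ) * R (19 / 60) (5 / 2) (30 * τ) +
        ζ 24 ^ 5 * R (29 / 60) (5 / 2) (30 * τ) + ζ 24 * R (49 / 60) (5 / 2) (30 * τ) +
        ζ 24 ^ (-1 : ℤ) * R (59 / 60) (5 / 2) (30 * τ)) := by
  have h := phi0_decomposition (τ := τ + 1) (by simpa using hτ)
  have hb := compB_add_one (α := 1 / 5) (exp_pi_odd 1 (by push_cast; ring)) τ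
  have hq : qpow (-1 / 240) (τ + 1) = exp (-(π * I / 120)) * qpow (-1 / 240) τ := by
    rw [qpow, qpow, ← Complex.exp_add]; push_cast; ring_nf
  have e0 : exp (π * I * (5 * ((1 / 5 : ℝ) : ℂ) ^ 2 - 5 / 24)) = exp (-(π * I / 120)) := by
    push_cast; ring_nf
  rw [e0] at hb
  rw [qpow_half_add_one, neg_neg, hq, hb, R_translate (s := 9) (by norm_num),
    R_translate (s := 14) (by norm_num), R_translate (s := 24) (by norm_num),
    R_translate (s := 29) (by norm_num)] at h
  have hne := Complex.exp_ne_zero (-(π * I / 120))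
  have e1 : -exp (π * I * (5 * ((19 / 60 : ℝ) : ℂ) - 30 * ((19 / 60 : ℝ) : ℂ) ^ 2)) =
      exp (-(π * I / 120)) * ζ 24 ^ (-5 : ℤ) := by
    rw [ζ, ← Complex.exp_int_mul, ← Complex.exp_add, ← neg_one_mul, ← Complex.exp_pi_mul_I,
      ← Complex.exp_add, Complex.exp_eq_exp_iff_exists_int]
    exact ⟨0, by push_cast; ring⟩
  have e2 : -exp (π * I * (5 * ((29 / 60 : ℝ) : ℂ) - 30 * ((29 / 60 : ℝ) : ℂ) ^ 2)) =
      exp (-(π * I / 120)) * ζ 24 ^ 5 := by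
    rw [ζ, ← Complex.exp_nat_mul, ← Complex.exp_add, ← neg_one_mul, ← Complex.exp_pi_mul_I,
      ← Complex.exp_add, Complex.exp_eq_exp_iff_exists_int]
    exact ⟨-2, by push_cast; ring⟩
  have e3 : exp (π * I * (5 * ((49 / 60 : ℝ) : ℂ) - 30 * ((49 / 60 : ℝ) : ℂ) ^ 2)) =
      exp (-(π * I / 120)) * ζ 24 := by
    rw [ζ, ← Complex.exp_add, Complex.exp_eq_exp_iff_exists_int]
    exact ⟨-8, by push_cast; ring⟩
  have e4 : exp (π * I * (5 * ((59 / 60 : ℝ) : ℂ) - 30 * ((59 / 60 : ℝ) : ℂ) ^ 2)) =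
      exp (-(π * I / 120)) * ζ 24 ^ (-1 : ℤ) := by
    rw [ζ, ← Complex.exp_int_mul, ← Complex.exp_add, Complex.exp_eq_exp_iff_exists_int]
    exact ⟨-12, by push_cast; ring⟩
  refine mul_left_cancel₀ hne ?_
  linear_combination h - 1 / 2 * R (19 / 60) (5 / 2) (30 * τ) * e1 -
    1 / 2 * R (29 / 60) (5 / 2) (30 * τ) * e2 - 1 / 2 * R (49 / 60) (5 / 2) (30 * τ) * e3 -
    1 / 2 * R (59 / 60) (5 / 2) (30 * τ) * e4

lemma phi1_decomposition' {τ : ℂ} (hτ : 0 < τ.im) :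
    qpow (-49 / 240) τ * phi1 (qpow (1 / 2) τ) = compC (2 / 5) τ -
      1 / 2 * (ζ 24 * R (13 / 60) (5 / 2) (30 * τ) +
        ζ 24 ^ (-1 : ℤ) * R (23 / 60) (5 / 2) (30 * τ) +
        ζ 24 ^ (-5 : ℤ) * R (43 / 60) (5 / 2) (30 * τ) +
        ζ 24 ^ 5 * R (53 / 60) (5 / 2) (30 * τ)) := by
  have h := phi1_decomposition (τ := τ + 1) (by simpa using hτ)
  have hb := compB_add_one (α := 2 / 5) (exp_pi_odd 2 (by push_cast; ring)) τ
  have hq : -qpow (-49 / 240) (τ + 1) = exp (71 * (π * I / 120)) * qpow (-49 / 240) τ := by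
    rw [qpow, qpow, ← Complex.exp_add, ← neg_one_mul, ← Complex.exp_pi_mul_I, ← Complex.exp_add]
    push_cast; ring_nf
  have e0 : exp (π * I * (5 * ((2 / 5 : ℝ) : ℂ) ^ 2 - 5 / 24)) = exp (71 * (π * I / 120)) := by
    push_cast; ring_nf
  rw [e0] at hb
  rw [qpow_half_add_one, neg_neg, hq, hb, R_translate (s := 6) (by norm_num),
    R_translate (s := 11) (by norm_num), R_translate (s := 21) (by norm_num),
    R_translate (s := 26) (by norm_num)] at h
  have hne := Complex.exp_ne_zero (71 * (π * I / 120))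
  have e1 : -exp (π * I * (5 * ((13 / 60 : ℝ) : ℂ) - 30 * ((13 / 60 : ℝ) : ℂ) ^ 2)) =
      exp (71 * (π * I / 120)) * ζ 24 := by
    rw [ζ, ← Complex.exp_add, ← neg_one_mul, ← Complex.exp_pi_mul_I,
      ← Complex.exp_add, Complex.exp_eq_exp_iff_exists_int]
    exact ⟨0, by push_cast; ring⟩
  have e2 : -exp (π * I * (5 * ((23 / 60 : ℝ) : ℂ) - 30 * ((23 / 60 : ℝ) : ℂ) ^ 2)) =
      exp (71 * (π * I / 120)) * ζ 24 ^ (-1 : ℤ) := by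
    rw [ζ, ← Complex.exp_int_mul, ← Complex.exp_add, ← neg_one_mul, ← Complex.exp_pi_mul_I,
      ← Complex.exp_add, Complex.exp_eq_exp_iff_exists_int]
    exact ⟨-1, by push_cast; ring⟩
  have e3 : exp (π * I * (5 * ((43 / 60 : ℝ) : ℂ) - 30 * ((43 / 60 : ℝ) : ℂ) ^ 2)) =
      exp (71 * (π * I / 120)) * ζ 24 ^ (-5 : ℤ) := by
    rw [ζ, ← Complex.exp_int_mul, ← Complex.exp_add, Complex.exp_eq_exp_iff_exists_int]
    exact ⟨-6, by push_cast; ring⟩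
  have e4 : exp (π * I * (5 * ((53 / 60 : ℝ) : ℂ) - 30 * ((53 / 60 : ℝ) : ℂ) ^ 2)) =
      exp (71 * (π * I / 120)) * ζ 24 ^ 5 := by
    rw [ζ, ← Complex.exp_nat_mul, ← Complex.exp_add, Complex.exp_eq_exp_iff_exists_int]
    exact ⟨-10, by push_cast; ring⟩
  refine mul_left_cancel₀ hne ?_
  linear_combination h - 1 / 2 * R (13 / 60) (5 / 2) (30 * τ) * e1 -
    1 / 2 * R (23 / 60) (5 / 2) (30 * τ) * e2 - 1 / 2 * R (43 / 60) (5 / 2) (30 * τ) * e3 -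
    1 / 2 * R (53 / 60) (5 / 2) (30 * τ) * e4

/-- The decomposition of `F_{5,2}`. -/
lemma F52_eq_add {τ : ℂ} (hτ : 0 < τ.im) : F52 τ = H52 τ + G52 τ := by
  rw [F52, psi0_decomposition hτ, psi1_decomposition hτ, phi0_decomposition hτ,
    phi1_decomposition hτ, phi0_decomposition' hτ, phi1_decomposition' hτ, H52_eq, G52, unaryVec]
  ext i
  fin_cases i <;> simp <;> ring

/-! ### The holomorphic extension of `β` -/

/-- The Laplace integral whose product with `√z` extends `β`. -/
def laplaceInt (z : ℂ) : ℂ := ∫ u in Set.Ioi (1 : ℝ), ((u ^ (-1 / 2 : ℝ) : ℝ) : ℂ) * exp (-π * z * u)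

/-- The holomorphic extension of `β` to the right half-plane. -/
def betaC (z : ℂ) : ℂ := z ^ (1 / 2 : ℂ) * laplaceInt z

lemma laplace_real {x : ℝ} (hx : 0 < x) :
    ∫ u in Set.Ioi (1 : ℝ), u ^ (-1 / 2 : ℝ) * Real.exp (-π * x * u) = (√x)⁻¹ * β x := by
  have h := integral_comp_mul_left_Ioi betaIntegrand 1 hx
  have h1 : ∀ u ∈ Set.Ioi (1 : ℝ), betaIntegrand (x * u) =
      (√x)⁻¹ * (u ^ (-1 / 2 : ℝ) * Real.exp (-π * x * u)) := by
    intro u hu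
    have hu0 : 0 ≤ u := zero_le_one.trans (Set.mem_Ioi.mp hu).le
    rw [betaIntegrand, Real.mul_rpow hx.le hu0, Real.sqrt_eq_rpow, ← Real.rpow_neg hx.le]
    ring_nf
  rw [setIntegral_congr_fun measurableSet_Ioi h1, integral_const_mul, mul_one, smul_eq_mul] at h
  have hs : √x ≠ 0 := (Real.sqrt_pos.mpr hx).ne'
  have h2 : x⁻¹ = (√x)⁻¹ * (√x)⁻¹ := by rw [← mul_inv, Real.mul_self_sqrt hx.le]
  rw [h2, mul_assoc] at h
  exact mul_left_cancel₀ (inv_ne_zero hs) h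

lemma betaC_ofReal {x : ℝ} (hx : 0 < x) : betaC x = β x := by
  have h1 : laplaceInt x = (((√x)⁻¹ * β x : ℝ) : ℂ) := by
    rw [← laplace_real hx, laplaceInt, ← integral_complex_ofReal]
    congr 1
    ext u
    push_cast
    rfl
  have h2 : (x : ℂ) ^ (1 / 2 : ℂ) = (√x : ℝ) := by
    rw [Real.sqrt_eq_rpow, Complex.ofReal_cpow hx.le]; push_cast; rfl
  have hs : (√x : ℂ) ≠ 0 := by exact_mod_cast (Real.sqrt_pos.mpr hx).ne'
  rw [betaC, h1, h2]
  push_cast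
  field_simp

lemma norm_cpow_half (z : ℂ) : ‖z ^ (1 / 2 : ℂ)‖ = √‖z‖ := by
  have h : ‖z ^ (1 / 2 : ℂ)‖ ^ 2 = ‖z‖ := by
    have := Complex.cpow_nat_inv_pow z two_ne_zero
    rw [Nat.cast_ofNat, ← one_div] at this
    rw [← norm_pow, this]
  rw [← h, Real.sqrt_sq (norm_nonneg _)]

lemma norm_laplace_integrand {z : ℂ} {u : ℝ} (hu : 0 ≤ u) :
    ‖((u ^ (-1 / 2 : ℝ) : ℝ) : ℂ) * exp (-π * z * u)‖ =
      u ^ (-1 / 2 : ℝ) * Real.exp (-π * z.re * u) := by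
  rw [norm_mul, Complex.norm_real, Real.norm_of_nonneg (Real.rpow_nonneg hu _), Complex.norm_exp]
  congr 2
  rw [show (-π * z * u : ℂ) = ((-π * u : ℝ) : ℂ) * z by push_cast; ring, Complex.re_ofReal_mul]
  ring

lemma norm_laplaceInt_le {z : ℂ} (hz : 0 < z.re) : ‖laplaceInt z‖ ≤ (√z.re)⁻¹ * β z.re := by
  rw [← laplace_real hz]
  refine (norm_integral_le_integral_norm _).trans_eq ?_
  exact setIntegral_congr_fun measurableSet_Ioi fun u hu =>
    norm_laplace_integrand (zero_le_one.trans (Set.mem_Ioi.mp hu).le)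

lemma norm_betaC_le {z : ℂ} (hz : 0 < z.re) :
    ‖betaC z‖ ≤ √(‖z‖ / z.re) * Real.exp (-π * z.re) := by
  rw [betaC, norm_mul, norm_cpow_half, Real.sqrt_div (norm_nonneg _), div_eq_mul_inv, mul_assoc]
  refine mul_le_mul_of_nonneg_left ((norm_laplaceInt_le hz).trans ?_) (Real.sqrt_nonneg _)
  exact mul_le_mul_of_nonneg_left (beta_le_exp hz.le) (by positivity)

lemma integrableOn_laplace (s : ℝ) (hs : -1 < s) {b : ℝ} (hb : 0 < b) :
    IntegrableOn (fun u : ℝ => u ^ s * Real.exp (-b * u)) (Set.Ioi 1) := by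
  have := integrableOn_rpow_mul_exp_neg_mul_rpow (p := 1) (s := s) hs one_pos hb
  simp only [Real.rpow_one] at this
  exact this.mono_set (Set.Ioi_subset_Ioi zero_le_one)

/-- Differentiation under the integral: on the disc of radius Re z / 2 the real part stays at least
Re z / 2, which dominates the factor πu of the derivative. -/
lemma differentiableAt_laplaceInt {z : ℂ} (hz : 0 < z.re) : DifferentiableAt ℂ laplaceInt z := by
  have hb : 0 < π * (z.re / 2) := by positivity
  have hmeas : ∀ w : ℂ, AEStronglyMeasurable
      (fun u : ℝ => ((u ^ (-1 / 2 : ℝ) : ℝ) : ℂ) * exp (-π * w * u)) (volume.restrict (Set.Ioi 1)) :=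
    fun w => by fun_prop
  have h := hasDerivAt_integral_of_dominated_loc_of_deriv_le (𝕜 := ℂ)
    (μ := volume.restrict (Set.Ioi (1 : ℝ)))
    (F := fun w (u : ℝ) => ((u ^ (-1 / 2 : ℝ) : ℝ) : ℂ) * exp (-π * w * u))
    (F' := fun w (u : ℝ) => ((u ^ (-1 / 2 : ℝ) : ℝ) : ℂ) * (exp (-π * w * u) * (-π * u)))
    (x₀ := z) (s := Metric.ball z (z.re / 2))
    (bound := fun u => π * (u ^ (1 / 2 : ℝ) * Real.exp (-(π * (z.re / 2)) * u)))
    (Metric.ball_mem_nhds _ (by positivity)) (Eventually.of_forall hmeas) ?_ (by fun_prop) ?_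
    ((integrableOn_laplace (1 / 2) (by norm_num) hb).const_mul π) ?_
  · exact h.2.differentiableAt
  · refine Integrable.mono' (integrableOn_laplace (-1 / 2) (by norm_num)
      (b := π * z.re) (by positivity)) (hmeas z) ?_
    refine (ae_restrict_mem measurableSet_Ioi).mono fun u hu => ?_
    rw [norm_laplace_integrand (zero_le_one.trans (Set.mem_Ioi.mp hu).le), neg_mul]
  · refine (ae_restrict_mem measurableSet_Ioi).mono fun u hu w hw => ?_
    have hu0 : 0 < u := zero_lt_one.trans (Set.mem_Ioi.mp hu)
    have hre : z.re / 2 ≤ w.re := by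
      have h1 : |(w - z).re| ≤ ‖w - z‖ := Complex.abs_re_le_norm _
      have h2 : ‖w - z‖ < z.re / 2 := by rwa [← dist_eq_norm]
      have h3 := (abs_lt.mp (h1.trans_lt h2)).1
      rw [Complex.sub_re] at h3
      linarith
    rw [← mul_assoc, norm_mul, norm_laplace_integrand hu0.le, norm_mul, norm_neg, Complex.norm_real,
      Complex.norm_real, Real.norm_of_nonneg Real.pi_pos.le, Real.norm_of_nonneg hu0.le,
      show (1 / 2 : ℝ) = -1 / 2 + 1 by norm_num, Real.rpow_add_one hu0.ne']
    have h4 : Real.exp (-π * w.re * u) ≤ Real.exp (-(π * (z.re / 2)) * u) := by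
      refine Real.exp_le_exp.mpr ?_
      have := mul_le_mul_of_nonneg_left hre (mul_pos Real.pi_pos hu0).le
      linarith
    have h5 : 0 ≤ u ^ (-1 / 2 : ℝ) * (π * u) := by positivity
    linarith [mul_le_mul_of_nonneg_left h4 h5]
  · refine (ae_restrict_mem measurableSet_Ioi).mono fun u _ w _ => ?_
    refine HasDerivAt.const_mul _ (HasDerivAt.cexp ?_)
    simpa using ((hasDerivAt_id w).const_mul (-π : ℂ)).mul_const (u : ℂ)

lemma differentiableAt_betaC {z : ℂ} (hz : 0 < z.re) : DifferentiableAt ℂ betaC z :=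
  (differentiableAt_id.cpow_const (Or.inl hz)).mul (differentiableAt_laplaceInt hz)

/-! ### Analyticity of separated series -/

section Separated

variable {ι : Type*} {e h : ι → ℂ → ℂ} {U V : Set ℂ} {W u v : ι → ℝ} {x₀ y₀ : ℂ}

/-- The series is the pairing of an ℓ²-valued function Y of y with a function X of x valued in
functionals on ℓ². Each is holomorphic in its single variable by uniform convergence, and a
continuous bilinear map of analytic functions is jointly analytic. The weights W move growth of e
onto the decay of h. -/
lemma analyticAt_tsum_mul (hU : IsOpen U) (hV : IsOpen V) (hx : x₀ ∈ U) (hy : y₀ ∈ V)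
    (he : ∀ i, DifferentiableOn ℂ (e i) U) (hh : ∀ i, DifferentiableOn ℂ (h i) V)
    (hW : ∀ i, 0 < W i) (hu : Summable u) (hv : Summable v)
    (hue : ∀ i, ∀ x ∈ U, ‖e i x‖ ≤ W i * u i) (hvh : ∀ i, ∀ y ∈ V, ‖h i y‖ * W i ≤ v i) :
    AnalyticAt ℂ (fun p : ℂ × ℂ => ∑' i, e i p.1 * h i p.2) (x₀, y₀) := by
  classical
  let Y : ℂ → lp (fun _ : ι => ℂ) 2 := fun y => ∑' i, (h i y * W i) • lp.single 2 i (1 : ℂ)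
  let X : ℂ → (lp (fun _ : ι => ℂ) 2 →L[ℂ] ℂ) := fun x =>
    ∑' i, (e i x / W i) • lp.evalCLM ℂ (fun _ : ι => ℂ) 2 i
  have hWn : ∀ i, ‖((W i : ℝ) : ℂ)‖ = W i := fun i => by
    rw [Complex.norm_real, Real.norm_of_nonneg (hW i).le]
  have hY1 : ∀ i, ∀ y ∈ V, ‖(h i y * W i) • (lp.single 2 i (1 : ℂ) : lp (fun _ : ι => ℂ) 2)‖ ≤ v i := by
    intro i y hy
    rw [norm_smul, lp.norm_single (by norm_num), norm_one, mul_one, norm_mul, hWn]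
    exact hvh i y hy
  have hev : ∀ i, ‖lp.evalCLM ℂ (fun _ : ι => ℂ) 2 i‖ ≤ 1 := fun i =>
    LinearMap.mkContinuous_norm_le _ zero_le_one _
  have hX1 : ∀ i, ∀ x ∈ U, ‖(e i x / W i) • lp.evalCLM ℂ (fun _ : ι => ℂ) 2 i‖ ≤ u i := by
    intro i x hx
    rw [norm_smul, norm_div, hWn]
    have h1 : ‖e i x‖ / W i ≤ u i := by
      rw [div_le_iff₀ (hW i), mul_comm]; exact hue i x hx
    calc _ ≤ ‖e i x‖ / W i * 1 :=
          mul_le_mul_of_nonneg_left (hev i) (div_nonneg (norm_nonneg _) (hW i).le)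
      _ ≤ u i := by rwa [mul_one]
  have hYd : DifferentiableOn ℂ Y V :=
    differentiableOn_tsum_of_summable_norm hv
      (fun i => ((hh i).mul_const _).smul_const _) hV hY1
  have hXd : DifferentiableOn ℂ X U :=
    differentiableOn_tsum_of_summable_norm hu
      (fun i => ((he i).div_const _).smul_const _) hU hX1
  have hYa : AnalyticAt ℂ Y y₀ := hYd.analyticAt (hV.mem_nhds hy)
  have hXa : AnalyticAt ℂ X x₀ := hXd.analyticAt (hU.mem_nhds hx)
  have hb := (ContinuousLinearMap.id ℂ (lp (fun _ : ι => ℂ) 2 →L[ℂ] ℂ)).analyticAt_bilinear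
    (X x₀, Y y₀)
  have hA : AnalyticAt ℂ (fun p : ℂ × ℂ => X p.1 (Y p.2)) (x₀, y₀) :=
    AnalyticAt.comp₂ (h := fun q : (lp (fun _ : ι => ℂ) 2 →L[ℂ] ℂ) × lp (fun _ : ι => ℂ) 2 => q.1 q.2)
      (f := fun p : ℂ × ℂ => X p.1) (g := fun p : ℂ × ℂ => Y p.2) hb
      (hXa.comp_of_eq analyticAt_fst rfl) (hYa.comp_of_eq analyticAt_snd rfl)
  refine hA.congr ?_
  filter_upwards [(hU.prod hV).mem_nhds (Set.mk_mem_prod hx hy)] with p hp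
  obtain ⟨h1, h2⟩ := hp
  have sY : Summable fun i => (h i p.2 * W i) • (lp.single 2 i (1 : ℂ) : lp (fun _ : ι => ℂ) 2) :=
    Summable.of_norm_bounded hv fun i => hY1 i _ h2
  have sX : Summable fun i => (e i p.1 / W i) • lp.evalCLM ℂ (fun _ : ι => ℂ) 2 i :=
    Summable.of_norm_bounded hu fun i => hX1 i _ h1
  have hXs : ∀ i, X p.1 (lp.single 2 i (1 : ℂ)) = e i p.1 / W i := by
    intro i
    have := (ContinuousLinearMap.apply ℂ ℂ (lp.single 2 i (1 : ℂ) : lp (fun _ : ι => ℂ) 2)).map_tsum sX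
    change _ = _ at this
    refine this.trans ((tsum_eq_single i fun j hj => ?_).trans ?_)
    · change (e j p.1 / W j) * (lp.single 2 i (1 : ℂ) : lp (fun _ : ι => ℂ) 2) j = 0
      rw [lp.single_apply, Pi.single_eq_of_ne hj, mul_zero]
    · change (e i p.1 / W i) * (lp.single 2 i (1 : ℂ) : lp (fun _ : ι => ℂ) 2) i = _
      rw [lp.single_apply, Pi.single_eq_same, mul_one]
  have h3 := (X p.1).map_tsum sY
  change X p.1 (Y p.2) = _
  rw [h3]
  refine tsum_congr fun i => ?_
  rw [map_smul, hXs, smul_eq_mul]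
  have : (W i : ℂ) ≠ 0 := by exact_mod_cast (hW i).ne'
  field_simp

/-- Restriction to the two coordinate lines reduces the partial derivatives to termwise
differentiation in one variable. -/
lemma hasSum_fderiv_tsum_mul (hU : IsOpen U) (hV : IsOpen V) (hx : x₀ ∈ U) (hy : y₀ ∈ V)
    (he : ∀ i, DifferentiableOn ℂ (e i) U) (hh : ∀ i, DifferentiableOn ℂ (h i) V)
    (hW : ∀ i, 0 < W i) (hu : Summable u) (hv : Summable v)
    (hue : ∀ i, ∀ x ∈ U, ‖e i x‖ ≤ W i * u i) (hvh : ∀ i, ∀ y ∈ V, ‖h i y‖ * W i ≤ v i) :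
    HasSum (fun i => deriv (e i) x₀ * h i y₀)
      (fderiv ℂ (fun p : ℂ × ℂ => ∑' i, e i p.1 * h i p.2) (x₀, y₀) (1, 0)) ∧
    HasSum (fun i => e i x₀ * deriv (h i) y₀)
      (fderiv ℂ (fun p : ℂ × ℂ => ∑' i, e i p.1 * h i p.2) (x₀, y₀) (0, 1)) := by
  have hA := (analyticAt_tsum_mul hU hV hx hy he hh hW hu hv hue hvh).differentiableAt.hasFDerivAt
  have hb : ∀ i, ∀ x ∈ U, ∀ y ∈ V, ‖e i x * h i y‖ ≤ u i * v i := by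
    intro i x hx y hy
    rw [norm_mul]
    have h1 := hue i x hx
    have h2 := hvh i y hy
    have h3 : 0 ≤ u i := by
      have := (norm_nonneg _).trans h1
      exact nonneg_of_mul_nonneg_right this (hW i)
    calc ‖e i x‖ * ‖h i y‖ ≤ W i * u i * ‖h i y‖ := mul_le_mul_of_nonneg_right h1 (norm_nonneg _)
      _ = u i * (‖h i y‖ * W i) := by ring
      _ ≤ _ := mul_le_mul_of_nonneg_left h2 h3
  have hu0 : ∀ i, 0 ≤ u i := fun i =>
    nonneg_of_mul_nonneg_right ((norm_nonneg _).trans (hue i _ hx)) (hW i)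
  have hv0 : ∀ i, 0 ≤ v i := fun i =>
    (mul_nonneg (norm_nonneg _) (hW i).le).trans (hvh i _ hy)
  have huv : Summable fun i => u i * v i := by
    refine (hu.mul_of_nonneg hv hu0 hv0).comp_injective (i := fun i => (i, i)) ?_
    intro i j hij
    exact (Prod.mk.inj hij).1
  constructor
  · have h1 := hasSum_deriv_of_summable_norm (F := fun i x => e i x * h i y₀) huv
      (fun i => (he i).mul_const _) hU (fun i x hx => hb i x hx y₀ hy) hx
    have hl : HasDerivAt (fun x : ℂ => (x, y₀)) ((1 : ℂ), (0 : ℂ)) x₀ :=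
      (hasDerivAt_id x₀).prodMk (hasDerivAt_const x₀ y₀)
    have h2 := (hA.comp_hasDerivAt x₀ hl).deriv
    rw [← h2]
    refine h1.congr_fun fun i => ?_
    rw [deriv_mul_const_field]
  · have h1 := hasSum_deriv_of_summable_norm (F := fun i y => e i x₀ * h i y) huv
      (fun i => (hh i).const_mul _) hV (fun i y hy => hb i x₀ hx y hy) hy
    have hl : HasDerivAt (fun y : ℂ => (x₀, y)) ((0 : ℂ), (1 : ℂ)) y₀ :=
      (hasDerivAt_const y₀ x₀).prodMk (hasDerivAt_id y₀)
    have h2 := (hA.comp_hasDerivAt y₀ hl).deriv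
    rw [← h2]
    refine h1.congr_fun fun i => ?_
    rw [deriv_const_mul_field]

end Separated

/-! ### Functions with antiholomorphic image under the lowering operator -/

/-- `f` is real-analytic on the upper half-plane and `√y ∂f/∂τ̄` is antiholomorphic. -/
def HasShadow (f : ℂ → ℂ) : Prop :=
  AnalyticOnNhd ℝ f {τ : ℂ | 0 < τ.im} ∧ ∃ g : ℂ → ℂ, DifferentiableOn ℂ g {τ : ℂ | 0 < τ.im} ∧
    ∀ τ : ℂ, 0 < τ.im → dTauBar f τ = (√τ.im : ℂ)⁻¹ * (starRingEnd ℂ) (g τ)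

/-- A complex derivative at a real point is determined by the restriction to the real line, where
`betaC` is β. -/
lemma hasDerivAt_betaC {x : ℝ} (hx : 0 < x) : HasDerivAt betaC (-(betaIntegrand x : ℂ)) x := by
  have h1 : HasDerivAt betaC (deriv betaC x) x :=
    (differentiableAt_betaC (z := (x : ℂ)) (by simpa using hx)).hasDerivAt
  have h2 := h1.comp_ofReal
  have h3 : HasDerivAt (fun t : ℝ => ((β t : ℝ) : ℂ)) ((-betaIntegrand x : ℝ) : ℂ) x :=
    (hasDerivAt_beta hx).ofReal_comp
  have h4 : (fun t : ℝ => betaC t) =ᶠ[𝓝 x] fun t : ℝ => ((β t : ℝ) : ℂ) := by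
    filter_upwards [lt_mem_nhds hx] with t ht
    exact betaC_ofReal ht
  have h5 := h2.unique (h3.congr_of_eventuallyEq h4)
  rw [h5] at h1
  simpa using h1

/-- The dependence on `x` of the terms of `R a b (30 * (x + iy))`. -/
def termX (b ν : ℝ) (x : ℂ) : ℂ := exp (-(30 * π * I * ν ^ 2 * x) - 2 * π * I * ν * b)

/-- The dependence on `y` of the terms of `R a b (30 * (x + iy))`. -/
def termY (ν : ℝ) (y : ℂ) : ℂ :=
  (Real.sign ν : ℂ) * (betaC (60 * ν ^ 2 * y) * exp (30 * π * ν ^ 2 * y))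

/-- Real and imaginary part of τ are separated so that each can be made complex. The growth
exp(30πν²y) is harmless, because β(60ν²y) ≤ exp(-60πν²y). -/
lemma R_eq_tsum (a b : ℝ) {τ : ℂ} (hτ : 0 < τ.im) :
    R a b (30 * τ) = ∑' n : ℤ, termX b (a + n) τ.re * termY (a + n) τ.im := by
  rw [R]
  refine tsum_congr fun n => ?_
  rw [im_thirty_mul]
  rcases eq_or_ne (a + n) 0 with h | h
  · rw [h, termY]; simp
  · have hp : 0 < 60 * (a + n) ^ 2 * τ.im := by positivity
    have h1 := betaC_ofReal hp
    push_cast at h1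
    have h2 : exp (-π * I * (a + n) ^ 2 * (30 * τ) - 2 * π * I * (a + n) * b) =
        exp (-(30 * π * I * (a + n) ^ 2 * τ.re) - 2 * π * I * (a + n) * b) *
          exp (30 * π * (a + n) ^ 2 * τ.im) := by
      rw [← Complex.exp_add]
      congr 1
      nth_rewrite 1 [← Complex.re_add_im τ]
      linear_combination (-(30 * π * (a + n) ^ 2 * τ.im : ℂ)) * I_sq
    rw [termX, termY, h2]
    push_cast
    rw [h1, show 2 * (a + n) ^ 2 * (30 * τ.im) = 60 * (a + n) ^ 2 * τ.im by ring]
    ring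

lemma differentiable_termX (b ν : ℝ) : Differentiable ℂ (termX b ν) := by
  unfold termX; fun_prop

lemma re_sixty_mul (ν : ℝ) (y : ℂ) : (60 * ν ^ 2 * y : ℂ).re = 60 * ν ^ 2 * y.re := by
  rw [show (60 * ν ^ 2 * y : ℂ) = ((60 * ν ^ 2 : ℝ) : ℂ) * y by push_cast; ring,
    Complex.re_ofReal_mul]

lemma differentiableAt_termY (ν : ℝ) {y : ℂ} (hy : 0 < y.re) : DifferentiableAt ℂ (termY ν) y := by
  rcases eq_or_ne ν 0 with h | h
  · have : termY ν = fun _ => 0 := by ext; rw [termY, h]; simp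
    rw [this]; exact differentiableAt_const _
  · have h1 : DifferentiableAt ℂ betaC (60 * ν ^ 2 * y) :=
      differentiableAt_betaC (by rw [re_sixty_mul]; positivity)
    exact ((h1.comp y (differentiableAt_id.const_mul _)).mul (by fun_prop)).const_mul _

lemma norm_termX (b ν : ℝ) (x : ℂ) : ‖termX b ν x‖ = Real.exp (30 * π * ν ^ 2 * x.im) := by
  rw [termX, Complex.norm_exp]
  congr 1
  rw [show (-(30 * π * I * ν ^ 2 * x) - 2 * π * I * ν * b : ℂ) =
    ((-(30 * π * ν ^ 2) : ℝ) : ℂ) * (I * x) + ((-(2 * π * ν * b) : ℝ) : ℂ) * I by push_cast; ring,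
    Complex.add_re, Complex.re_ofReal_mul, Complex.re_ofReal_mul, Complex.I_mul_re, Complex.I_re]
  ring

lemma norm_termY_le (ν : ℝ) {y : ℂ} (hy : 0 < y.re) (h3 : ‖y‖ ≤ 3 * y.re) :
    ‖termY ν y‖ ≤ √3 * Real.exp (-(30 * π * ν ^ 2 * y.re)) := by
  rcases eq_or_ne ν 0 with h | h
  · rw [h, termY]; simp
  · have hz : 0 < (60 * ν ^ 2 * y : ℂ).re := by rw [re_sixty_mul]; positivity
    have h1 := norm_betaC_le hz
    have h2 : ‖(60 * ν ^ 2 * y : ℂ)‖ / (60 * ν ^ 2 * y : ℂ).re ≤ 3 := by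
      rw [div_le_iff₀ hz, re_sixty_mul,
        show (60 * ν ^ 2 * y : ℂ) = ((60 * ν ^ 2 : ℝ) : ℂ) * y by push_cast; ring, norm_mul,
        Complex.norm_real, Real.norm_of_nonneg (by positivity)]
      have : 0 ≤ 60 * ν ^ 2 := by positivity
      linarith [mul_le_mul_of_nonneg_left h3 this]
    have h4 : ‖(Real.sign ν : ℂ)‖ ≤ 1 := by
      rw [Complex.norm_real]; exact abs_sign_le_one ν
    have h5 : ‖exp (30 * π * ν ^ 2 * y)‖ = Real.exp (30 * π * ν ^ 2 * y.re) := by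
      rw [Complex.norm_exp, show (30 * π * ν ^ 2 * y : ℂ) = ((30 * π * ν ^ 2 : ℝ) : ℂ) * y by
        push_cast; ring, Complex.re_ofReal_mul]
    rw [termY, norm_mul, norm_mul, h5]
    calc _ ≤ 1 * (√3 * Real.exp (-π * (60 * ν ^ 2 * y : ℂ).re) *
          Real.exp (30 * π * ν ^ 2 * y.re)) := by
          refine mul_le_mul h4 (mul_le_mul_of_nonneg_right (h1.trans ?_) (Real.exp_pos _).le)
            (by positivity) zero_le_one
          exact mul_le_mul_of_nonneg_right (Real.sqrt_le_sqrt h2) (Real.exp_pos _).le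
      _ = _ := by
          rw [one_mul, mul_assoc, ← Real.exp_add, re_sixty_mul]
          ring_nf

lemma hasDerivAt_termX (b ν : ℝ) (x : ℂ) :
    HasDerivAt (termX b ν) (termX b ν x * (-(30 * π * I * ν ^ 2))) x := by
  have h : HasDerivAt (fun x : ℂ => -(30 * π * I * ν ^ 2 * x) - 2 * π * I * ν * b)
      (-(30 * π * I * ν ^ 2)) x := by
    simpa using (((hasDerivAt_id x).const_mul (30 * π * I * ν ^ 2 : ℂ)).neg).sub_const
      (2 * π * I * ν * b)
  exact h.cexp

/-- The part proportional to `termY` will cancel in ∂/∂τ̄; the part coming from β' carries y^(-1/2)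
and yields the shadow. -/
lemma hasDerivAt_termY (ν : ℝ) {y : ℝ} (hy : 0 < y) :
    HasDerivAt (termY ν) (30 * π * ν ^ 2 * termY ν y - (√y : ℂ)⁻¹ * (60 / √60) * ν *
      exp (-(30 * π * ν ^ 2 * y))) y := by
  rcases eq_or_ne ν 0 with h | h
  · have : termY ν = fun _ => 0 := by ext; rw [termY, h]; simp
    rw [this, h]
    simpa using hasDerivAt_const (y : ℂ) (0 : ℂ)
  · have hp : 0 < 60 * ν ^ 2 * y := by positivity
    have h1 := hasDerivAt_betaC hp
    have h2 : HasDerivAt (fun y : ℂ => (60 * ν ^ 2 * y : ℂ)) (60 * ν ^ 2) y := by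
      simpa using (hasDerivAt_id (y : ℂ)).const_mul (60 * ν ^ 2 : ℂ)
    have h3 : HasDerivAt (fun y : ℂ => exp (30 * π * ν ^ 2 * y))
        (exp (30 * π * ν ^ 2 * y) * (30 * π * ν ^ 2)) y := by
      have : HasDerivAt (fun y : ℂ => (30 * π * ν ^ 2 * y : ℂ)) (30 * π * ν ^ 2) y := by
        simpa using (hasDerivAt_id (y : ℂ)).const_mul (30 * π * ν ^ 2 : ℂ)
      exact this.cexp
    push_cast at h1
    have h4 := ((h1.comp (y : ℂ) h2).mul h3).const_mul (Real.sign ν : ℂ)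
    refine h4.congr_deriv ?_
    have h5 : Real.sign ν * (60 * ν ^ 2) * betaIntegrand (60 * ν ^ 2 * y) =
        (√y)⁻¹ * (60 / √60) * ν * Real.exp (-(60 * π * ν ^ 2 * y)) := by
      have e1 : (60 * ν ^ 2 * y) ^ (-1 / 2 : ℝ) = (√60 * |ν| * √y)⁻¹ := by
        rw [show (-1 / 2 : ℝ) = -(1 / 2) by norm_num, Real.rpow_neg hp.le, ← Real.sqrt_eq_rpow,
          Real.sqrt_mul (by positivity), Real.sqrt_mul (by norm_num), Real.sqrt_sq_eq_abs]
      have e2 : Real.sign ν * ν ^ 2 = ν * |ν| := by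
        rcases lt_or_gt_of_ne h with h | h
        · rw [Real.sign_of_neg h, abs_of_neg h]; ring
        · rw [Real.sign_of_pos h, abs_of_pos h]; ring
      have e3 : |ν| ≠ 0 := abs_ne_zero.mpr h
      have e4 : √y ≠ 0 := (Real.sqrt_pos.mpr hy).ne'
      have e5 : √(60 : ℝ) ≠ 0 := by simp
      rw [betaIntegrand, e1, show Real.sign ν * (60 * ν ^ 2) = 60 * (ν * |ν|) by rw [← e2]; ring,
        show -π * (60 * ν ^ 2 * y) = -(60 * π * ν ^ 2 * y) by ring]
      field_simp
    have h6 : exp (-(30 * π * ν ^ 2 * y) : ℂ) =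
        (Real.exp (-(60 * π * ν ^ 2 * y)) : ℂ) * exp (30 * π * ν ^ 2 * y) := by
      rw [Complex.ofReal_exp, ← Complex.exp_add]; push_cast; ring_nf
    have h5' := congrArg ofReal h5
    push_cast at h5' h6
    rw [h6, termY]
    simp only [Function.comp_apply]
    linear_combination -exp (30 * π * ν ^ 2 * y) * h5'

/-- The shadow of `R a b (30 * τ)`. -/
def shadowR (a b : ℝ) (τ : ℂ) : ℂ :=
  ∑' n : ℤ, 30 / √60 * I * (a + n) *
    exp (30 * π * I * (a + n) ^ 2 * τ + 2 * π * I * (a + n) * b)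

lemma differentiableOn_shadowR (a b : ℝ) :
    DifferentiableOn ℂ (shadowR a b) {τ : ℂ | 0 < τ.im} := by
  intro τ₀ h₀
  have h₀' : 0 < τ₀.im := h₀
  have hU : IsOpen {τ : ℂ | τ₀.im / 2 < τ.im} := isOpen_lt continuous_const Complex.continuous_im
  have hmem : τ₀ ∈ {τ : ℂ | τ₀.im / 2 < τ.im} := by
    change τ₀.im / 2 < τ₀.im; linarith
  set c : ℝ := 15 * π * τ₀.im / 2 with hc
  have hc0 : 0 < c := by positivity
  have hsum : Summable fun n : ℤ => 30 / √60 *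
      (Real.exp (1 / (4 * c)) * Real.exp (-c * (a + n) ^ 2)) :=
    ((summable_gauss a hc0).mul_left _).mul_left _
  refine ((differentiableOn_tsum_of_summable_norm hsum (fun n => ?_) hU ?_).differentiableAt
    (hU.mem_nhds hmem)).differentiableWithinAt
  · exact Differentiable.differentiableOn (by fun_prop)
  · intro n τ hτ
    have hτ' : τ₀.im / 2 < τ.im := hτ
    have e1 : ‖exp (30 * π * I * (a + n) ^ 2 * τ + 2 * π * I * (a + n) * b)‖ =
        Real.exp (-(30 * π * (a + n) ^ 2 * τ.im)) := by
      rw [Complex.norm_exp]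
      congr 1
      rw [show (30 * π * I * (a + n) ^ 2 * τ + 2 * π * I * (a + n) * b : ℂ) =
        ((30 * π * (a + n) ^ 2 : ℝ) : ℂ) * (I * τ) + ((2 * π * (a + n) * b : ℝ) : ℂ) * I by
          push_cast; ring, Complex.add_re, Complex.re_ofReal_mul, Complex.re_ofReal_mul,
          Complex.I_mul_re, Complex.I_re]
      ring
    have e2 : ‖(30 / √60 * I * (a + n) : ℂ)‖ = 30 / √60 * |a + n| := by
      rw [show (30 / √60 * I * (a + n) : ℂ) = ((30 / √60 * (a + n) : ℝ) : ℂ) * I by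
        push_cast; ring, norm_mul, Complex.norm_I, mul_one, Complex.norm_real, Real.norm_eq_abs,
        abs_mul, abs_of_pos (by positivity)]
    rw [norm_mul, e1, e2, mul_assoc]
    refine mul_le_mul_of_nonneg_left (le_trans ?_ (abs_mul_exp_le hc0 _)) (by positivity)
    refine mul_le_mul_of_nonneg_left (Real.exp_le_exp.mpr ?_) (abs_nonneg _)
    have : 0 ≤ 30 * π * (a + n) ^ 2 := by positivity
    have := mul_le_mul_of_nonneg_left hτ'.le this
    rw [hc]
    linarith

/-- Real and imaginary part, as complex numbers. -/
def reImCLM : ℂ →L[ℝ] ℂ × ℂ :=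
  (Complex.ofRealCLM.comp Complex.reCLM).prod (Complex.ofRealCLM.comp Complex.imCLM)

lemma reImCLM_apply (τ : ℂ) : reImCLM τ = ((τ.re : ℂ), (τ.im : ℂ)) := rfl

lemma hasShadow_R (a b : ℝ) : HasShadow fun τ => R a b (30 * τ) := by
  have key : ∀ τ₀ : ℂ, 0 < τ₀.im →
      AnalyticAt ℂ (fun p : ℂ × ℂ => ∑' n : ℤ, termX b (a + n) p.1 * termY (a + n) p.2)
        ((τ₀.re : ℂ), (τ₀.im : ℂ)) ∧
      HasSum (fun n : ℤ => deriv (termX b (a + n)) τ₀.re * termY (a + n) τ₀.im)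
        (fderiv ℂ (fun p : ℂ × ℂ => ∑' n : ℤ, termX b (a + n) p.1 * termY (a + n) p.2)
          ((τ₀.re : ℂ), (τ₀.im : ℂ)) (1, 0)) ∧
      HasSum (fun n : ℤ => termX b (a + n) τ₀.re * deriv (termY (a + n)) τ₀.im)
        (fderiv ℂ (fun p : ℂ × ℂ => ∑' n : ℤ, termX b (a + n) p.1 * termY (a + n) p.2)
          ((τ₀.re : ℂ), (τ₀.im : ℂ)) (0, 1)) := by
    intro τ₀ h0
    set y₀ := τ₀.im with hy₀
    have hre : ∀ y ∈ Metric.ball (y₀ : ℂ) (y₀ / 2), y₀ / 2 < y.re ∧ ‖y‖ ≤ 3 * y.re := by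
      intro y hy
      rw [Metric.mem_ball, dist_eq_norm] at hy
      have h1 : |(y - y₀).re| ≤ ‖y - y₀‖ := Complex.abs_re_le_norm _
      have h2 := (abs_lt.mp (h1.trans_lt hy)).1
      rw [Complex.sub_re, Complex.ofReal_re] at h2
      have h3 : ‖y‖ ≤ ‖y - y₀‖ + ‖(y₀ : ℂ)‖ := by
        simpa using norm_add_le (y - y₀) (y₀ : ℂ)
      rw [Complex.norm_real, Real.norm_of_nonneg h0.le] at h3
      constructor <;> linarith
    have him : ∀ x ∈ Metric.ball (τ₀.re : ℂ) (y₀ / 4), x.im ≤ y₀ / 4 := by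
      intro x hx
      rw [Metric.mem_ball, dist_eq_norm] at hx
      have h1 : |(x - τ₀.re).im| ≤ ‖x - τ₀.re‖ := Complex.abs_im_le_norm _
      have h2 := (abs_lt.mp (h1.trans_lt hx)).2
      rw [Complex.sub_im, Complex.ofReal_im] at h2
      linarith
    have hc1 : 0 < 5 / 2 * π * y₀ := by positivity
    have hc2 : 0 < 5 * π * y₀ := by positivity
    have A : _ ∧ _ := ⟨Metric.mem_ball_self (x := (τ₀.re : ℂ)) (show 0 < y₀ / 4 by positivity),
      Metric.mem_ball_self (x := (y₀ : ℂ)) (show 0 < y₀ / 2 by positivity)⟩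
    have he : ∀ n : ℤ, DifferentiableOn ℂ (termX b (a + n)) (Metric.ball (τ₀.re : ℂ) (y₀ / 4)) :=
      fun n => (differentiable_termX b _).differentiableOn
    have hh : ∀ n : ℤ, DifferentiableOn ℂ (termY (a + n)) (Metric.ball (y₀ : ℂ) (y₀ / 2)) :=
      fun n y hy => (differentiableAt_termY _ (by
        have := (hre y hy).1; linarith)).differentiableWithinAt
    -- On these discs `termX` is at most exp(15/2 πy₀ν²) and `termY` at most √3 exp(-15πy₀ν²); the
    -- exponent 10 lies between the two, leaving the decay rates 5/2 and 5.
    have hW : ∀ n : ℤ, 0 < Real.exp (10 * π * y₀ * (a + n) ^ 2) := fun n => Real.exp_pos _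
    have hu := summable_gauss a hc1
    have hv := (summable_gauss a hc2).mul_left √3
    have hue : ∀ n : ℤ, ∀ x ∈ Metric.ball (τ₀.re : ℂ) (y₀ / 4), ‖termX b (a + n) x‖ ≤
        Real.exp (10 * π * y₀ * (a + n) ^ 2) * Real.exp (-(5 / 2 * π * y₀) * (a + n) ^ 2) := by
      intro n x hx
      rw [norm_termX, ← Real.exp_add]
      refine Real.exp_le_exp.mpr ?_
      have : 0 ≤ 30 * π * (a + n) ^ 2 := by positivity
      have := mul_le_mul_of_nonneg_left (him x hx) this
      linarith
    have hvh : ∀ n : ℤ, ∀ y ∈ Metric.ball (y₀ : ℂ) (y₀ / 2), ‖termY (a + n) y‖ *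
        Real.exp (10 * π * y₀ * (a + n) ^ 2) ≤ √3 * Real.exp (-(5 * π * y₀) * (a + n) ^ 2) := by
      intro n y hy
      obtain ⟨h1, h2⟩ := hre y hy
      refine (mul_le_mul_of_nonneg_right (norm_termY_le _ (by linarith) h2)
        (Real.exp_pos _).le).trans ?_
      rw [mul_assoc, ← Real.exp_add]
      refine mul_le_mul_of_nonneg_left (Real.exp_le_exp.mpr ?_) (Real.sqrt_nonneg _)
      have : 0 ≤ 30 * π * (a + n) ^ 2 := by positivity
      have := mul_le_mul_of_nonneg_left h1.le this
      linarith
    exact ⟨analyticAt_tsum_mul Metric.isOpen_ball Metric.isOpen_ball A.1 A.2 he hh hW hu hv hue hvh,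
      hasSum_fderiv_tsum_mul Metric.isOpen_ball Metric.isOpen_ball A.1 A.2 he hh hW hu hv hue hvh⟩
  have hloc : ∀ τ₀ : ℂ, 0 < τ₀.im → (fun τ => R a b (30 * τ)) =ᶠ[𝓝 τ₀]
      fun τ => (fun p : ℂ × ℂ => ∑' n : ℤ, termX b (a + n) p.1 * termY (a + n) p.2) (reImCLM τ) := by
    intro τ₀ h0
    filter_upwards [(isOpen_lt continuous_const Complex.continuous_im).mem_nhds h0] with τ hτ
    exact R_eq_tsum a b hτ
  refine ⟨fun τ₀ h0 => ?_, shadowR a b, differentiableOn_shadowR a b, fun τ₀ h0 => ?_⟩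
  · have h1 := (key τ₀ h0).1.restrictScalars (𝕜 := ℝ)
    have h2 : AnalyticAt ℝ (reImCLM : ℂ → ℂ × ℂ) τ₀ := reImCLM.analyticAt τ₀
    exact (h1.comp_of_eq h2 (reImCLM_apply τ₀)).congr (hloc τ₀ h0).symm
  · obtain ⟨k1, k2, k3⟩ := key τ₀ h0
    have h1 := k1.differentiableAt.hasFDerivAt.restrictScalars ℝ
    rw [← reImCLM_apply] at h1
    have h2 := (h1.comp τ₀ reImCLM.hasFDerivAt).congr_of_eventuallyEq (hloc τ₀ h0)
    have e1 : reImCLM 1 = (1, 0) := by rw [reImCLM_apply]; simp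
    have e2 : reImCLM I = (0, 1) := by rw [reImCLM_apply]; simp
    rw [dTauBar, h2.fderiv]
    simp only [ContinuousLinearMap.comp_apply, ContinuousLinearMap.coe_restrictScalars', e1, e2,
      smul_eq_mul]
    rw [reImCLM_apply, ← k2.tsum_eq, ← k3.tsum_eq, ← tsum_mul_left,
      ← k2.summable.tsum_add (k3.summable.mul_left I), ← tsum_mul_left, shadowR, conj_tsum,
      ← tsum_mul_left]
    -- In ∂x + i∂y the contributions -30πiν² and i · 30πν² of the exponentials cancel, so only the
    -- derivative of β is left.
    refine tsum_congr fun n => ?_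
    rw [(hasDerivAt_termX b (a + n) τ₀.re).deriv, (hasDerivAt_termY (a + n) h0).deriv]
    have e3 : (starRingEnd ℂ) (30 / √60 * I * (a + n) *
        exp (30 * π * I * (a + n) ^ 2 * τ₀ + 2 * π * I * (a + n) * b)) =
        -(30 / √60 * I * (a + n)) * (termX b (a + n) τ₀.re *
          exp (-(30 * π * ((a + n : ℝ) : ℂ) ^ 2 * τ₀.im))) := by
      have e4 : ∀ x : ℝ, (starRingEnd ℂ) (x : ℂ) = x := Complex.conj_ofReal
      have e5 : (starRingEnd ℂ) τ₀ = τ₀.re - τ₀.im * I := by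
        apply Complex.ext <;> simp
      rw [map_mul, ← Complex.exp_conj, termX, ← Complex.exp_add]
      congr 1
      · rw [show (30 / √60 * I * (a + n) : ℂ) = ((30 / √60 * (a + n) : ℝ) : ℂ) * I by
          push_cast; ring, map_mul, e4, Complex.conj_I]
        push_cast; ring
      · congr 1
        rw [show (30 * π * I * (a + n) ^ 2 * τ₀ + 2 * π * I * (a + n) * b : ℂ) =
          ((30 * π * (a + n) ^ 2 : ℝ) : ℂ) * I * τ₀ + ((2 * π * (a + n) * b : ℝ) : ℂ) * I by
            push_cast; ring, map_add, map_mul, map_mul, map_mul, e4, e4, Complex.conj_I, e5]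
        push_cast
        linear_combination (30 * π * (a + n) ^ 2 * τ₀.im : ℂ) * I_sq
    rw [e3]
    push_cast
    ring

lemma isOpen_upperHalf : IsOpen {τ : ℂ | 0 < τ.im} :=
  isOpen_lt continuous_const Complex.continuous_im

namespace HasShadow

variable {f g : ℂ → ℂ}

lemma differentiableAt (hf : HasShadow f) {τ : ℂ} (hτ : 0 < τ.im) : DifferentiableAt ℝ f τ :=
  (hf.1 τ hτ).differentiableAt

lemma add (hf : HasShadow f) (hg : HasShadow g) : HasShadow fun τ => f τ + g τ := by
  obtain ⟨f', hf', hf2⟩ := hf.2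
  obtain ⟨g', hg', hg2⟩ := hg.2
  refine ⟨fun τ hτ => (hf.1 τ hτ).add (hg.1 τ hτ), fun τ => f' τ + g' τ, hf'.add hg',
    fun τ hτ => ?_⟩
  rw [map_add, mul_add, ← hf2 τ hτ, ← hg2 τ hτ, dTauBar, dTauBar, dTauBar,
    fderiv_fun_add (hf.differentiableAt hτ) (hg.differentiableAt hτ)]
  simp only [add_apply, smul_eq_mul]
  ring

lemma const_mul (hf : HasShadow f) (c : ℂ) : HasShadow fun τ => c * f τ := by
  obtain ⟨f', hf', hf2⟩ := hf.2
  refine ⟨fun τ hτ => analyticAt_const.mul (hf.1 τ hτ), fun τ => (starRingEnd ℂ) c * f' τ,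
    hf'.const_mul _, fun τ hτ => ?_⟩
  have h := (hf.differentiableAt hτ).hasFDerivAt.const_mul c
  rw [map_mul, Complex.conj_conj, mul_left_comm, ← hf2 τ hτ, dTauBar, dTauBar, h.fderiv]
  simp only [smul_apply, smul_eq_mul]
  ring

lemma of_differentiableOn (hf : DifferentiableOn ℂ f {τ : ℂ | 0 < τ.im}) : HasShadow f := by
  refine ⟨fun τ hτ => (hf.analyticAt (isOpen_upperHalf.mem_nhds hτ)).restrictScalars, fun _ => 0,
    differentiableOn_const _, fun τ hτ => ?_⟩
  have h := ((hf.differentiableAt (isOpen_upperHalf.mem_nhds hτ)).hasDerivAt.hasFDerivAt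
    ).restrictScalars ℝ
  rw [dTauBar, h.fderiv, map_zero, mul_zero]
  simp only [ContinuousLinearMap.coe_restrictScalars', ContinuousLinearMap.toSpanSingleton_apply,
    smul_eq_mul]
  linear_combination (1 / 2 : ℂ) * deriv f τ * I_sq

end HasShadow

lemma hasFDerivAt_conj_div_sqrt {g : ℂ → ℂ} {τ g' : ℂ} (hτ : 0 < τ.im) (hg : HasDerivAt g g' τ) :
    ∃ k : ℂ →L[ℝ] ℂ, HasFDerivAt (fun w : ℂ => (√w.im : ℂ)⁻¹ * (starRingEnd ℂ) (g w)) k τ ∧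
      k 1 = (√τ.im : ℂ)⁻¹ * (starRingEnd ℂ) g' ∧
      k I = -I * ((√τ.im : ℂ)⁻¹ * (starRingEnd ℂ) g') -
        (√τ.im : ℂ)⁻¹ / (2 * τ.im) * (starRingEnd ℂ) (g τ) := by
  have hs : √τ.im ≠ 0 := (Real.sqrt_pos.mpr hτ).ne'
  have h1 : HasDerivAt (fun t : ℝ => (√t)⁻¹) (-(1 / (2 * √τ.im)) / √τ.im ^ 2) τ.im :=
    (Real.hasDerivAt_sqrt hτ.ne').inv hs
  have h2 := (h1.ofReal_comp).hasFDerivAt.comp τ Complex.imCLM.hasFDerivAt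
  have h3 := (Complex.conjCLE.toContinuousLinearMap.hasFDerivAt (x := g τ)).comp τ
    (hg.hasFDerivAt.restrictScalars ℝ)
  have h4 := h2.mul h3
  refine ⟨_, (h4.congr_of_eventuallyEq (Eventually.of_forall fun w => ?_)), ?_, ?_⟩
  · simp
  · simp
  · simp
    rw [← Complex.ofReal_pow, Real.sq_sqrt hτ.le]
    have hs' : (√τ.im : ℂ) ≠ 0 := by exact_mod_cast hs
    have ht : (τ.im : ℂ) ≠ 0 := by exact_mod_cast hτ.ne'
    field_simp
    ring

/-- If ∂f/∂τ̄ = y^(-1/2) ḡ with g holomorphic, then ∂/∂τ acts only on y^(-1/2) and gives (i/4)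
y^(-3/2) ḡ. Hence -4y² ∂²f/∂τ∂τ̄ = -i y^(1/2) ḡ cancels iy ∂f/∂τ̄, and only the constant 3/16
remains. -/
lemma casimir_eq_of_hasShadow {n : ℕ} {f : ℂ → Fin n → ℂ} (hf : ∀ i, HasShadow fun τ => f τ i)
    {τ : ℂ} (hτ : 0 < τ.im) : casimir f τ = (3 / 16 : ℂ) • f τ := by
  choose g hg hfg using fun i => (hf i).2
  have hd : ∀ w : ℂ, 0 < w.im → ∀ v i, fderiv ℝ f w v i = fderiv ℝ (fun z => f z i) w v := by
    intro w hw v i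
    have := hasFDerivAt_pi.mpr fun i => ((hf i).differentiableAt hw).hasFDerivAt
    rw [this.fderiv]
    rfl
  have hbar : ∀ w : ℂ, 0 < w.im →
      dTauBar f w = fun i => (√w.im : ℂ)⁻¹ * (starRingEnd ℂ) (g i w) := by
    intro w hw
    ext i
    rw [← hfg i w hw, dTauBar, dTauBar]
    simp only [Pi.smul_apply, Pi.add_apply, hd w hw]
  choose k hk hk1 hk2 using fun i => hasFDerivAt_conj_div_sqrt hτ
    ((hg i).differentiableAt (isOpen_upperHalf.mem_nhds hτ)).hasDerivAt
  have hev : dTauBar f =ᶠ[𝓝 τ] fun w i => (√w.im : ℂ)⁻¹ * (starRingEnd ℂ) (g i w) := by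
    filter_upwards [isOpen_upperHalf.mem_nhds hτ] with w hw
    exact hbar w hw
  have h2 : HasFDerivAt (dTauBar f) (ContinuousLinearMap.pi k) τ :=
    (hasFDerivAt_pi.mpr hk).congr_of_eventuallyEq hev
  have ht : (τ.im : ℂ) ≠ 0 := by exact_mod_cast hτ.ne'
  rw [casimir, hbar τ hτ, dTau, h2.fderiv]
  ext i
  simp only [Pi.smul_apply, Pi.add_apply, Pi.sub_apply, ContinuousLinearMap.pi_apply, hk1, hk2,
    smul_eq_mul]
  field_simp
  ring_nf
  simp only [Complex.I_sq]
  ring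

lemma analyticOnNhd_of_hasShadow {n : ℕ} {f : ℂ → Fin n → ℂ} (hf : ∀ i, HasShadow fun τ => f τ i) :
    AnalyticOnNhd ℝ f {τ : ℂ | 0 < τ.im} :=
  fun τ hτ => AnalyticAt.pi fun i => (hf i).1 τ hτ

/-! ### The holomorphic vector -/

lemma differentiableOn_heckeTerm {e : ℕ → ℤ → ℤ}
    (he : ∀ (n : ℕ) (j : ℤ), -(n : ℤ) ≤ j → j ≤ n → (n : ℤ) ≤ e n j) (k : ℕ → ℕ) (n : ℕ) :
    Differentiable ℂ (heckeTerm e k n) := by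
  refine (Differentiable.fun_sum (u := Finset.Icc (-(n : ℤ)) n)
    (A := fun j q => (-1 : ℂ) ^ j * q ^ e n j * (1 - q ^ k n)) fun j hj => ?_)
  rw [Finset.mem_Icc] at hj
  obtain ⟨m, hm⟩ := Int.eq_ofNat_of_zero_le ((Int.natCast_nonneg n).trans (he n j hj.1 hj.2))
  simp only [hm, zpow_natCast]
  fun_prop

lemma differentiableOn_heckeSum {e : ℕ → ℤ → ℤ}
    (he : ∀ (n : ℕ) (j : ℤ), -(n : ℤ) ≤ j → j ≤ n → (n : ℤ) ≤ e n j) (k : ℕ → ℕ) :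
    DifferentiableOn ℂ (heckeSum e k) (Metric.ball 0 1) := by
  intro q hq
  rw [mem_ball_zero_iff] at hq
  obtain ⟨r, hqr, hr⟩ := exists_between hq
  have hr0 := (norm_nonneg q).trans hqr.le
  refine ((differentiableOn_tsum_of_summable_norm (summable_hecke_bound hr0 hr)
    (fun n => (differentiableOn_heckeTerm he k n).differentiableOn) Metric.isOpen_ball
    fun n w hw => ?_).differentiableAt (Metric.isOpen_ball.mem_nhds (x := q) (s := Metric.ball 0 r)
      (by simpa using hqr))).differentiableWithinAt
  exact norm_heckeTerm_le he k ((mem_ball_zero_iff.mp hw).le) hr n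

lemma differentiableOn_partialTheta :
    DifferentiableOn ℂ (fun q : ℂ => ∑' m : ℕ, (-1 : ℂ) ^ (m + 1) * q ^ ((m + 1) ^ 2 + (m + 1)))
      (Metric.ball 0 1) := by
  intro q hq
  rw [mem_ball_zero_iff] at hq
  obtain ⟨r, hqr, hr⟩ := exists_between hq
  have hr0 := (norm_nonneg q).trans hqr.le
  refine ((differentiableOn_tsum_of_summable_norm (summable_geometric_of_lt_one hr0 hr)
    (fun n => by fun_prop) Metric.isOpen_ball
    fun n w hw => ?_).differentiableAt (Metric.isOpen_ball.mem_nhds (x := q) (s := Metric.ball 0 r)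
      (by simpa using hqr))).differentiableWithinAt
  have hw' : ‖w‖ ≤ r := (mem_ball_zero_iff.mp hw).le
  rw [norm_mul, norm_pow, norm_pow, norm_neg, norm_one, one_pow, one_mul]
  exact (pow_le_pow_left₀ (norm_nonneg _) hw' _).trans
    (pow_le_pow_of_le_one hr0 hr.le (by nlinarith))

lemma differentiableOn_eulerProd_sq :
    DifferentiableOn ℂ (fun q => eulerProd (q ^ 2)) (Metric.ball 0 1) :=
  differentiableOn_eulerProd.comp (f := fun q : ℂ => q ^ 2) (by fun_prop) fun q hq => by
    rw [mem_ball_zero_iff] at hq ⊢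
    exact norm_sq_lt_one hq

lemma differentiableOn_qPoch_div :
    DifferentiableOn ℂ (fun q => qPoch (-q) q / qPoch q q) (Metric.ball 0 1) := by
  have h0 : ∀ q ∈ Metric.ball (0 : ℂ) 1, eulerProd q ≠ 0 := fun q hq =>
    eulerProd_ne_zero (mem_ball_zero_iff.mp hq)
  refine (((differentiableOn_eulerProd_sq.div differentiableOn_eulerProd h0).div
    differentiableOn_eulerProd h0)).congr fun q hq => ?_
  rw [qPoch_neg_self (mem_ball_zero_iff.mp hq), qPoch_self]
  rfl

lemma differentiableOn_qPoch_sq_div :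
    DifferentiableOn ℂ (fun q => qPoch (-q) (q ^ 2) / qPoch (q ^ 2) (q ^ 2)) (Metric.ball 0 1) := by
  have h0 : ∀ q ∈ Metric.ball (0 : ℂ) 1, eulerProd (q ^ 2) ≠ 0 := fun q hq =>
    eulerProd_ne_zero (norm_sq_lt_one (mem_ball_zero_iff.mp hq))
  have h1 : DifferentiableOn ℂ (fun q => eulerProd (-q)) (Metric.ball 0 1) :=
    differentiableOn_eulerProd.comp (f := fun q : ℂ => -q) (by fun_prop) fun q hq => by
      simpa using hq
  refine (((h1.div differentiableOn_eulerProd_sq h0).div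
    differentiableOn_eulerProd_sq h0)).congr fun q hq => ?_
  rw [qPoch_neg_sq (mem_ball_zero_iff.mp hq), qPoch_self]
  rfl

lemma differentiableOn_psi0 : DifferentiableOn ℂ psi0 (Metric.ball 0 1) := by
  refine DifferentiableOn.congr ?_ fun q _ => psi0_eq q
  exact ((differentiableOn_qPoch_div.mul (((differentiableOn_partialTheta.const_mul 2).const_add
    1).sub ((differentiableOn_heckeSum le_exponent_psi0 _).const_mul 2))).sub_const 1).div_const 2

lemma differentiableOn_psi1 : DifferentiableOn ℂ psi1 (Metric.ball 0 1) :=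
  (differentiableOn_qPoch_div.mul (differentiableOn_heckeSum le_exponent_psi1 _)).congr
    fun q _ => psi1_eq q

lemma differentiableOn_phi0 : DifferentiableOn ℂ phi0 (Metric.ball 0 1) :=
  (differentiableOn_qPoch_sq_div.mul (differentiableOn_heckeSum le_exponent_phi0 _)).congr
    fun q _ => phi0_eq q

lemma differentiableOn_phi1 : DifferentiableOn ℂ phi1 (Metric.ball 0 1) :=
  ((differentiableOn_id.mul differentiableOn_qPoch_sq_div).mul
    (differentiableOn_heckeSum le_exponent_phi1 _)).congr fun q _ => phi1_eq q

lemma phi0_zero : phi0 0 = 1 := by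
  have h : heckeSum (fun n j => 5 * (n : ℤ) ^ 2 + 2 * n - 3 * j ^ 2 - j) (fun n => 6 * n + 3) 0
      = 1 := by
    rw [heckeSum, tsum_eq_single 0]
    · simp [heckeTerm]
    · intro n hn
      refine Finset.sum_eq_zero fun j hj => ?_
      rw [Finset.mem_Icc] at hj
      have := le_exponent_phi0 n j hj.1 hj.2
      rw [zero_zpow _ (this.trans_lt' (by positivity)).ne', mul_zero, zero_mul]
  rw [phi0_eq, h]
  simp [qPoch]

lemma differentiable_qpow (r : ℚ) : Differentiable ℂ (qpow r) := by
  unfold qpow; fun_prop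

lemma differentiableOn_comp_qpow {f : ℂ → ℂ} (hf : DifferentiableOn ℂ f (Metric.ball 0 1)) {r : ℚ}
    (hr : 0 < r) : DifferentiableOn ℂ (fun τ => f (qpow r τ)) {τ : ℂ | 0 < τ.im} :=
  hf.comp (differentiable_qpow r).differentiableOn fun τ hτ => by
    rw [mem_ball_zero_iff]; exact norm_qpow_lt_one hr hτ

lemma differentiableOn_comp_neg {f : ℂ → ℂ} (hf : DifferentiableOn ℂ f (Metric.ball 0 1)) :
    DifferentiableOn ℂ (fun q => f (-q)) (Metric.ball 0 1) :=
  hf.comp (f := fun q : ℂ => -q) (by fun_prop) fun q hq => by simpa using hq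

/-- Properties that pass to linear combinations of products `q ^ s * f (q ^ r)` hold for `F52`. -/
lemma F52_induction {p : (ℂ → ℂ) → Prop} (hc : ∀ (c : ℂ) (f : ℂ → ℂ), p f → p fun τ => c * f τ)
    (h : ∀ (s r : ℚ) (f : ℂ → ℂ), -1 ≤ s → 1 / 2 ≤ r → DifferentiableOn ℂ f (Metric.ball 0 1) →
      p fun τ => qpow s τ * f (qpow r τ)) (i : Fin 6) : p fun τ => F52 τ i := by
  have aux : ∀ f g : ℂ → ℂ, p f → (∀ τ, g τ = f τ) → p g := fun f g hf hg => by
    rwa [funext hg]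
  fin_cases i
  · exact aux _ _ (hc 2 _ (h (-1 / 60) 1 psi0 (by norm_num) (by norm_num) differentiableOn_psi0))
      fun τ => by simp [F52, mul_assoc]
  · exact aux _ _ (hc 2 _ (h (11 / 60) 1 psi1 (by norm_num) (by norm_num) differentiableOn_psi1))
      fun τ => by simp [F52, mul_assoc]
  · exact aux _ _ (h (-1 / 240) (1 / 2) _ (by norm_num) (by norm_num)
      (differentiableOn_comp_neg differentiableOn_phi0)) fun τ => by simp [F52]
  · exact aux _ _ (hc (-1) _ (h (-49 / 240) (1 / 2) _ (by norm_num) (by norm_num)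
      (differentiableOn_comp_neg differentiableOn_phi1))) fun τ => by simp [F52]
  · exact aux _ _ (h (-1 / 240) (1 / 2) _ (by norm_num) (by norm_num) differentiableOn_phi0)
      fun τ => by simp [F52]
  · exact aux _ _ (h (-49 / 240) (1 / 2) _ (by norm_num) (by norm_num) differentiableOn_phi1)
      fun τ => by simp [F52]

lemma differentiableOn_F52 (i : Fin 6) :
    DifferentiableOn ℂ (fun τ => F52 τ i) {τ : ℂ | 0 < τ.im} :=
  F52_induction (p := fun f => DifferentiableOn ℂ f {τ : ℂ | 0 < τ.im})
    (fun c _ hf => hf.const_mul c)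
    (fun s _ _ _ hr hf => (differentiable_qpow s).differentiableOn.mul
      (differentiableOn_comp_qpow hf (by linarith))) i

/-- For y ≥ 1 and r ≥ 1/2 the nome q^r stays in the compact disc of radius exp(-π), where f is
bounded; for s ≥ -1 the power q^s is at most exp(2πy). -/
lemma F52_isBigO (i : Fin 6) : (fun τ => F52 τ i) =O[𝓟 {τ : ℂ | 1 ≤ τ.im}]
    fun τ => Real.exp (2 * π * τ.im) := by
  refine F52_induction (p := fun f => f =O[𝓟 {τ : ℂ | 1 ≤ τ.im}]
    fun τ => Real.exp (2 * π * τ.im)) (fun c _ hf => hf.const_mul_left c)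
    (fun s r f hs hr hf => ?_) i
  have hr' : (1 / 2 : ℝ) ≤ r := by
    have := (Rat.cast_le (K := ℝ)).mpr hr
    push_cast at this
    exact this
  have hs' : (-1 : ℝ) ≤ s := by exact_mod_cast hs
  have hlt : Real.exp (-π) < 1 := Real.exp_lt_one_iff.mpr (neg_lt_zero.mpr Real.pi_pos)
  obtain ⟨C, hC⟩ := (isCompact_closedBall (0 : ℂ) (Real.exp (-π))).exists_bound_of_continuousOn
    (hf.continuousOn.mono (Metric.closedBall_subset_ball hlt))
  refine Asymptotics.IsBigO.of_bound C (eventually_principal.mpr fun τ hτ => ?_)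
  have hτ' : 1 ≤ τ.im := hτ
  have h1 : qpow r τ ∈ Metric.closedBall (0 : ℂ) (Real.exp (-π)) := by
    rw [mem_closedBall_zero_iff, norm_qpow, Real.exp_le_exp]
    have : 1 ≤ 2 * r * τ.im := by nlinarith
    nlinarith [Real.pi_pos]
  have h2 : ‖qpow s τ‖ ≤ Real.exp (2 * π * τ.im) := by
    rw [norm_qpow, Real.exp_le_exp]
    have : 0 ≤ (1 + s) * (2 * π * τ.im) :=
      mul_nonneg (by linarith) (by have := Real.pi_pos; positivity)
    linarith
  have h3 := hC _ h1
  rw [norm_mul, Real.norm_of_nonneg (Real.exp_pos _).le, mul_comm]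
  exact mul_le_mul h3 h2 (norm_nonneg _) ((norm_nonneg _).trans h3)

/-! ### The non-holomorphic vector -/

/-- Properties that pass to linear combinations hold for `G52` if they hold for the functions
`R a b (30 * τ)` with `60 a` and `2 b` integral. -/
lemma G52_induction {p : (ℂ → ℂ) → Prop} (hc : ∀ (c : ℂ) (f : ℂ → ℂ), p f → p fun τ => c * f τ)
    (ha : ∀ f g : ℂ → ℂ, p f → p g → p fun τ => f τ + g τ)
    (h : ∀ (s m : ℤ), 0 < s → s < 60 → p fun τ => R (s / 60) (m / 2) (30 * τ)) (i : Fin 6) :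
    p fun τ => G52 τ i := by
  have aux : ∀ f g : ℂ → ℂ, p f → (∀ τ, g τ = f τ) → p g := fun f g hf hg => by
    rwa [funext hg]
  have hR : ∀ (c : ℂ) (s m : ℤ) (a b : ℝ), 0 < s → s < 60 → s / 60 = a → m / 2 = b →
      p fun τ => c * R a b (30 * τ) := by
    rintro c s m _ _ h1 h2 rfl rfl
    exact hc c _ (h s m h1 h2)
  fin_cases i
  · exact aux _ _ (ha _ _
      (hR (-ζ 12) 2 5 (1 / 30) (5 / 2) (by norm_num) (by norm_num) (by norm_num) (by norm_num))
      (hR (-(ζ 12)⁻¹) 22 5 (11 / 30) (5 / 2) (by norm_num) (by norm_num) (by norm_num)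
        (by norm_num))) fun τ => by simp [G52, unaryVec]; ring
  · exact aux _ _ (ha _ _
      (hR (-ζ 12) 26 5 (13 / 30) (5 / 2) (by norm_num) (by norm_num) (by norm_num) (by norm_num))
      (hR (-(ζ 12)⁻¹) 46 5 (23 / 30) (5 / 2) (by norm_num) (by norm_num) (by norm_num)
        (by norm_num))) fun τ => by simp [G52, unaryVec]; ring
  · exact aux _ _ (ha _ _ (ha _ _ (ha _ _
      (hR (1 / 2) 19 0 (19 / 60) 0 (by norm_num) (by norm_num) (by norm_num) (by norm_num))
      (hR (1 / 2) 29 0 (29 / 60) 0 (by norm_num) (by norm_num) (by norm_num) (by norm_num)))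
      (hR (-1 / 2) 49 0 (49 / 60) 0 (by norm_num) (by norm_num) (by norm_num) (by norm_num)))
      (hR (-1 / 2) 59 0 (59 / 60) 0 (by norm_num) (by norm_num) (by norm_num) (by norm_num)))
      fun τ => by simp [G52, unaryVec]; ring
  · exact aux _ _ (ha _ _ (ha _ _ (ha _ _
      (hR (1 / 2) 13 0 (13 / 60) 0 (by norm_num) (by norm_num) (by norm_num) (by norm_num))
      (hR (1 / 2) 23 0 (23 / 60) 0 (by norm_num) (by norm_num) (by norm_num) (by norm_num)))
      (hR (-1 / 2) 43 0 (43 / 60) 0 (by norm_num) (by norm_num) (by norm_num) (by norm_num)))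
      (hR (-1 / 2) 53 0 (53 / 60) 0 (by norm_num) (by norm_num) (by norm_num) (by norm_num)))
      fun τ => by simp [G52, unaryVec]; ring
  · exact aux _ _ (ha _ _ (ha _ _ (ha _ _
      (hR (-(ζ 24 ^ (-5 : ℤ)) / 2) 19 5 (19 / 60) (5 / 2) (by norm_num) (by norm_num) (by norm_num)
        (by norm_num))
      (hR (-(ζ 24 ^ 5) / 2) 29 5 (29 / 60) (5 / 2) (by norm_num) (by norm_num) (by norm_num)
        (by norm_num)))
      (hR (-ζ 24 / 2) 49 5 (49 / 60) (5 / 2) (by norm_num) (by norm_num) (by norm_num)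
        (by norm_num)))
      (hR (-(ζ 24)⁻¹ / 2) 59 5 (59 / 60) (5 / 2) (by norm_num) (by norm_num) (by norm_num)
        (by norm_num)))
      fun τ => by simp [G52, unaryVec]; ring
  · exact aux _ _ (ha _ _ (ha _ _ (ha _ _
      (hR (-ζ 24 / 2) 13 5 (13 / 60) (5 / 2) (by norm_num) (by norm_num) (by norm_num)
        (by norm_num))
      (hR (-(ζ 24)⁻¹ / 2) 23 5 (23 / 60) (5 / 2) (by norm_num) (by norm_num) (by norm_num)
        (by norm_num)))
      (hR (-(ζ 24 ^ (-5 : ℤ)) / 2) 43 5 (43 / 60) (5 / 2) (by norm_num) (by norm_num) (by norm_num)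
        (by norm_num)))
      (hR (-(ζ 24 ^ 5) / 2) 53 5 (53 / 60) (5 / 2) (by norm_num) (by norm_num) (by norm_num)
        (by norm_num)))
      fun τ => by simp [G52, unaryVec]; ring

lemma hasShadow_G52 (i : Fin 6) : HasShadow fun τ => G52 τ i :=
  G52_induction (p := HasShadow) (fun c _ hf => hf.const_mul c) (fun _ _ hf hg => hf.add hg)
    (fun s m _ _ => hasShadow_R (s / 60) (m / 2)) i

/-- Linear combinations of bounded functions are bounded. -/
lemma G52_isBigO {X : Type*} {l : Filter X} {u : X → ℂ}
    (h : ∀ (s m : ℤ), 0 < s → s < 60 →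
      (fun x => R (s / 60) (m / 2) (30 * u x)) =O[l] fun _ => (1 : ℝ)) (i : Fin 6) :
    (fun x => G52 (u x) i) =O[l] fun _ => (1 : ℝ) :=
  G52_induction (p := fun f => (fun x => f (u x)) =O[l] fun _ => (1 : ℝ))
    (fun c _ hf => hf.const_mul_left c) (fun _ _ hf hg => hf.add hg) h i

lemma R_isBigO (a b : ℝ) :
    (fun τ => R a b (30 * τ)) =O[𝓟 {τ : ℂ | 1 ≤ τ.im}] fun _ => (1 : ℝ) := by
  have hc : 0 < 30 * π := by have := Real.pi_pos; positivity
  have hs := (summable_gauss a hc).mul_left √3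
  refine Asymptotics.IsBigO.of_bound (∑' n : ℤ, √3 * Real.exp (-(30 * π) * (a + n) ^ 2))
    (eventually_principal.mpr fun τ hτ => ?_)
  have hτ' : 1 ≤ τ.im := hτ
  have h0 : 0 < τ.im := by linarith
  rw [norm_one, mul_one, R_eq_tsum a b h0]
  refine tsum_of_norm_bounded hs.hasSum fun n => ?_
  have h1 := norm_termY_le (a + n) (y := (τ.im : ℂ)) (by simpa using h0) (by
    rw [Complex.norm_real, Real.norm_of_nonneg h0.le, Complex.ofReal_re]; linarith)
  have h2 := norm_termX b (a + n) τ.re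
  rw [Complex.ofReal_im, mul_zero, Real.exp_zero] at h2
  rw [norm_mul]
  rw [h2, one_mul]
  refine h1.trans (mul_le_mul_of_nonneg_left (Real.exp_le_exp.mpr ?_) (Real.sqrt_nonneg _))
  rw [Complex.ofReal_re]
  have : 0 ≤ 30 * π * (a + n) ^ 2 := by positivity
  nlinarith

/-! ### The modular vector -/

lemma HasShadow.congr {f g : ℂ → ℂ} (hf : HasShadow f) (h : ∀ τ : ℂ, 0 < τ.im → g τ = f τ) :
    HasShadow g := by
  obtain ⟨k, hk, hk2⟩ := hf.2
  have hev : ∀ τ : ℂ, 0 < τ.im → g =ᶠ[𝓝 τ] f := fun τ hτ => by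
    filter_upwards [isOpen_upperHalf.mem_nhds hτ] with w hw
    exact h w hw
  refine ⟨fun τ hτ => (hf.1 τ hτ).congr (hev τ hτ).symm, k, hk, fun τ hτ => ?_⟩
  rw [← hk2 τ hτ, dTauBar, dTauBar, (hev τ hτ).fderiv_eq]

/-- Taken from H = F - G rather than from the definition: F is holomorphic and G is a combination of
the series `R`. -/
lemma hasShadow_H52 (i : Fin 6) : HasShadow fun τ => H52 τ i := by
  refine ((HasShadow.of_differentiableOn (differentiableOn_F52 i)).add
    ((hasShadow_G52 i).const_mul (-1))).congr fun τ hτ => ?_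
  rw [F52_eq_add hτ, Pi.add_apply]
  ring

lemma H52_growth : ∃ C K : ℝ, ∀ τ : ℂ, 1 ≤ τ.im → ‖H52 τ‖ ≤ C * Real.exp (K * τ.im) := by
  have h1 : (fun _ => (1 : ℝ)) =O[𝓟 {τ : ℂ | 1 ≤ τ.im}] fun τ => Real.exp (2 * π * τ.im) := by
    refine Asymptotics.IsBigO.of_bound 1 (eventually_principal.mpr fun τ hτ => ?_)
    have hτ' : 1 ≤ τ.im := hτ
    rw [norm_one, one_mul, Real.norm_of_nonneg (Real.exp_pos _).le]
    exact Real.one_le_exp (by have := Real.pi_pos; positivity)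
  have h2 : H52 =O[𝓟 {τ : ℂ | 1 ≤ τ.im}] fun τ => Real.exp (2 * π * τ.im) := by
    refine Asymptotics.isBigO_pi.mpr fun i => ?_
    refine ((F52_isBigO i).sub ((G52_isBigO (u := id) (fun s m _ _ => R_isBigO _ _) i).trans
      h1)).congr' (eventually_principal.mpr fun τ hτ => ?_) EventuallyEq.rfl
    have hτ' : 1 ≤ τ.im := hτ
    change F52 τ i - G52 τ i = H52 τ i
    rw [F52_eq_add (by linarith : 0 < τ.im), Pi.add_apply, add_sub_cancel_right]
  obtain ⟨C, hC⟩ := h2.bound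
  refine ⟨C, 2 * π, fun τ hτ => ?_⟩
  have := eventually_principal.mp hC τ hτ
  rwa [Real.norm_of_nonneg (Real.exp_pos _).le] at this

/-- If H vanished, F would equal G, which is bounded for y ≥ 1. But the fifth component of F is
q^(-1/240) φ₀(q^(1/2)), which is unbounded along the imaginary axis because φ₀(0) = 1. -/
lemma exists_H52_ne_zero : ∃ τ : ℂ, 0 < τ.im ∧ H52 τ ≠ 0 := by
  by_contra! hzero
  obtain ⟨C, hC⟩ := (G52_isBigO (u := id) (fun s m _ _ => R_isBigO _ _) 4).bound
  have hq : Tendsto (fun y : ℝ => qpow (1 / 2) (y * I)) atTop (𝓝 0) := by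
    rw [tendsto_zero_iff_norm_tendsto_zero]
    simp only [norm_qpow]
    refine Real.tendsto_exp_atBot.comp ?_
    simp only [Complex.im_ofReal_mul, Complex.I_im, mul_one]
    exact tendsto_id.const_mul_atTop_of_neg (by push_cast; linarith [Real.pi_pos])
  have hφ : Tendsto (fun y : ℝ => ‖phi0 (qpow (1 / 2) (y * I))‖) atTop (𝓝 1) := by
    have h1 : ContinuousAt phi0 0 :=
      (differentiableOn_phi0.differentiableAt (Metric.ball_mem_nhds 0 one_pos)).continuousAt
    have h2 := (h1.tendsto.comp hq).norm
    rwa [phi0_zero, norm_one] at h2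
  have he : Tendsto (fun y : ℝ => ‖qpow (-1 / 240) (y * I)‖) atTop atTop := by
    simp only [norm_qpow]
    refine Real.tendsto_exp_atTop.comp ?_
    simp only [Complex.im_ofReal_mul, Complex.I_im, mul_one]
    exact tendsto_id.const_mul_atTop (by push_cast; linarith [Real.pi_pos])
  obtain ⟨y, hy1, hy2⟩ := (((he.atTop_mul_pos one_pos hφ).eventually_gt_atTop C).and
    (eventually_ge_atTop 1)).exists
  have him : ((y : ℂ) * I).im = y := by simp
  have h3 := eventually_principal.mp hC (y * I) (by rw [Set.mem_ofPred_eq, him]; exact hy2)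
  have h0 : 0 < ((y : ℂ) * I).im := by rw [him]; linarith
  have h4 := congrFun (F52_eq_add h0) 4
  rw [hzero _ h0, zero_add] at h4
  rw [id, ← h4, norm_one, mul_one] at h3
  have h5 : F52 (y * I) 4 = qpow (-1 / 240) (y * I) * phi0 (qpow (1 / 2) (y * I)) := rfl
  rw [h5, norm_mul] at h3
  linarith

/-! ### Boundedness at rational points -/

/-- Alternating sums of interlacing decreasing sequences with values in `[0, 1]`. -/
lemma abs_sum_sub_le_one {A B : ℕ → ℝ} (hA : ∀ k, 0 ≤ A k) (hB : ∀ k, 0 ≤ B k) (hA0 : A 0 ≤ 1)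
    (hB0 : B 0 ≤ 1) (hAB : ∀ k, A (k + 1) ≤ B k) (hBA : ∀ k, B (k + 1) ≤ A k) (K : ℕ) :
    |∑ k ∈ Finset.range K, (A k - B k)| ≤ 1 := by
  have h1 : ∑ k ∈ Finset.range K, (A k - B k) ≤ A 0 - A K := by
    induction K with
    | zero => simp
    | succ K ih => rw [Finset.sum_range_succ]; linarith [hAB K]
  have h2 : B K - B 0 ≤ ∑ k ∈ Finset.range K, (A k - B k) := by
    clear h1
    induction K with
    | zero => simp
    | succ K ih => rw [Finset.sum_range_succ]; linarith [hBA K]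
  rw [abs_le]
  constructor <;> linarith [hA K, hB K]

/-- The absolute value of `termY x t` for `x ≠ 0`. -/
def betaExp (t x : ℝ) : ℝ := β (60 * x ^ 2 * t) * Real.exp (30 * π * x ^ 2 * t)

lemma termY_eq (ν : ℝ) {t : ℝ} (ht : 0 < t) : termY ν t = ((Real.sign ν * betaExp t ν : ℝ) : ℂ) := by
  rcases eq_or_ne ν 0 with h | h
  · rw [h, termY]; simp
  · have h1 := betaC_ofReal (show 0 < 60 * ν ^ 2 * t by positivity)
    push_cast at h1
    rw [termY, h1, betaExp]
    push_cast
    rfl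

lemma betaExp_nonneg {t : ℝ} (ht : 0 < t) (x : ℝ) : 0 ≤ betaExp t x :=
  mul_nonneg (beta_nonneg (by positivity)) (Real.exp_pos _).le

/-- With X = 60x²t the function is β(X) exp(πX), decreasing by `beta_mul_exp_antitone`, times the
decreasing factor exp(-πX/2). -/
lemma betaExp_antitone {t x y : ℝ} (ht : 0 < t) (hx : 0 ≤ x) (hxy : x ≤ y) :
    betaExp t y ≤ betaExp t x := by
  have hsq : x ^ 2 ≤ y ^ 2 := pow_le_pow_left₀ hx hxy 2
  have key : ∀ z : ℝ, betaExp t z = (β (60 * z ^ 2 * t) * Real.exp (π * (60 * z ^ 2 * t))) *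
      Real.exp (-(30 * π * z ^ 2 * t)) := fun z => by
    rw [betaExp, mul_assoc (β _), ← Real.exp_add]
    ring_nf
  rw [key, key]
  have hpi := Real.pi_pos
  refine mul_le_mul (beta_mul_exp_antitone (by positivity) (by gcongr))
    (Real.exp_le_exp.mpr (neg_le_neg (by gcongr))) (Real.exp_pos _).le
    (mul_nonneg (beta_nonneg (by positivity)) (Real.exp_pos _).le)

lemma betaExp_le_one {t x : ℝ} (ht : 0 < t) (hx : 0 ≤ x) : betaExp t x ≤ 1 :=
  (betaExp_antitone ht le_rfl hx).trans_eq (by simp [betaExp, beta_zero])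

lemma betaExp_neg (t x : ℝ) : betaExp t (-x) = betaExp t x := by simp [betaExp]

/-- The class c + Nℤ consists of the positive points c + kN and the negatives of N - c + kN. Each
sequence is one step behind the other at most, so the values interlace and carry opposite signs; the
bound is uniform in t. -/
lemma norm_tsum_termY_le {t c N : ℝ} (ht : 0 < t) (hc : 0 < c) (hcN : c < N)
    (hs : Summable fun k : ℤ => termY (c + k * N) t) : ‖∑' k : ℤ, termY (c + k * N) t‖ ≤ 1 := by
  have hN : 0 < N := hc.trans hcN
  have h1 := HasSum.nat_add_neg_add_one hs.hasSum
  have hkN : ∀ k : ℕ, 0 ≤ (k : ℝ) * N := fun k => by positivity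
  have h2 : ∀ k : ℕ, termY (c + ((k : ℤ) : ℝ) * N) t +
      termY (c + ((-((k : ℤ) + 1) : ℤ) : ℝ) * N) t =
      ((betaExp t (c + k * N) - betaExp t (N - c + k * N) : ℝ) : ℂ) := by
    intro k
    have hk := hkN k
    push_cast
    rw [show c + -((k : ℝ) + 1) * N = -(N - c + k * N) by ring, termY_eq _ ht, termY_eq _ ht,
      betaExp_neg, Real.sign_of_pos (by positivity), Real.sign_of_neg (by linarith)]
    push_cast
    ring
  simp only [h2] at h1
  refine le_of_tendsto h1.tendsto_sum_nat.norm (Eventually.of_forall fun K => ?_)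
  rw [← Complex.ofReal_sum, Complex.norm_real]
  refine abs_sum_sub_le_one (A := fun k => betaExp t (c + k * N))
    (B := fun k => betaExp t (N - c + k * N)) (fun k => betaExp_nonneg ht _)
    (fun k => betaExp_nonneg ht _) (betaExp_le_one ht (by push_cast; linarith))
    (betaExp_le_one ht (by push_cast; linarith)) (fun k => ?_) (fun k => ?_) K
  · have := hkN k
    exact betaExp_antitone ht (by linarith) (by push_cast; linarith)
  · have := hkN k
    exact betaExp_antitone ht (by linarith) (by push_cast; linarith)

lemma tsum_residues_int {f : ℤ → ℂ} (hf : Summable f) (N : ℕ) [NeZero N] :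
    ∑' n, f n = ∑ r : Fin N, ∑' k : ℤ, f (k * N + (r : ℕ)) := by
  let e : Fin N × ℤ ≃ ℤ := (Equiv.prodComm _ _).trans (Int.divModEquiv N).symm
  rw [← e.tsum_eq, (show Summable fun c => f (e c) from e.summable_iff.mpr hf).tsum_prod,
    tsum_fintype]
  rfl

lemma summable_termY (a : ℝ) {t : ℝ} (ht : 0 < t) : Summable fun n : ℤ => termY (a + n) t := by
  have hc : 0 < 30 * π * t := by have := Real.pi_pos; positivity
  refine Summable.of_norm_bounded ((summable_gauss a hc).mul_left √3) fun n => ?_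
  refine (norm_termY_le (a + n) (y := (t : ℂ)) (by simpa using ht) ?_).trans_eq ?_
  · rw [Complex.norm_real, Real.norm_of_nonneg ht.le, Complex.ofReal_re]; linarith
  · rw [Complex.ofReal_re]; ring_nf

lemma norm_termX_ofReal (b ν x : ℝ) : ‖termX b ν x‖ = 1 := by
  rw [norm_termX, Complex.ofReal_im, mul_zero, Real.exp_zero]

/-- At x = p/q the phase is periodic modulo 2q since 60ν and 2b are integers; the period q alone
could leave a sign. -/
lemma termX_add_mul (s m p r k : ℤ) {q : ℕ} (hq : q ≠ 0) :
    termX (m / 2) (s / 60 + (k * (2 * q) + r)) (p / q : ℝ) =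
      termX (m / 2) (s / 60 + r) (p / q : ℝ) := by
  have hq' : (q : ℂ) ≠ 0 := by exact_mod_cast hq
  rw [termX, termX, Complex.exp_eq_exp_iff_exists_int]
  refine ⟨-(p * k * s + 60 * p * k * r + 60 * p * q * k ^ 2 + k * q * m), ?_⟩
  push_cast
  field_simp
  ring

/-- On each of the 2q residue classes the phase is constant and of modulus 1, so the class
contributes at most 1. The condition 0 < s < 60 places the representative s/60 + r strictly between
0 and 2q. -/
lemma norm_R_le (s m p : ℤ) {q : ℕ} (hq : q ≠ 0) (h0 : 0 < s) (h60 : s < 60) {t : ℝ} (ht : 0 < t) :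
    ‖R (s / 60) (m / 2) (30 * (((p / q : ℝ) : ℂ) + t * I))‖ ≤ 2 * q := by
  have : NeZero (2 * q) := ⟨by omega⟩
  have hre : (((p / q : ℝ) : ℂ) + t * I).re = p / q := by simp
  have him : (((p / q : ℝ) : ℂ) + t * I).im = t := by simp
  have hY := summable_termY (s / 60) ht
  have hs : Summable fun n : ℤ =>
      termX (m / 2) (s / 60 + n) (p / q : ℝ) * termY (s / 60 + n) t :=
    Summable.of_norm_bounded hY.norm fun n => by rw [norm_mul, norm_termX_ofReal, one_mul]
  rw [R_eq_tsum _ _ (by rwa [him]), hre, him, tsum_residues_int hs (2 * q)]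
  refine (norm_sum_le _ _).trans ((Finset.sum_le_sum (g := fun _ => (1 : ℝ)) fun r _ => ?_).trans
    (by simp))
  have hinj : Function.Injective fun k : ℤ => k * ((2 * q : ℕ) : ℤ) + ((r : ℕ) : ℤ) := by
    intro k l hkl
    have : ((2 * q : ℕ) : ℤ) ≠ 0 := by exact_mod_cast NeZero.ne (2 * q)
    exact mul_right_cancel₀ this (add_right_cancel hkl)
  have hY' := hY.comp_injective hinj
  have hval : ∀ k : ℤ, (s / 60 : ℝ) + ((k * ((2 * q : ℕ) : ℤ) + ((r : ℕ) : ℤ) : ℤ) : ℝ) =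
      (s / 60 + (r : ℕ)) + k * (2 * q) := fun k => by push_cast; ring
  have hX : ∀ k : ℤ, termX (m / 2)
      (s / 60 + ((k * ((2 * q : ℕ) : ℤ) + ((r : ℕ) : ℤ) : ℤ) : ℝ)) (p / q : ℝ) =
      termX (m / 2) (s / 60 + (((r : ℕ) : ℤ) : ℝ)) (p / q : ℝ) := fun k => by
    rw [← termX_add_mul s m p (r : ℕ) k hq]
    push_cast
    rfl
  have hcN : (s / 60 + (r : ℕ) : ℝ) < 2 * q := by
    have h1 : ((r : ℕ) : ℝ) + 1 ≤ 2 * q := by exact_mod_cast r.isLt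
    have h2 : (s : ℝ) < 60 := by exact_mod_cast h60
    linarith
  have hc : 0 < (s / 60 + (r : ℕ) : ℝ) := by
    have h2 : (0 : ℝ) < s := by exact_mod_cast h0
    positivity
  have hterm : ∀ k : ℤ, termX (m / 2)
        (s / 60 + ((k * ((2 * q : ℕ) : ℤ) + ((r : ℕ) : ℤ) : ℤ) : ℝ)) (p / q : ℝ) *
      termY (s / 60 + ((k * ((2 * q : ℕ) : ℤ) + ((r : ℕ) : ℤ) : ℤ) : ℝ)) t =
      termX (m / 2) (s / 60 + (((r : ℕ) : ℤ) : ℝ)) (p / q : ℝ) *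
        termY ((s / 60 + (r : ℕ)) + k * (2 * q)) t := fun k => by rw [hX, hval]
  rw [tsum_congr hterm, tsum_mul_left, norm_mul, norm_termX_ofReal, one_mul]
  refine norm_tsum_termY_le ht hc hcN (hY'.congr fun k => ?_)
  simp only [Function.comp_apply, hval]

theorem boundedAtRationals_G52 : BoundedAtRationals G52 := by
  intro ξ
  have h : (fun t : ℝ => G52 ((ξ : ℂ) + t * I)) =O[𝓝[>] 0] fun _ => (1 : ℝ) := by
    refine Asymptotics.isBigO_pi.mpr (G52_isBigO (u := fun t : ℝ => (ξ : ℂ) + t * I)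
      fun s m h0 h60 => ?_)
    refine Asymptotics.IsBigO.of_bound (2 * ξ.den) ?_
    filter_upwards [self_mem_nhdsWithin] with t ht
    have h1 := norm_R_le s m ξ.num ξ.den_nz h0 h60 (t := t) ht
    have h2 : (((ξ.num / ξ.den : ℝ) : ℝ) : ℂ) = (ξ : ℂ) := by
      push_cast
      exact (Rat.cast_def ξ).symm
    rw [h2] at h1
    rwa [norm_one, mul_one]
  obtain ⟨C, hC⟩ := h.bound
  exact ⟨C, by simpa using hC⟩

end

end MockTheta

theorem mainTheorem6 :
    (∀ τ : ℂ, 0 < τ.im → MockTheta.F52 τ = MockTheta.H52 τ + MockTheta.G52 τ) ∧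
    MockTheta.IsRealAnalyticModularForm MockTheta.T5 MockTheta.S5 (3 / 16) MockTheta.H52 ∧
    (∀ τ : ℂ, 0 < τ.im → MockTheta.G52 τ = -MockTheta.G51 τ) ∧
    MockTheta.BoundedAtRationals MockTheta.G52 := by
  refine ⟨fun τ hτ => MockTheta.F52_eq_add hτ, ⟨?_, ?_, ?_, ⟨?_, ?_⟩, ?_⟩, fun τ _ => ?_,
    MockTheta.boundedAtRationals_G52⟩
  · exact MockTheta.analyticOnNhd_of_hasShadow MockTheta.hasShadow_H52
  · exact fun τ _ => MockTheta.H52_map_T τ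
  · exact fun τ hτ => MockTheta.H52_map_S hτ
  · exact MockTheta.exists_H52_ne_zero
  · exact fun τ hτ => MockTheta.casimir_eq_of_hasShadow MockTheta.hasShadow_H52 hτ
  · exact MockTheta.H52_growth
  · rw [MockTheta.G52, MockTheta.G51, neg_smul]
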